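/- Let $\lambda\in\mathbb{R}$ with $|\lambda|>1$ and let $\eta>0$, $\Omega_0>0$. Let $W_0,W_1,\dots$ be iid real random variables with a density $f_W$ that is Riemann integrable on every compact interval, and assume that there is a constant $K$ with $E\big[\big|\sum_{i=1}^t\lambda^{-i}W_i\big|^\eta\big]\le K$ for all $t\ge 1$. Let $X_0$ be uniform on $[-\Omega_0/2,\Omega_0/2]$, independent of $(W_t)_{t\ge0}$, and let $X_{t+1}=\lambda X_t+W_t$. For each horizon $n$ let the backwards process $\overleftarrow{X}$ be defined by $\overleftarrow{X}_n=0$ and $\overleftarrow{X}_t=\lambda^{-1}\overleftarrow{X}_{t+1}-\lambda^{-1}W_t$ for $0\le t<n$. For $\Delta>0$ let $Q_\Delta$ be the quantizer that maps its input to a nearest point of the form $k\Delta$, $k\in\mathbb{Z}$. For a random block $U=(U_0,\dots,U_{n-1})$ and real side information $Z$, let $$R_n^{U}(d)=\inf \tfrac1n I(U;Y),\qquad R_n^{U|Z}(d)=\inf\tfrac1n I(U;Y\mid Z),$$ where the infima are over all conditional laws of $Y=(Y_0,\dots,Y_{n-1})$ given $U$, respectively given $(U,Z)$, with $\frac1n\sum_{i<n}E|U_i-Y_i|^\eta\le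 d$, and let $D_n^U(R)=\inf\frac1n\sum_{i<n}E|U_i-Y_i|^\eta$ over all conditional laws of $Y$ given $U$ with $\frac1nI(U;Y)\le R$ (information is measured in bits). Apply these to the blocks $(X_0,\dots,X_{n-1})$ and $(\overleftarrow{X}_0,\dots,\overleftarrow{X}_{n-1})$ (the latter with horizon $n$), and let $R_\infty=\liminf_{n}R_n$ and $D_\infty=\liminf_n D_n$. All these quantities take values in $[0,\infty]$. Then for every $d\ge 0$ the limits below exist and $$R_\infty^{\overleftarrow{X}}(d)=\lim_{\Delta\downarrow 0}\,\lim_{n\to\infty}R_n^{\overleftarrow{X}|Q_\Delta(\overleftarrow{X}_0)}(d)=\lim_{n\to\infty}R_n^{\overleftarrow{X}|\overleftarrow{X}_0}(d)=R_\infty^X(d)-\log_2|\lambda|$$ (the inner limit over $n$ exists for every $\Delta>0$). Moreover, for every $R>\log_2|\lambda|$, $$D_\infty^X(R)=D_\infty^{\overleftarrow{X}}(R-\log_2|\lambda|).$$ Finally, there is a phase transition at the rate $\log_2|\lambda|$: $D_\infty^X(R)=\infty$ for $0\le R<\log_2|\lambda|$, while there is a finite constant $C$ with $D_\infty^X(R)\le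 C$ for all $R>\log_2|\lambda|$. -/

import Mathlib

open MeasureTheory ProbabilityTheory Filter Topology
open scoped ENNReal NNReal

noncomputable section

namespace RateDist

/-! ### Processes and the quantizer -/

/-- The forward process `X (t+1) = lam * X t + w t`, `X 0 = x₀`. -/
def fwd (lam x₀ : ℝ) (w : ℕ → ℝ) : ℕ → ℝ
  | 0 => x₀
  | t + 1 => lam * fwd lam x₀ w t + w t

/-- The backwards-in-time process with horizon `n`, started from `0` at time `n`, after `k` steps,
that is, at time `n - k`. -/
def bwdSteps (lam : ℝ) (w : ℕ → ℝ) (n : ℕ) : ℕ → ℝ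
  | 0 => 0
  | k + 1 => lam⁻¹ * bwdSteps lam w n k - lam⁻¹ * w (n - (k + 1))

/-- The backwards-in-time process with horizon `n` at time `t ≤ n`; the two lemmas below say that
it vanishes at time `n` and obeys `X t = lam⁻¹ * X (t+1) - lam⁻¹ * w t` for `t < n`. -/
def bwd (lam : ℝ) (w : ℕ → ℝ) (n t : ℕ) : ℝ := bwdSteps lam w n (n - t)

theorem bwd_self (lam : ℝ) (w : ℕ → ℝ) (n : ℕ) : bwd lam w n n = 0 := by
  simp [bwd, bwdSteps]

theorem bwd_of_lt (lam : ℝ) (w : ℕ → ℝ) {n t : ℕ} (h : t < n) :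
    bwd lam w n t = lam⁻¹ * bwd lam w n (t + 1) - lam⁻¹ * w t := by
  obtain ⟨k, rfl⟩ : ∃ k, n = t + k + 1 := ⟨n - t - 1, by omega⟩
  have h1 : t + k + 1 - t = k + 1 := by omega
  have h2 : t + k + 1 - (t + 1) = k := by omega
  have h3 : t + k + 1 - (k + 1) = t := by omega
  simp only [bwd, h1, h2, bwdSteps, h3]

/-- The uniform quantizer: `x` is mapped to a nearest point of the form `k * Δ`, `k ∈ ℤ`. -/
def quantize (Δ x : ℝ) : ℝ := round (x / Δ) * Δ

/-- `f : ℝ → ℝ` is Riemann integrable on every compact interval. -/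
def LocallyRiemannIntegrable (f : ℝ → ℝ) : Prop :=
  ∀ I : BoxIntegral.Box (Fin 1),
    BoxIntegral.Integrable I BoxIntegral.IntegrationParams.Riemann (fun x => f (x 0))
      BoxIntegral.BoxAdditiveMap.volume

/-! ### Mutual information (in bits) -/

section Information

variable {α β γ : Type*} [MeasurableSpace α] [MeasurableSpace β] [MeasurableSpace γ]

/-- Mutual information `I(A;B)`, in bits, of a pair `(A, B)` with joint law `ρ`. -/
def mutualInfo (ρ : Measure (α × β)) : ℝ≥0∞ :=
  InformationTheory.klDiv ρ (ρ.fst.prod ρ.snd) / ENNReal.ofReal (Real.log 2)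

/-- Conditional mutual information `I(A;B|C)`, in bits, of a triple `(C, A, B)` with joint law `ρ`:
the divergence of `ρ` from the law under which `A` and `B` are conditionally independent given `C`
with the same conditional marginals. -/
def condMutualInfo [StandardBorelSpace α] [Nonempty α] [StandardBorelSpace β] [Nonempty β]
    (ρ : Measure (γ × α × β)) [IsFiniteMeasure ρ] : ℝ≥0∞ :=
  InformationTheory.klDiv ρ
      (ρ.fst ⊗ₘ (Kernel.fst ρ.condKernel ×ₖ Kernel.snd ρ.condKernel)) /
    ENNReal.ofReal (Real.log 2)

end Information

/-! ### Rate-distortion and distortion-rate functions of blocks -/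

/-- The average distortion `(1/n) ∑ |x i - y i| ^ η` of a block. -/
def blockDist {n : ℕ} (η : ℝ) (x y : Fin n → ℝ) : ℝ≥0∞ :=
  (∑ i, ENNReal.ofReal (|x i - y i| ^ η)) / n

/-- The expected average distortion when a block with law `μ` is sent through the test
channel `κ`. -/
def expDist {n : ℕ} (η : ℝ) (μ : Measure (Fin n → ℝ)) (κ : Kernel (Fin n → ℝ) (Fin n → ℝ)) :
    ℝ≥0∞ :=
  ∫⁻ p, blockDist η p.1 p.2 ∂(μ ⊗ₘ κ)

/-- The rate `(1/n) I(X;Y)` when `X` has law `μ` and `Y` is obtained through the channel `κ`. -/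
def chanRate {n : ℕ} (μ : Measure (Fin n → ℝ)) (κ : Kernel (Fin n → ℝ) (Fin n → ℝ)) : ℝ≥0∞ :=
  mutualInfo (μ ⊗ₘ κ) / n

/-- The rate-distortion function `R_n(d)`, in bits per symbol, of a block of `n` real numbers with
law `μ`. -/
def rateDistortion {n : ℕ} (η : ℝ) (μ : Measure (Fin n → ℝ)) (d : ℝ) : ℝ≥0∞ :=
  ⨅ (κ : Kernel (Fin n → ℝ) (Fin n → ℝ)) (_ : IsMarkovKernel κ)
    (_ : expDist η μ κ ≤ ENNReal.ofReal d), chanRate μ κ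

/-- The distortion-rate function `D_n(R)` of a block of `n` real numbers with law `μ`. -/
def distortionRate {n : ℕ} (η : ℝ) (μ : Measure (Fin n → ℝ)) (R : ℝ) : ℝ≥0∞ :=
  ⨅ (κ : Kernel (Fin n → ℝ) (Fin n → ℝ)) (_ : IsMarkovKernel κ)
    (_ : chanRate μ κ ≤ ENNReal.ofReal R), expDist η μ κ

/-- The conditional rate-distortion function `R_n^{X|Z}(d)`, in bits per symbol, where `ν` is the
joint law of the side information `Z` and of the block `X`. The test channel sees both. -/
def condRateDistortion {n : ℕ} (η : ℝ) (ν : Measure (ℝ × (Fin n → ℝ))) [IsFiniteMeasure ν]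
    (d : ℝ) : ℝ≥0∞ :=
  ⨅ (κ : Kernel (ℝ × (Fin n → ℝ)) (Fin n → ℝ)) (_ : IsMarkovKernel κ)
    (_ : ∫⁻ p, blockDist η p.1.2 p.2 ∂(ν ⊗ₘ κ) ≤ ENNReal.ofReal d),
    condMutualInfo ((ν ⊗ₘ κ).map MeasurableEquiv.prodAssoc) / n

/-- The infinite-horizon rate-distortion function of a sequence of blocks. -/
def rateDistortionInf (η : ℝ) (μ : (n : ℕ) → Measure (Fin n → ℝ)) (d : ℝ) : ℝ≥0∞ :=
  liminf (fun n => rateDistortion η (μ n) d) atTop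

/-- The infinite-horizon distortion-rate function of a sequence of blocks. -/
def distortionRateInf (η : ℝ) (μ : (n : ℕ) → Measure (Fin n → ℝ)) (R : ℝ) : ℝ≥0∞ :=
  liminf (fun n => distortionRate η (μ n) R) atTop

/-! ### The laws of the blocks -/

section Laws

variable {Ω : Type*} [MeasurableSpace Ω]

/-- The law of the block `(X 0, …, X (n-1))` of the forward process. -/
def fwdLaw (P : Measure Ω) (lam : ℝ) (X₀ : Ω → ℝ) (W : ℕ → Ω → ℝ) (n : ℕ) :
    Measure (Fin n → ℝ) :=
  P.map fun ω i => fwd lam (X₀ ω) (fun t => W t ω) i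

/-- The law of the block of the times `0, …, n-1` of the backwards process with horizon `n`. -/
def bwdLaw (P : Measure Ω) (lam : ℝ) (W : ℕ → Ω → ℝ) (n : ℕ) : Measure (Fin n → ℝ) :=
  P.map fun ω i => bwd lam (fun t => W t ω) n i

/-- The joint law of `g (X 0)` and of the block of the times `0, …, n-1` of the backwards process
`X` with horizon `n`. -/
def bwdJointLaw (P : Measure Ω) (lam : ℝ) (W : ℕ → Ω → ℝ) (g : ℝ → ℝ) (n : ℕ) :
    Measure (ℝ × (Fin n → ℝ)) :=
  P.map fun ω => (g (bwd lam (fun t => W t ω) n 0), fun i => bwd lam (fun t => W t ω) n i)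

instance (P : Measure Ω) [IsFiniteMeasure P] (lam : ℝ) (W : ℕ → Ω → ℝ) (g : ℝ → ℝ) (n : ℕ) :
    IsFiniteMeasure (bwdJointLaw P lam W g n) := by
  unfold bwdJointLaw; infer_instance

end Laws

end RateDist

end

/-!
The forward block `X` and the backwards block `A` of the same noise differ by the one-dimensional
term `X t - A t = lam ^ t * (X 0 - A 0)`, so the forward block carries, besides the backwards block,
exactly the information on the real number `X 0 - A 0` at the accuracy `|lam| ^ (-n)`, which is
`n * log |lam|` up to lower order. All comparisons are made for finite blocks, in nats and for total
distortions (`Achievable`), with errors that are of lower order than the length of the block; they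
become equalities in the limit.

* From backwards to forward (`IsNoise.exists_fwd_of_bwd`): the number `X 0 - A 0` is described with
  an added uniform noise of width `|lam| ^ (-n)`, which costs `n * log |lam|` by a bound for the
  divergence of laws of bounded density (`exists_reference`).
* From forward to backwards (`IsNoise.exists_bwd_of_fwd`): given `X 0 - A 0`, a description of the
  forward block is one of the backwards block. Its conditional information is smaller than the
  information by the divergence of the joint law of `X 0 - A 0` and the output from a product law
  (`lintegral_klDiv_eq_add`), and this is at least about `n * log |lam|` by a Donsker-Varadhan
  bound, since the last output predicts `lam ^ (n - 1) * (X 0 - A 0)` with a bounded error.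
* The limit of the rates of the backwards blocks exists because descriptions can be concatenated
  (`IsNoise.exists_concat`): the influence of a late block on an earlier one decays geometrically
  and is described at a bounded cost. The rates are moreover uniformly continuous in the distortion,
  by time sharing (`IsNoise.exists_lower_distortion`).
* Knowledge of the initial value saves at most a bounded amount in total and a factor as close to
  `1` as desired (`IsNoise.exists_of_achievableGiven`): after replacing the first noise variable by
  an independent one of bounded density, the initial value can be conveyed at a bounded cost.
  Quantized side information lies in between, so that the rate does not depend on the step of the
  quantizer in the limit of long blocks.
* At distortion `0` every rate is infinite for blocks of at least two times
  (`IsNoise.not_achievableGiven_zero`), since the first two values have a joint density.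
* Below the rate `log |lam|` the bound behind the second comparison leaves no room for a bounded
  distortion; above it the output `0` for the backwards block already yields the bound `K`.
-/

noncomputable section

namespace RateDist

open InformationTheory

/-! ### Kullback-Leibler divergence of composition products -/

section KullbackLeibler

variable {α β γ : Type*} [MeasurableSpace α] [MeasurableSpace β] [MeasurableSpace γ]

theorem rnDeriv_compProd_right [MeasurableSpace.CountableOrCountablyGenerated α β]
    (μ : Measure α) [IsFiniteMeasure μ] (κ η : Kernel α β) [IsFiniteKernel κ] [IsFiniteKernel η]
    (h : ∀ᵐ a ∂μ, κ a ≪ η a) :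
    (μ ⊗ₘ κ).rnDeriv (μ ⊗ₘ η) =ᵐ[μ ⊗ₘ η] fun p => κ.rnDeriv η p.1 p.2 := by
  have h1 : μ ⊗ₘ κ = (μ ⊗ₘ η).withDensity fun p => κ.rnDeriv η p.1 p.2 := by
    rw [← Measure.compProd_withDensity (f := κ.rnDeriv η) (Kernel.measurable_rnDeriv κ η)]
    refine Measure.compProd_congr ?_
    filter_upwards [h] with a ha
    rw [Kernel.withDensity_rnDeriv_eq ha]
  rw [h1]
  exact Measure.rnDeriv_withDensity _ (Kernel.measurable_rnDeriv κ η)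

theorem klDiv_kernel_eq [MeasurableSpace.CountableOrCountablyGenerated α β]
    (κ η : Kernel α β) [IsFiniteKernel κ] [IsFiniteKernel η] (a : α) (ha : κ a ≪ η a) :
    klDiv (κ a) (η a) = ∫⁻ x, ENNReal.ofReal (klFun (κ.rnDeriv η a x).toReal) ∂(η a) := by
  rw [klDiv_eq_lintegral_klFun_of_ac ha]
  refine lintegral_congr_ae ?_
  filter_upwards [Kernel.rnDeriv_eq_rnDeriv_measure (κ := κ) (η := η) (a := a)] with x hx
  rw [hx]

theorem measurable_klDiv_kernel [MeasurableSpace.CountableOrCountablyGenerated α β]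
    (κ η : Kernel α β) [IsFiniteKernel κ] [IsFiniteKernel η] :
    Measurable fun a => klDiv (κ a) (η a) := by
  classical
  have h : (fun a => klDiv (κ a) (η a)) = fun a => if a ∈ {a | κ a ≪ η a} then
      ∫⁻ x, ENNReal.ofReal (klFun (κ.rnDeriv η a x).toReal) ∂(η a) else ∞ := by
    ext a
    split_ifs with ha
    · exact klDiv_kernel_eq κ η a ha
    · exact klDiv_of_not_ac ha
  rw [h]
  refine Measurable.ite (Kernel.measurableSet_absolutelyContinuous κ η) ?_ measurable_const
  refine Measurable.lintegral_kernel_prod_right' (κ := η)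
    (f := fun p : α × β => ENNReal.ofReal (klFun (κ.rnDeriv η p.1 p.2).toReal)) ?_
  exact (measurable_klFun.comp (Kernel.measurable_rnDeriv κ η).ennreal_toReal).ennreal_ofReal

theorem measurable_klDiv_left [MeasurableSpace.CountableOrCountablyGenerated α β]
    (κ : Kernel α β) [IsFiniteKernel κ] (Q : Measure β) [IsFiniteMeasure Q] :
    Measurable fun a => klDiv (κ a) Q :=
  measurable_klDiv_kernel κ (Kernel.const α Q)

/-- The conditional divergence is the average of the pointwise divergences. -/
theorem klDiv_compProd_right [MeasurableSpace.CountableOrCountablyGenerated α β]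
    (μ : Measure α) [IsFiniteMeasure μ] (κ η : Kernel α β) [IsFiniteKernel κ] [IsFiniteKernel η] :
    klDiv (μ ⊗ₘ κ) (μ ⊗ₘ η) = ∫⁻ a, klDiv (κ a) (η a) ∂μ := by
  by_cases h : ∀ᵐ a ∂μ, κ a ≪ η a
  · rw [klDiv_eq_lintegral_klFun_of_ac (Measure.AbsolutelyContinuous.compProd_right h)]
    have h1 : ∫⁻ p, ENNReal.ofReal (klFun ((μ ⊗ₘ κ).rnDeriv (μ ⊗ₘ η) p).toReal) ∂(μ ⊗ₘ η) =
        ∫⁻ p, ENNReal.ofReal (klFun (κ.rnDeriv η p.1 p.2).toReal) ∂(μ ⊗ₘ η) := by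
      refine lintegral_congr_ae ?_
      filter_upwards [rnDeriv_compProd_right μ κ η h] with p hp
      rw [hp]
    rw [h1, Measure.lintegral_compProd]
    · refine lintegral_congr_ae ?_
      filter_upwards [h] with a ha
      rw [klDiv_kernel_eq κ η a ha]
    · exact (measurable_klFun.comp (Kernel.measurable_rnDeriv κ η).ennreal_toReal).ennreal_ofReal
  · rw [klDiv_of_not_ac (by rwa [Measure.absolutelyContinuous_compProd_right_iff])]
    symm
    by_contra hne
    refine h ?_
    filter_upwards [ae_lt_top (measurable_klDiv_kernel κ η) hne] with a ha
    by_contra hac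
    rw [klDiv_of_not_ac hac] at ha
    exact lt_irrefl _ ha

theorem klDiv_prod [MeasurableSpace.CountablyGenerated β] (μ ν : Measure α) (μ' ν' : Measure β)
    [IsProbabilityMeasure μ] [IsProbabilityMeasure ν] [IsProbabilityMeasure μ']
    [IsProbabilityMeasure ν'] :
    klDiv (μ.prod μ') (ν.prod ν') = klDiv μ ν + klDiv μ' ν' := by
  rw [← Measure.compProd_const, ← Measure.compProd_const, klDiv_compProd_eq_add,
    klDiv_compProd_right]
  simp

theorem klDiv_map_equiv (e : α ≃ᵐ β) (μ ν : Measure α) [IsFiniteMeasure μ] [IsFiniteMeasure ν] :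
    klDiv (μ.map e) (ν.map e) = klDiv μ ν := by
  refine le_antisymm (klDiv_map_le μ ν e.measurable) ?_
  have h := klDiv_map_le (μ.map e) (ν.map e) e.symm.measurable
  have h2 : ∀ ρ : Measure α, (ρ.map e).map e.symm = ρ := fun ρ => by
    rw [Measure.map_map e.symm.measurable e.measurable]; simp
  rwa [h2, h2] at h

/-- The second marginal minimises the divergence from a product measure. -/
theorem klDiv_prod_snd_le [StandardBorelSpace α] [Nonempty α]
    (ρ : Measure (α × β)) [IsProbabilityMeasure ρ] (Q : Measure β) [IsProbabilityMeasure Q] :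
    klDiv ρ (ρ.fst.prod ρ.snd) ≤ klDiv ρ (ρ.fst.prod Q) := by
  have key : ∀ R : Measure β, IsProbabilityMeasure R → klDiv ρ (ρ.fst.prod R) =
      klDiv ρ.snd R + klDiv ((ρ.map Prod.swap).fst ⊗ₘ (ρ.map Prod.swap).condKernel)
        (ρ.snd.prod ρ.fst) := by
    intro R hR
    have h1 := klDiv_map_equiv MeasurableEquiv.prodComm ρ (ρ.fst.prod R)
    have h2 : (ρ.fst.prod R).map MeasurableEquiv.prodComm = R.prod ρ.fst := Measure.prod_swap
    have h3 : ρ.map MeasurableEquiv.prodComm = ρ.map Prod.swap := rfl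
    have h4 : (ρ.map Prod.swap).fst = ρ.snd := by
      simp [Measure.fst_map_swap]
    rw [← h1, h2, h3, ← Measure.compProd_const (μ := R)]
    conv_lhs => rw [← (ρ.map Prod.swap).disintegrate (ρ.map Prod.swap).condKernel]
    rw [klDiv_compProd_eq_add, h4, Measure.compProd_const]
  rw [key Q inferInstance, key ρ.snd inferInstance, klDiv_self, zero_add]
  exact le_add_self

end KullbackLeibler

/-! ### Conditional mutual information as a minimum over reference kernels -/

section Conditional

variable {Z U Y : Type*} [MeasurableSpace Z] [MeasurableSpace U] [MeasurableSpace Y]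

theorem kernel_prod_eq_compProd (a : Kernel Z U) (π : Kernel Z Y) [IsMarkovKernel a]
    [IsMarkovKernel π] : a ×ₖ π = a ⊗ₖ (Kernel.prodMkRight U π) := by
  ext1 z
  rw [Kernel.prod_apply, Kernel.compProd_apply_eq_compProd_sectR,
    ← Measure.compProd_const]
  rfl

theorem compProd_prod_map_assoc (μ : Measure Z) [IsProbabilityMeasure μ] (a : Kernel Z U)
    (π : Kernel Z Y) [IsMarkovKernel a] [IsMarkovKernel π] :
    μ ⊗ₘ (a ×ₖ π) = ((μ ⊗ₘ a) ⊗ₘ (Kernel.prodMkRight U π)).map MeasurableEquiv.prodAssoc := by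
  rw [Measure.compProd_assoc', kernel_prod_eq_compProd]

/-- The measurable equivalence `(z, (u, y)) ↦ ((z, y), u)`. -/
def swapAssoc : Z × U × Y ≃ᵐ (Z × Y) × U :=
  (MeasurableEquiv.prodCongr (MeasurableEquiv.refl Z) MeasurableEquiv.prodComm).trans
    MeasurableEquiv.prodAssoc.symm

theorem compProd_prod_map_swapAssoc (μ : Measure Z) [IsProbabilityMeasure μ] (a : Kernel Z U)
    (π : Kernel Z Y) [IsMarkovKernel a] [IsMarkovKernel π] :
    (μ ⊗ₘ (a ×ₖ π)).map swapAssoc = (μ ⊗ₘ π) ⊗ₘ (Kernel.prodMkRight Y a) := by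
  have h1 : (μ ⊗ₘ (a ×ₖ π)).map
      (MeasurableEquiv.prodCongr (MeasurableEquiv.refl Z) MeasurableEquiv.prodComm) =
      μ ⊗ₘ (π ×ₖ a) := by
    rw [← Kernel.map_prod_swap a π, Measure.compProd_map measurable_swap]
    rfl
  rw [swapAssoc, MeasurableEquiv.coe_trans, ← Measure.map_map (MeasurableEquiv.measurable _)
    (MeasurableEquiv.measurable _), h1, kernel_prod_eq_compProd, Measure.compProd_assoc]

variable [StandardBorelSpace U] [Nonempty U] [StandardBorelSpace Y] [Nonempty Y]

/-- The conditional law of the output `y` given the side information `z`, when the pair `(z, u)`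
has law `ν` and `y` is produced from it by the channel `κ`. -/
def outputKernel (ν : Measure (Z × U)) [IsProbabilityMeasure ν] (κ : Kernel (Z × U) Y)
    [IsMarkovKernel κ] : Kernel Z Y :=
  Kernel.snd ((ν ⊗ₘ κ).map MeasurableEquiv.prodAssoc).condKernel

variable (ν : Measure (Z × U)) [IsProbabilityMeasure ν] (κ : Kernel (Z × U) Y) [IsMarkovKernel κ]

instance : IsProbabilityMeasure ((ν ⊗ₘ κ).map MeasurableEquiv.prodAssoc) :=
  Measure.isProbabilityMeasure_map (MeasurableEquiv.measurable _).aemeasurable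

instance : IsMarkovKernel (outputKernel ν κ) := by
  unfold outputKernel; infer_instance

omit [StandardBorelSpace U] [Nonempty U] [StandardBorelSpace Y] [Nonempty Y] in
theorem fst_assoc_compProd : ((ν ⊗ₘ κ).map MeasurableEquiv.prodAssoc).fst = ν.fst := by
  rw [Measure.fst, Measure.map_map measurable_fst (MeasurableEquiv.measurable _)]
  have : (Prod.fst ∘ (MeasurableEquiv.prodAssoc : (Z × U) × Y ≃ᵐ Z × U × Y)) =
    Prod.fst ∘ Prod.fst := rfl
  rw [this, ← Measure.map_map measurable_fst measurable_fst]
  change (ν ⊗ₘ κ).fst.fst = _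
  rw [Measure.fst_compProd]

theorem compProd_fst_condKernel :
    ν.fst ⊗ₘ Kernel.fst ((ν ⊗ₘ κ).map MeasurableEquiv.prodAssoc).condKernel = ν := by
  rw [Kernel.fst_eq, Measure.compProd_map measurable_fst, ← fst_assoc_compProd ν κ,
    Measure.disintegrate, Measure.map_map (by fun_prop) (MeasurableEquiv.measurable _)]
  have : (Prod.map id Prod.fst ∘ (MeasurableEquiv.prodAssoc : (Z × U) × Y ≃ᵐ Z × U × Y)) =
    Prod.fst := rfl
  rw [this]
  change (ν ⊗ₘ κ).fst = _
  rw [Measure.fst_compProd]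

theorem klDiv_assoc_compProd (π : Kernel Z Y) [IsMarkovKernel π] :
    klDiv ((ν ⊗ₘ κ).map MeasurableEquiv.prodAssoc)
      (ν.fst ⊗ₘ (Kernel.fst ((ν ⊗ₘ κ).map MeasurableEquiv.prodAssoc).condKernel ×ₖ π)) =
      ∫⁻ p, klDiv (κ p) (π p.1) ∂ν := by
  rw [compProd_prod_map_assoc, compProd_fst_condKernel, klDiv_map_equiv, klDiv_compProd_right]
  rfl

/-- Conditional mutual information in nats is the average divergence of the channel from the
conditional law of its output given the side information. -/
theorem condMutualInfo_eq :
    condMutualInfo ((ν ⊗ₘ κ).map MeasurableEquiv.prodAssoc) =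
      (∫⁻ p, klDiv (κ p) (outputKernel ν κ p.1) ∂ν) / ENNReal.ofReal (Real.log 2) := by
  rw [condMutualInfo, ← klDiv_assoc_compProd, fst_assoc_compProd]
  rfl

/-- Compensation identity: the average divergence of the channel from an arbitrary reference
kernel exceeds the conditional mutual information by the divergence of the conditional output law
from the reference. -/
theorem lintegral_klDiv_eq_add (π : Kernel Z Y) [IsMarkovKernel π] :
    ∫⁻ p, klDiv (κ p) (π p.1) ∂ν =
      klDiv (ν.fst ⊗ₘ outputKernel ν κ) (ν.fst ⊗ₘ π) +
        ∫⁻ p, klDiv (κ p) (outputKernel ν κ p.1) ∂ν := by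
  set ρ := (ν ⊗ₘ κ).map MeasurableEquiv.prodAssoc with hρ
  have hfst : ρ.fst = ν.fst := fst_assoc_compProd ν κ
  set σ := ρ.map swapAssoc with hσ
  have : IsProbabilityMeasure σ :=
    Measure.isProbabilityMeasure_map (MeasurableEquiv.measurable _).aemeasurable
  have hσfst : σ.fst = ν.fst ⊗ₘ outputKernel ν κ := by
    rw [outputKernel, Kernel.snd_eq, Measure.compProd_map measurable_snd, ← hfst,
      Measure.disintegrate, hσ, Measure.fst,
      Measure.map_map measurable_fst (MeasurableEquiv.measurable _)]
    rfl
  have key : ∀ π' : Kernel Z Y, IsMarkovKernel π' → ∫⁻ p, klDiv (κ p) (π' p.1) ∂ν =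
      klDiv (ν.fst ⊗ₘ outputKernel ν κ) (ν.fst ⊗ₘ π') +
        klDiv σ (σ.fst ⊗ₘ (Kernel.prodMkRight Y (Kernel.fst ρ.condKernel))) := by
    intro π' _
    rw [← klDiv_assoc_compProd, ← klDiv_map_equiv swapAssoc, compProd_prod_map_swapAssoc]
    change klDiv σ _ = _
    conv_lhs => rw [← σ.disintegrate σ.condKernel]
    rw [klDiv_compProd_eq_add, σ.disintegrate, hσfst]
  rw [key π inferInstance, key (outputKernel ν κ) inferInstance, klDiv_self, zero_add]

theorem condMutualInfo_le (π : Kernel Z Y) [IsMarkovKernel π] :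
    condMutualInfo ((ν ⊗ₘ κ).map MeasurableEquiv.prodAssoc) ≤
      (∫⁻ p, klDiv (κ p) (π p.1) ∂ν) / ENNReal.ofReal (Real.log 2) := by
  rw [condMutualInfo_eq]
  refine ENNReal.div_le_div_right ?_ _
  rw [lintegral_klDiv_eq_add ν κ π]
  exact le_add_self

end Conditional

/-! ### Two estimates for the divergence -/

section Estimates

variable {α : Type*} [MeasurableSpace α]

/-- A lower bound in the manner of Donsker and Varadhan: a test function `exp (-ψ)` whose mean
under `ν` is at most `exp (-ℓ)` shows that the divergence is at least `ℓ - ∫ ψ`. -/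
theorem ofReal_le_klDiv_add_lintegral (P ν : Measure α) [IsProbabilityMeasure P]
    [IsProbabilityMeasure ν] (ψ : α → ℝ) (hψ : Measurable ψ) (hψ0 : ∀ x, 0 ≤ ψ x) (ℓ : ℝ)
    (hℓ : ∫⁻ x, ENNReal.ofReal (Real.exp (-ψ x)) ∂ν ≤ ENNReal.ofReal (Real.exp (-ℓ))) :
    ENNReal.ofReal ℓ ≤ klDiv P ν + ∫⁻ x, ENNReal.ofReal (ψ x) ∂P := by
  rcases le_or_gt ℓ 0 with h0 | h0
  · simp [ENNReal.ofReal_of_nonpos h0]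
  by_cases hac : P ≪ ν
  swap
  · simp [klDiv_of_not_ac hac]
  have hg : Measurable (P.rnDeriv ν) := Measure.measurable_rnDeriv P ν
  have hpt : ∀ᵐ x ∂ν, P.rnDeriv ν x * ENNReal.ofReal ℓ + 1 ≤
      (ENNReal.ofReal (klFun (P.rnDeriv ν x).toReal) + P.rnDeriv ν x * ENNReal.ofReal (ψ x)) +
        ENNReal.ofReal (Real.exp ℓ) * ENNReal.ofReal (Real.exp (-ψ x)) := by
    filter_upwards [Measure.rnDeriv_lt_top P ν] with x hx
    obtain ⟨g, hgx⟩ : ∃ g : ℝ≥0, P.rnDeriv ν x = g := ⟨_, (ENNReal.coe_toNNReal hx.ne).symm⟩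
    rw [hgx, ← ENNReal.ofReal_coe_nnreal, ENNReal.toReal_ofReal g.coe_nonneg,
      ← ENNReal.ofReal_mul g.coe_nonneg, ← ENNReal.ofReal_mul g.coe_nonneg,
      ← ENNReal.ofReal_mul (Real.exp_pos _).le,
      ← ENNReal.ofReal_one, ← ENNReal.ofReal_add (by positivity) zero_le_one,
      ← ENNReal.ofReal_add (klFun_nonneg g.coe_nonneg) (mul_nonneg g.coe_nonneg (hψ0 x)),
      ← ENNReal.ofReal_add
        (add_nonneg (klFun_nonneg g.coe_nonneg) (mul_nonneg g.coe_nonneg (hψ0 x)))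
        (by positivity), ← Real.exp_add]
    refine ENNReal.ofReal_le_ofReal ?_
    rw [klFun_apply]
    set s := Real.exp (ℓ + -ψ x) with hs
    have hlog : Real.log s = ℓ + -ψ x := Real.log_exp _
    have hspos : 0 < s := Real.exp_pos _
    rcases eq_or_lt_of_le g.coe_nonneg with hg0 | hgpos
    · have : (g : ℝ) = 0 := hg0.symm
      simp only [this]
      simpa using hspos.le
    · have hgpos' : 0 < (g : ℝ) := hgpos
      -- `log (s / g) ≤ s / g - 1`
      have h1 := Real.log_le_sub_one_of_pos (div_pos hspos hgpos')
      rw [Real.log_div hspos.ne' hgpos'.ne', hlog] at h1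
      have h2 := mul_le_mul_of_nonneg_left h1 hgpos'.le
      have h3 : (g : ℝ) * (s / g - 1) = s - g := by field_simp
      rw [h3] at h2
      nlinarith
  have hint := lintegral_mono_ae hpt
  rw [lintegral_add_left (by fun_prop), lintegral_add_left (by fun_prop),
    lintegral_add_left (by fun_prop), lintegral_const_mul _ (by fun_prop),
    lintegral_mul_const _ hg, Measure.lintegral_rnDeriv hac, lintegral_rnDeriv_mul hac
      (by fun_prop), ← klDiv_eq_lintegral_klFun_of_ac hac] at hint
  simp only [measure_univ, one_mul, lintegral_const, mul_one] at hint
  have h1 : ENNReal.ofReal (Real.exp ℓ) * ∫⁻ x, ENNReal.ofReal (Real.exp (-ψ x)) ∂ν ≤ 1 := by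
    calc _ ≤ ENNReal.ofReal (Real.exp ℓ) * ENNReal.ofReal (Real.exp (-ℓ)) := by gcongr
      _ = 1 := by
        rw [← ENNReal.ofReal_mul (Real.exp_pos _).le, ← Real.exp_add]; simp
  have h2 : ENNReal.ofReal ℓ + 1 ≤
      (klDiv P ν + ∫⁻ x, ENNReal.ofReal (ψ x) ∂P) + 1 := hint.trans (by gcongr)
  exact (ENNReal.add_le_add_iff_right ENNReal.one_ne_top).1 h2

/-- A measure of density at most `exp L` has divergence at most `∫ L + 1`. Positivity of `L` and the
extra `1` give room for a pointwise bound of the nonnegative integrand `g * log g + 1 - g` of the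
divergence by `g * L + 1`. -/
theorem klDiv_le_lintegral_add_one (P ν : Measure α) [IsProbabilityMeasure P]
    [IsProbabilityMeasure ν] (L : α → ℝ) (hL : Measurable L) (hL0 : ∀ x, 0 ≤ L x)
    (hle : P ≤ ν.withDensity fun x => ENNReal.ofReal (Real.exp (L x))) :
    klDiv P ν ≤ ∫⁻ x, ENNReal.ofReal (L x) ∂P + 1 := by
  have hac : P ≪ ν :=
    (Measure.absolutelyContinuous_of_le hle).trans (withDensity_absolutelyContinuous _ _)
  have hg : Measurable (P.rnDeriv ν) := Measure.measurable_rnDeriv P ν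
  have hd : P.rnDeriv ν ≤ᵐ[ν] fun x => ENNReal.ofReal (Real.exp (L x)) := by
    refine ae_le_of_forall_setLIntegral_le_of_sigmaFinite hg fun s hs _ => ?_
    rw [Measure.setLIntegral_rnDeriv hac, ← withDensity_apply _ hs]
    exact hle s
  rw [klDiv_eq_lintegral_klFun_of_ac hac]
  have hpt : ∀ᵐ x ∂ν, ENNReal.ofReal (klFun (P.rnDeriv ν x).toReal) ≤
      P.rnDeriv ν x * ENNReal.ofReal (L x) + 1 := by
    filter_upwards [hd] with x hx
    have hx' : P.rnDeriv ν x < ∞ := hx.trans_lt ENNReal.ofReal_lt_top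
    obtain ⟨g, hgx⟩ : ∃ g : ℝ≥0, P.rnDeriv ν x = g := ⟨_, (ENNReal.coe_toNNReal hx'.ne).symm⟩
    rw [hgx, ← ENNReal.ofReal_coe_nnreal] at hx ⊢
    rw [ENNReal.toReal_ofReal g.coe_nonneg,
      ← ENNReal.ofReal_mul g.coe_nonneg, ← ENNReal.ofReal_one,
      ← ENNReal.ofReal_add (mul_nonneg g.coe_nonneg (hL0 x)) zero_le_one]
    refine ENNReal.ofReal_le_ofReal ?_
    have hgL : (g : ℝ) ≤ Real.exp (L x) := (ENNReal.ofReal_le_ofReal_iff (Real.exp_pos _).le).1 hx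
    rw [klFun_apply]
    rcases eq_or_lt_of_le g.coe_nonneg with hg0 | hgpos
    · have : (g : ℝ) = 0 := hg0.symm
      simp [this]
    · have hgpos' : 0 < (g : ℝ) := hgpos
      have h1 : Real.log g ≤ L x := (Real.log_le_iff_le_exp hgpos').2 hgL
      have h2 := mul_le_mul_of_nonneg_left h1 hgpos'.le
      linarith
  refine (lintegral_mono_ae hpt).trans ?_
  rw [lintegral_add_left (by fun_prop), lintegral_rnDeriv_mul hac (by fun_prop)]
  simp

end Estimates

/-! ### Powers of distances -/

section Power

/-- The single-letter distortion `|x| ^ η` of an error `x`. -/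
def pw (η x : ℝ) : ℝ≥0∞ := ENNReal.ofReal (|x| ^ η)

variable {η : ℝ}

theorem measurable_pw : Measurable (pw η) := by
  unfold pw
  exact ((measurable_norm (α := ℝ)).pow_const η).ennreal_ofReal

@[fun_prop]
theorem Measurable.pw {α : Type*} [MeasurableSpace α] {f : α → ℝ} (hf : Measurable f) :
    Measurable fun x => RateDist.pw η (f x) := measurable_pw.comp hf

theorem pw_zero (hη : 0 < η) : pw η 0 = 0 := by
  simp [pw, Real.zero_rpow hη.ne']

theorem pw_neg (x : ℝ) : pw η (-x) = pw η x := by simp [pw]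

theorem pw_mul (x y : ℝ) : pw η (x * y) = pw η x * pw η y := by
  rw [pw, pw, pw, ← ENNReal.ofReal_mul (by positivity), abs_mul,
    Real.mul_rpow (abs_nonneg _) (abs_nonneg _)]

theorem pw_ne_top (x : ℝ) : pw η x ≠ ∞ := ENNReal.ofReal_ne_top

theorem pw_mono (hη : 0 < η) {x y : ℝ} (h : |x| ≤ |y|) : pw η x ≤ pw η y :=
  ENNReal.ofReal_le_ofReal (Real.rpow_le_rpow (abs_nonneg _) h hη.le)

theorem pw_eq_zero {x : ℝ} (h : pw η x = 0) : x = 0 := by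
  rw [pw, ENNReal.ofReal_eq_zero] at h
  by_contra hx
  exact absurd (Real.rpow_pos_of_pos (abs_pos.2 hx) η) (not_lt.2 h)

/-- The power of a sum exceeds the power of its first summand only by a factor close to `1`, up to
a multiple of the power of the second summand. -/
theorem exists_pw_add_le (hη : 0 < η) (ε : ℝ≥0) (hε : 0 < ε) :
    ∃ C : ℝ≥0, ∀ a b : ℝ, pw η (a + b) ≤ (1 + ε) * pw η a + C * pw η b := by
  have hε' : (0 : ℝ) < ε := hε
  set κ : ℝ := (1 + ε : ℝ) ^ (1 / η) - 1 with hκ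
  have h1 : (1 : ℝ) < (1 + ε : ℝ) ^ (1 / η) := Real.one_lt_rpow (by linarith) (by positivity)
  have hκ0 : 0 < κ := by linarith
  have hκη : (1 + κ) ^ η = 1 + ε := by
    rw [hκ, add_sub_cancel, ← Real.rpow_mul (by positivity), one_div_mul_cancel hη.ne',
      Real.rpow_one]
  refine ⟨Real.toNNReal ((1 + 1 / κ) ^ η), fun a b => ?_⟩
  have hab : |a + b| ≤ |a| + |b| := abs_add_le a b
  have hC : (Real.toNNReal ((1 + 1 / κ) ^ η) : ℝ≥0∞) = ENNReal.ofReal ((1 + 1 / κ) ^ η) := rfl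
  rw [hC]
  rcases le_or_gt |b| (κ * |a|) with h | h
  · refine le_trans ?_ le_self_add
    have h2 : (1 + ε : ℝ≥0∞) = ENNReal.ofReal (1 + ε) := by
      rw [ENNReal.ofReal_add zero_le_one ε.coe_nonneg]; simp
    rw [h2, pw, pw, ← ENNReal.ofReal_mul (by positivity), ← hκη,
      ← Real.mul_rpow (by positivity) (abs_nonneg _)]
    refine ENNReal.ofReal_le_ofReal (Real.rpow_le_rpow (abs_nonneg _) ?_ hη.le)
    linarith
  · refine le_trans ?_ le_add_self
    rw [pw, pw, ← ENNReal.ofReal_mul (by positivity),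
      ← Real.mul_rpow (by positivity) (abs_nonneg _)]
    refine ENNReal.ofReal_le_ofReal (Real.rpow_le_rpow (abs_nonneg _) ?_ hη.le)
    have h3 : |a| ≤ 1 / κ * |b| := by
      rw [one_div, inv_mul_eq_div, le_div_iff₀ hκ0]; linarith
    linarith

theorem exists_pw_add_le' (hη : 0 < η) :
    ∃ C : ℝ≥0, ∀ a b : ℝ, pw η (a + b) ≤ C * (pw η a + pw η b) := by
  obtain ⟨C, hC⟩ := exists_pw_add_le hη 1 one_pos
  refine ⟨2 + C, fun a b => (hC a b).trans ?_⟩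
  have : (1 + (1 : ℝ≥0) : ℝ≥0∞) = 2 := by norm_num [one_add_one_eq_two]
  rw [this, mul_add]
  push_cast
  gcongr
  · exact le_self_add
  · exact le_add_self

end Power

/-! ### A reference law for real random variables of finite moment -/

section Reference

variable {η : ℝ}

theorem lintegral_comp_affine (F : ℝ → ℝ≥0∞) (hF : Measurable F) {a : ℝ} (ha : a ≠ 0) (b : ℝ) :
    ∫⁻ x, F (a * x + b) = ENNReal.ofReal |a⁻¹| * ∫⁻ x, F x := by
  have h1 : ∫⁻ x, F (a * x + b) = ∫⁻ y, F (y + b) ∂(volume.map (a * ·)) := by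
    rw [lintegral_map (by fun_prop) (by fun_prop)]
  rw [h1, Real.map_volume_mul_left ha, lintegral_smul_measure, lintegral_add_right_eq_self]
  rfl

theorem integrable_exp_neg_abs_rpow (hη : 0 < η) :
    Integrable fun x : ℝ => Real.exp (-|x| ^ η) := by
  refine not_imp_comm.1 integral_undef ?_
  rw [integral_comp_abs (f := fun x => Real.exp (-x ^ η)), integral_exp_neg_rpow hη]
  exact mul_ne_zero two_ne_zero (Real.Gamma_pos_of_pos (by positivity)).ne'

theorem lintegral_exp_pos_lt_top (hη : 0 < η) :
    0 < ∫⁻ x : ℝ, ENNReal.ofReal (Real.exp (-|x| ^ η)) ∧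
      ∫⁻ x : ℝ, ENNReal.ofReal (Real.exp (-|x| ^ η)) < ∞ := by
  constructor
  · rw [lintegral_pos_iff_support (by fun_prop)]
    have : (Function.support fun x : ℝ => ENNReal.ofReal (Real.exp (-|x| ^ η))) = Set.univ := by
      ext x; simp [Real.exp_pos]
    rw [this]; simp
  · exact (integrable_exp_neg_abs_rpow hη).lintegral_lt_top

/-- A probability law on the line against which every law with density at most `exp ℓ` has
divergence at most `ℓ` plus a constant plus its `η`-th absolute moment. It takes the place of the
entropy bounds for random variables of finite moment. -/
theorem exists_reference (hη : 0 < η) :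
    ∃ (Q : Measure ℝ) (C : ℝ≥0), IsProbabilityMeasure Q ∧ ∀ (ℓ : ℝ) (μ : Measure ℝ), 0 ≤ ℓ →
      IsProbabilityMeasure μ → μ ≤ ENNReal.ofReal (Real.exp ℓ) • volume →
      klDiv μ Q ≤ ENNReal.ofReal ℓ + C + ∫⁻ x, pw η x ∂μ := by
  obtain ⟨hZ0, hZ⟩ := lintegral_exp_pos_lt_top hη
  set Z := ∫⁻ x : ℝ, ENNReal.ofReal (Real.exp (-|x| ^ η)) with hZdef
  have hZr : 0 < Z.toReal := ENNReal.toReal_pos hZ0.ne' hZ.ne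
  set q : ℝ → ℝ≥0∞ := fun x => Z⁻¹ * ENNReal.ofReal (Real.exp (-|x| ^ η)) with hq
  have hqm : Measurable q := by fun_prop
  have hQ : IsProbabilityMeasure (volume.withDensity q) := by
    constructor
    rw [withDensity_apply _ MeasurableSet.univ, Measure.restrict_univ,
      lintegral_const_mul _ (by fun_prop), ENNReal.inv_mul_cancel hZ0.ne' hZ.ne]
  set z : ℝ := max 0 (Real.log Z.toReal) with hz
  refine ⟨volume.withDensity q, Real.toNNReal z + 1, hQ, fun ℓ μ hℓ hμ hle => ?_⟩
  have hLm : Measurable fun x : ℝ => ℓ + z + |x| ^ η := by fun_prop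
  have hz0 : 0 ≤ z := le_max_left _ _
  refine (klDiv_le_lintegral_add_one μ _ (fun x => ℓ + z + |x| ^ η) hLm
    (fun x => by positivity) ?_).trans ?_
  · refine hle.trans ?_
    rw [← withDensity_mul _ hqm (by fun_prop), ← withDensity_const]
    refine withDensity_mono (ae_of_all _ fun x => ?_)
    simp only [hq, Pi.mul_apply]
    have h1 : (1 : ℝ≥0∞) ≤ Z⁻¹ * ENNReal.ofReal (Real.exp z) := by
      rw [← ENNReal.ofReal_toReal hZ.ne, ← ENNReal.ofReal_inv_of_pos hZr,
        ← ENNReal.ofReal_mul (by positivity), ENNReal.one_le_ofReal, inv_mul_eq_div,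
        one_le_div hZr]
      calc Z.toReal = Real.exp (Real.log Z.toReal) := (Real.exp_log hZr).symm
        _ ≤ Real.exp z := Real.exp_le_exp.2 (le_max_right _ _)
    have h2 : ENNReal.ofReal (Real.exp (-|x| ^ η)) * ENNReal.ofReal (Real.exp (ℓ + z + |x| ^ η)) =
        ENNReal.ofReal (Real.exp z) * ENNReal.ofReal (Real.exp ℓ) := by
      rw [← ENNReal.ofReal_mul (by positivity), ← ENNReal.ofReal_mul (by positivity),
        ← Real.exp_add, ← Real.exp_add]
      congr 2; ring
    calc ENNReal.ofReal (Real.exp ℓ) = 1 * ENNReal.ofReal (Real.exp ℓ) := (one_mul _).symm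
      _ ≤ (Z⁻¹ * ENNReal.ofReal (Real.exp z)) * ENNReal.ofReal (Real.exp ℓ) := by gcongr
      _ = _ := by rw [mul_assoc, ← h2, mul_assoc]
  · have h3 : ∀ x : ℝ, ENNReal.ofReal (ℓ + z + |x| ^ η) =
        (ENNReal.ofReal ℓ + ENNReal.ofReal z) + pw η x := fun x => by
      rw [pw, ENNReal.ofReal_add (by positivity) (by positivity), ENNReal.ofReal_add hℓ hz0]
    simp_rw [h3]
    rw [lintegral_add_left measurable_const, lintegral_const, measure_univ, mul_one]
    have h4 : ENNReal.ofReal z = (Real.toNNReal z : ℝ≥0∞) := rfl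
    rw [h4]
    push_cast
    apply le_of_eq
    ring

end Reference

/-! ### Channels with given total distortion and information -/

section Achievable

variable {n : ℕ} {η : ℝ}

/-- The total distortion `∑ |x i - y i| ^ η` of a block. -/
def totalDist (η : ℝ) (x y : Fin n → ℝ) : ℝ≥0∞ := ∑ i, pw η (x i - y i)

@[fun_prop]
theorem Measurable.totalDist {α : Type*} [MeasurableSpace α] {f g : α → Fin n → ℝ}
    (hf : Measurable f) (hg : Measurable g) :
    Measurable fun a => RateDist.totalDist η (f a) (g a) := by
  unfold RateDist.totalDist
  fun_prop

theorem blockDist_eq (x y : Fin n → ℝ) : blockDist η x y = totalDist η x y / n := rfl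

/-- Some channel maps a block of law `μ` to an output with expected total distortion at most `D`
while conveying at most `I` nats. Neither quantity is divided by the length of the block. -/
def Achievable (η : ℝ) (μ : Measure (Fin n → ℝ)) (D I : ℝ≥0∞) : Prop :=
  ∃ κ : Kernel (Fin n → ℝ) (Fin n → ℝ), IsMarkovKernel κ ∧
    ∫⁻ x, ∫⁻ y, totalDist η x y ∂κ x ∂μ ≤ D ∧ ∫⁻ x, klDiv (κ x) (κ ∘ₘ μ) ∂μ ≤ I

theorem Achievable.mono {μ : Measure (Fin n → ℝ)} {D D' I I' : ℝ≥0∞} (h : Achievable η μ D I)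
    (hD : D ≤ D') (hI : I ≤ I') : Achievable η μ D' I' :=
  let ⟨κ, h1, h2, h3⟩ := h
  ⟨κ, h1, h2.trans hD, h3.trans hI⟩

theorem klDiv_compProd_prod (μ : Measure (Fin n → ℝ)) [IsProbabilityMeasure μ]
    (κ : Kernel (Fin n → ℝ) (Fin n → ℝ)) [IsMarkovKernel κ] :
    klDiv (μ ⊗ₘ κ) ((μ ⊗ₘ κ).fst.prod (μ ⊗ₘ κ).snd) = ∫⁻ x, klDiv (κ x) (κ ∘ₘ μ) ∂μ := by
  rw [Measure.fst_compProd, Measure.snd_compProd, ← Measure.compProd_const, klDiv_compProd_right]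
  rfl

theorem chanRate_eq (μ : Measure (Fin n → ℝ)) [IsProbabilityMeasure μ]
    (κ : Kernel (Fin n → ℝ) (Fin n → ℝ)) [IsMarkovKernel κ] :
    chanRate μ κ = (∫⁻ x, klDiv (κ x) (κ ∘ₘ μ) ∂μ) / ENNReal.ofReal (Real.log 2) / n := by
  rw [chanRate, mutualInfo, klDiv_compProd_prod]

theorem lintegral_blockDist {α : Type*} [MeasurableSpace α] (ρ : Measure α)
    {f g : α → Fin n → ℝ} (hf : Measurable f) (hg : Measurable g) :
    ∫⁻ a, blockDist η (f a) (g a) ∂ρ = (∫⁻ a, totalDist η (f a) (g a) ∂ρ) / n := by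
  simp_rw [blockDist_eq, div_eq_mul_inv]
  rw [lintegral_mul_const _ (by fun_prop)]

theorem expDist_eq (μ : Measure (Fin n → ℝ)) [IsProbabilityMeasure μ]
    (κ : Kernel (Fin n → ℝ) (Fin n → ℝ)) [IsMarkovKernel κ] :
    expDist η μ κ = (∫⁻ x, ∫⁻ y, totalDist η x y ∂κ x ∂μ) / n := by
  rw [expDist, lintegral_blockDist _ measurable_fst measurable_snd, Measure.lintegral_compProd
    (by fun_prop)]

theorem ofReal_log_two_pos : ENNReal.ofReal (Real.log 2) ≠ 0 := by
  simpa using Real.log_pos one_lt_two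

theorem rateDistortion_le {μ : Measure (Fin n → ℝ)} [IsProbabilityMeasure μ] {d : ℝ}
    {I : ℝ≥0∞} (h : Achievable η μ (n * ENNReal.ofReal d) I) :
    rateDistortion η μ d ≤ I / ENNReal.ofReal (Real.log 2) / n := by
  obtain ⟨κ, hκ, hD, hI⟩ := h
  refine (iInf_le_of_le κ (iInf_le_of_le hκ (iInf_le _ ?_))).trans (b := chanRate μ κ) ?_
  · rw [expDist_eq]
    exact ENNReal.div_le_of_le_mul' hD
  · rw [chanRate_eq]
    gcongr

theorem achievable_of_rateDistortion_lt {μ : Measure (Fin n → ℝ)} [IsProbabilityMeasure μ]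
    (hn : n ≠ 0) {d : ℝ} {x : ℝ≥0∞} (h : rateDistortion η μ d < x) :
    Achievable η μ (n * ENNReal.ofReal d) (n * (x * ENNReal.ofReal (Real.log 2))) := by
  have hn' : (n : ℝ≥0∞) ≠ 0 := by exact_mod_cast hn
  simp only [rateDistortion, iInf_lt_iff] at h
  obtain ⟨κ, hκ, hD, hI⟩ := h
  refine ⟨κ, hκ, ?_, ?_⟩
  · rwa [expDist_eq, ENNReal.div_le_iff hn' (by simp), mul_comm] at hD
  · have := hI.le
    rwa [chanRate_eq, ENNReal.div_le_iff hn' (by simp),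
      ENNReal.div_le_iff ofReal_log_two_pos ENNReal.ofReal_ne_top, mul_comm x, mul_assoc] at this

theorem distortionRate_le {μ : Measure (Fin n → ℝ)} [IsProbabilityMeasure μ] (hn : n ≠ 0) {R : ℝ}
    {D : ℝ≥0∞}
    (h : Achievable η μ D (n * (ENNReal.ofReal R * ENNReal.ofReal (Real.log 2)))) :
    distortionRate η μ R ≤ D / n := by
  have hn' : (n : ℝ≥0∞) ≠ 0 := by exact_mod_cast hn
  obtain ⟨κ, hκ, hD, hI⟩ := h
  refine (iInf_le_of_le κ (iInf_le_of_le hκ (iInf_le _ ?_))).trans (b := expDist η μ κ) ?_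
  · rwa [chanRate_eq, ENNReal.div_le_iff hn' (by simp),
      ENNReal.div_le_iff ofReal_log_two_pos ENNReal.ofReal_ne_top, mul_comm (ENNReal.ofReal R),
      mul_assoc]
  · rw [expDist_eq]
    gcongr

theorem achievable_of_distortionRate_lt {μ : Measure (Fin n → ℝ)} [IsProbabilityMeasure μ]
    (hn : n ≠ 0) {R : ℝ} {x : ℝ≥0∞} (h : distortionRate η μ R < x) :
    Achievable η μ (n * x) (n * (ENNReal.ofReal R * ENNReal.ofReal (Real.log 2))) := by
  have hn' : (n : ℝ≥0∞) ≠ 0 := by exact_mod_cast hn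
  simp only [distortionRate, iInf_lt_iff] at h
  obtain ⟨κ, hκ, hI, hD⟩ := h
  refine ⟨κ, hκ, ?_, ?_⟩
  · have := hD.le
    rwa [expDist_eq, ENNReal.div_le_iff hn' (by simp), mul_comm] at this
  · rwa [chanRate_eq, ENNReal.div_le_iff hn' (by simp),
      ENNReal.div_le_iff ofReal_log_two_pos ENNReal.ofReal_ne_top, mul_comm (ENNReal.ofReal R),
      mul_assoc] at hI

variable {S A Y : Type*} [MeasurableSpace S] [MeasurableSpace A] [MeasurableSpace Y]

/-- A description `t` of a source `s`, from which the reproduction `y t` of the block `u s` is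
computed, conveys at most the average divergence of its conditional law from any fixed law. -/
theorem achievable_of_kernel [MeasurableSpace.CountablyGenerated Y]
    (m : Measure S) [IsProbabilityMeasure m] (τ : Kernel S Y) [IsMarkovKernel τ]
    (Q : Measure Y) [IsProbabilityMeasure Q] (u : S → Fin n → ℝ) (hu : Measurable u)
    (y : Y → Fin n → ℝ) (hy : Measurable y) {D I : ℝ≥0∞}
    (hD : ∫⁻ s, ∫⁻ t, totalDist η (u s) (y t) ∂τ s ∂m ≤ D)
    (hI : ∫⁻ s, klDiv (τ s) Q ∂m ≤ I) : Achievable η (m.map u) D I := by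
  set ρ := (m ⊗ₘ τ).map (Prod.map u y) with hρ
  have hmap : Measurable (Prod.map u y) := by fun_prop
  have : IsProbabilityMeasure ρ := Measure.isProbabilityMeasure_map hmap.aemeasurable
  have hfst : ρ.fst = m.map u := by
    rw [hρ, Measure.fst, Measure.map_map measurable_fst hmap]
    have : Prod.fst ∘ Prod.map u y = u ∘ (Prod.fst : S × Y → S) := rfl
    rw [this, ← Measure.map_map hu measurable_fst]
    change ((m ⊗ₘ τ).fst).map u = _
    rw [Measure.fst_compProd]
  have hdis : m.map u ⊗ₘ ρ.condKernel = ρ := by rw [← hfst, ρ.disintegrate]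
  have hprob : IsProbabilityMeasure (m.map u) := Measure.isProbabilityMeasure_map hu.aemeasurable
  have hprobQ : IsProbabilityMeasure (Q.map y) := Measure.isProbabilityMeasure_map hy.aemeasurable
  refine ⟨ρ.condKernel, inferInstance, ?_, ?_⟩
  · rw [← Measure.lintegral_compProd (f := fun p => totalDist η p.1 p.2) (by fun_prop), hdis, hρ,
      lintegral_map (by fun_prop) hmap, Measure.lintegral_compProd (by fun_prop)]
    exact hD
  · rw [← klDiv_compProd_prod, hdis]
    refine (klDiv_prod_snd_le ρ (Q.map y)).trans ?_
    rw [hfst, Measure.map_prod_map _ _ hu hy]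
    refine (klDiv_map_le _ _ hmap).trans ?_
    rw [← Measure.compProd_const, klDiv_compProd_right]
    exact hI

/-- The two-stage form of the preceding bound: the description consists of a part `a`, of
conditional law `α s`, and of a part `y`, of conditional law `κ (s, a)`. -/
theorem achievable_of_two_stage [MeasurableSpace.CountablyGenerated A]
    [MeasurableSpace.CountablyGenerated Y]
    (m : Measure S) [IsProbabilityMeasure m] (α : Kernel S A) [IsMarkovKernel α]
    (κ : Kernel (S × A) Y) [IsMarkovKernel κ] (Q : Measure A) [IsProbabilityMeasure Q]
    (π : Kernel A Y) [IsMarkovKernel π] (u : S → Fin n → ℝ) (hu : Measurable u)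
    (y : A × Y → Fin n → ℝ) (hy : Measurable y) {D I : ℝ≥0∞}
    (hD : ∫⁻ s, ∫⁻ a, ∫⁻ t, totalDist η (u s) (y (a, t)) ∂κ (s, a) ∂α s ∂m ≤ D)
    (hI : ∫⁻ s, klDiv (α s) Q ∂m + ∫⁻ s, ∫⁻ a, klDiv (κ (s, a)) (π a) ∂α s ∂m ≤ I) :
    Achievable η (m.map u) D I := by
  refine achievable_of_kernel m (α ⊗ₖ κ) (Q ⊗ₘ π) u hu y hy ?_ ?_
  · refine le_of_eq_of_le (lintegral_congr fun s => ?_) hD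
    rw [Kernel.lintegral_compProd _ _ _ (by fun_prop)]
  · refine le_of_eq_of_le ?_ hI
    rw [← lintegral_add_left (measurable_klDiv_left α Q)]
    refine lintegral_congr fun s => ?_
    rw [Kernel.compProd_apply_eq_compProd_sectR, klDiv_compProd_eq_add, klDiv_compProd_right]
    rfl

end Achievable

/-! ### The forward and the backwards process -/

section Processes

variable {lam : ℝ}

theorem bwdSteps_add_shift (w : ℕ → ℝ) (m n : ℕ) {k : ℕ} (hk : k ≤ n) :
    bwdSteps lam w (m + n) k = bwdSteps lam (fun t => w (m + t)) n k := by
  induction k with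
  | zero => rfl
  | succ k ih =>
    rw [bwdSteps, bwdSteps, ih (by omega)]
    congr 3
    omega

theorem bwd_add_shift (w : ℕ → ℝ) (m n : ℕ) (t : ℕ) :
    bwd lam w (m + n) (m + t) = bwd lam (fun t => w (m + t)) n t := by
  rw [bwd, bwd, Nat.add_sub_add_left, bwdSteps_add_shift _ _ _ (Nat.sub_le _ _)]

theorem bwd_add_eq (w : ℕ → ℝ) (m n : ℕ) {t : ℕ} (ht : t ≤ m) :
    bwd lam w (m + n) t = bwd lam w m t + lam⁻¹ ^ (m - t) * bwd lam w (m + n) m := by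
  induction ht using Nat.decreasingInduction with
  | self => simp [bwd_self]
  | of_succ t ht ih =>
    have h1 : m - t = (m - (t + 1)) + 1 := by omega
    rw [bwd_of_lt lam w (by omega : t < m + n), bwd_of_lt lam w ht, ih, h1, pow_succ]
    ring

theorem fwd_eq (hlam : lam ≠ 0) (x : ℝ) (w : ℕ → ℝ) {n t : ℕ} (ht : t ≤ n) :
    fwd lam x w t = bwd lam w n t + lam ^ t * (x - bwd lam w n 0) := by
  induction t with
  | zero => simp [fwd]
  | succ t ih =>
    rw [fwd, ih (by omega), bwd_of_lt lam w (by omega : t < n), pow_succ]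
    field_simp
    ring

@[fun_prop]
theorem measurable_bwd (n t : ℕ) : Measurable fun w : ℕ → ℝ => bwd lam w n t := by
  unfold bwd
  generalize n - t = k
  induction k with
  | zero => exact measurable_const
  | succ k ih =>
    simp only [bwdSteps]
    fun_prop

@[fun_prop]
theorem measurable_fwd (t : ℕ) : Measurable fun p : ℝ × (ℕ → ℝ) => fwd lam p.1 p.2 t := by
  induction t with
  | zero => exact measurable_fst
  | succ t ih =>
    simp only [fwd]
    fun_prop

/-- The block of the times `0, …, n - 1` of the backwards process with horizon `n`. -/
def bwdBlock (lam : ℝ) (n : ℕ) (w : ℕ → ℝ) : Fin n → ℝ := fun i => bwd lam w n i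

/-- The block of the times `0, …, n - 1` of the forward process, as a function of its initial value
and of the noise. -/
def fwdBlock (lam : ℝ) (n : ℕ) (p : ℝ × (ℕ → ℝ)) : Fin n → ℝ := fun i => fwd lam p.1 p.2 i

@[fun_prop]
theorem measurable_bwdBlock (n : ℕ) : Measurable (bwdBlock lam n) := by
  unfold bwdBlock; fun_prop

@[fun_prop]
theorem measurable_fwdBlock (n : ℕ) : Measurable (fwdBlock lam n) := by
  unfold fwdBlock; fun_prop

end Processes

/-- The standing assumptions on the law `𝒲` of the noise sequence: it is the law of a sequence whose
first term has law `ν` and is independent of the rest, which has again law `𝒲`, and the initial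
values of the backwards processes have uniformly bounded `η`-th moments. -/
structure IsNoise (lam η : ℝ) (K : ℝ≥0) (ν : Measure ℝ) (𝒲 : Measure (ℕ → ℝ)) : Prop where
  one_lt : 1 < |lam|
  eta_pos : 0 < η
  prob_marginal : IsProbabilityMeasure ν
  prob : IsProbabilityMeasure 𝒲
  map_split : 𝒲.map (fun w => (w 0, fun t => w (t + 1))) = ν.prod 𝒲
  moment : ∀ n, ∫⁻ w, pw η (bwd lam w n 0) ∂𝒲 ≤ K

namespace IsNoise

variable {lam η : ℝ} {K : ℝ≥0} {ν : Measure ℝ} {𝒲 : Measure (ℕ → ℝ)} (h : IsNoise lam η K ν 𝒲)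
include h

theorem lam_ne_zero : lam ≠ 0 := by
  rintro rfl
  have := h.one_lt
  simp at this
  linarith

theorem map_shift (m : ℕ) : 𝒲.map (fun w t => w (m + t)) = 𝒲 := by
  have := h.prob
  have := h.prob_marginal
  induction m with
  | zero => simp
  | succ m ih =>
    have h1 : 𝒲.map (fun w t => w (t + 1)) = 𝒲 := by
      have h2 := congrArg (Measure.map Prod.snd) h.map_split
      rw [Measure.map_map measurable_snd (by fun_prop), Measure.map_snd_prod] at h2
      simpa [Function.comp_def] using h2
    conv_rhs => rw [← ih, ← h1]
    rw [Measure.map_map (by fun_prop) (by fun_prop)]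
    congr 1
    ext w t
    simp only [Function.comp]
    congr 1
    omega

theorem moment_bwd {n t : ℕ} (ht : t ≤ n) : ∫⁻ w, pw η (bwd lam w n t) ∂𝒲 ≤ K := by
  obtain ⟨k, rfl⟩ := Nat.exists_eq_add_of_le ht
  have h1 : ∀ w, bwd lam w (t + k) t = bwd lam (fun s => w (t + s)) k 0 := fun w => by
    simpa using bwd_add_shift (lam := lam) w t k 0
  simp_rw [h1]
  have h2 := lintegral_map (μ := 𝒲) (f := fun w => pw η (bwd lam w k 0))
    (g := fun w s => w (t + s)) (by fun_prop) (by fun_prop)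
  rw [← h2, h.map_shift]
  exact h.moment k

omit h in
theorem isProbabilityMeasure_bwdBlock [IsProbabilityMeasure 𝒲] (n : ℕ) :
    IsProbabilityMeasure (𝒲.map (bwdBlock lam n)) :=
  Measure.isProbabilityMeasure_map (measurable_bwdBlock n).aemeasurable

omit h in
theorem isProbabilityMeasure_fwdBlock [IsProbabilityMeasure 𝒲] (U : Measure ℝ)
    [IsProbabilityMeasure U] (n : ℕ) :
    IsProbabilityMeasure ((U.prod 𝒲).map (fwdBlock lam n)) :=
  Measure.isProbabilityMeasure_map (measurable_fwdBlock n).aemeasurable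

theorem pw_inv_lt_one : pw η lam⁻¹ < 1 := by
  have h1 := h.one_lt
  rw [pw, ← ENNReal.ofReal_one, ENNReal.ofReal_lt_ofReal_iff one_pos, abs_inv]
  exact Real.rpow_lt_one (by positivity) (inv_lt_one_of_one_lt₀ h1) h.eta_pos

theorem sum_pw_le (m : ℕ) :
    ∑ i : Fin m, pw η (lam⁻¹ ^ (m - (i : ℕ))) ≤ (1 - pw η lam⁻¹)⁻¹ := by
  have h1 : ∀ k : ℕ, pw η (lam⁻¹ ^ k) = pw η lam⁻¹ ^ k := fun k => by
    induction k with
    | zero => simp [pw]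
    | succ k ih => rw [pow_succ, pow_succ, pw_mul, ih]
  simp_rw [h1]
  have h2 : ∀ i ∈ Finset.range m, pw η lam⁻¹ ^ (m - i) ≤ pw η lam⁻¹ ^ (m - 1 - i) := by
    intro i hi
    exact pow_le_pow_right_of_le_one' h.pw_inv_lt_one.le (by omega)
  rw [← ENNReal.tsum_geometric, Fin.sum_univ_eq_sum_range (fun i => pw η lam⁻¹ ^ (m - i)) m]
  refine (Finset.sum_le_sum h2).trans ?_
  rw [Finset.sum_range_reflect (fun j => pw η lam⁻¹ ^ j) m]
  exact ENNReal.sum_le_tsum _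

theorem sum_pw_ne_top : (1 - pw η lam⁻¹)⁻¹ ≠ ∞ := by
  rw [ENNReal.inv_ne_top]
  exact (tsub_pos_of_lt h.pw_inv_lt_one).ne'

end IsNoise

/-! ### Additive noise -/

section AddNoise

variable {S : Type*} [MeasurableSpace S]

/-- The channel that adds to `V s` an independent noise of law `N`. -/
def addNoise (V : S → ℝ) (hV : Measurable V) (N : Measure ℝ) : Kernel S ℝ :=
  (Kernel.deterministic V hV ×ₖ Kernel.const S N).map fun p => p.1 + p.2

variable (V : S → ℝ) (hV : Measurable V) (N : Measure ℝ) [IsProbabilityMeasure N]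

instance : IsMarkovKernel (addNoise V hV N) := by
  unfold addNoise
  exact Kernel.IsMarkovKernel.map _ (by fun_prop)

theorem addNoise_apply (s : S) : addNoise V hV N s = N.map (V s + ·) := by
  rw [addNoise, Kernel.map_apply _ (by fun_prop), Kernel.prod_apply, Kernel.deterministic_apply,
    Kernel.const_apply, Measure.dirac_prod, Measure.map_map (by fun_prop) (by fun_prop)]
  rfl

theorem lintegral_addNoise (s : S) {F : ℝ → ℝ≥0∞} (hF : Measurable F) :
    ∫⁻ x, F x ∂addNoise V hV N s = ∫⁻ x, F (V s + x) ∂N := by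
  rw [addNoise_apply, lintegral_map hF (by fun_prop)]

theorem addNoise_le {c : ℝ≥0∞} (hN : N ≤ c • volume) (s : S) :
    addNoise V hV N s ≤ c • volume := by
  rw [addNoise_apply]
  calc N.map (V s + ·) ≤ (c • (volume : Measure ℝ)).map (V s + ·) :=
        Measure.map_mono hN (by fun_prop)
    _ = c • volume := by rw [Measure.map_smul, map_add_left_eq_self]

/-- The uniform law on `[0, δ]`. -/
def unifNoise (δ : ℝ) : Measure ℝ := ENNReal.ofReal δ⁻¹ • volume.restrict (Set.Icc 0 δ)

theorem isProbabilityMeasure_unifNoise {δ : ℝ} (hδ : 0 < δ) :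
    IsProbabilityMeasure (unifNoise δ) := by
  constructor
  rw [unifNoise, Measure.smul_apply, Measure.restrict_apply_univ, Real.volume_Icc, sub_zero,
    smul_eq_mul, ← ENNReal.ofReal_mul (by positivity), inv_mul_cancel₀ hδ.ne', ENNReal.ofReal_one]

theorem unifNoise_le (δ : ℝ) : unifNoise δ ≤ ENNReal.ofReal δ⁻¹ • volume := by
  intro s
  simp only [unifNoise, Measure.smul_apply, smul_eq_mul]
  gcongr
  exact Measure.restrict_le_self

theorem ae_unifNoise (δ : ℝ) : ∀ᵐ x ∂unifNoise δ, |x| ≤ |δ| := by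
  refine Measure.ae_smul_measure ?_ _
  filter_upwards [ae_restrict_mem measurableSet_Icc] with x hx
  rw [abs_of_nonneg hx.1, abs_of_nonneg (hx.1.trans hx.2)]
  exact hx.2

theorem ae_addNoise_unifNoise (δ : ℝ) [IsProbabilityMeasure (unifNoise δ)] (s : S) :
    ∀ᵐ a ∂addNoise V hV (unifNoise δ) s, |a - V s| ≤ |δ| := by
  rw [addNoise_apply, ae_map_iff (by fun_prop)
    (measurableSet_le (by fun_prop) measurable_const)]
  simpa using ae_unifNoise δ

/-- The cost of describing `V s` by adding a noise of density at most `exp ℓ`. -/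
theorem lintegral_klDiv_addNoise_le {η : ℝ} {Q : Measure ℝ} [IsProbabilityMeasure Q] {C : ℝ≥0}
    (hQ : ∀ (ℓ : ℝ) (μ : Measure ℝ), 0 ≤ ℓ → IsProbabilityMeasure μ →
      μ ≤ ENNReal.ofReal (Real.exp ℓ) • volume →
      klDiv μ Q ≤ ENNReal.ofReal ℓ + C + ∫⁻ x, pw η x ∂μ)
    (m : Measure S) [IsProbabilityMeasure m] {ℓ : ℝ} (hℓ : 0 ≤ ℓ)
    (hN : N ≤ ENNReal.ofReal (Real.exp ℓ) • volume) :
    ∫⁻ s, klDiv (addNoise V hV N s) Q ∂m ≤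
      ENNReal.ofReal ℓ + C + ∫⁻ s, ∫⁻ x, pw η (V s + x) ∂N ∂m := by
  calc ∫⁻ s, klDiv (addNoise V hV N s) Q ∂m
      ≤ ∫⁻ s, (ENNReal.ofReal ℓ + C + ∫⁻ x, pw η (V s + x) ∂N) ∂m := by
        refine lintegral_mono fun s => ?_
        refine (hQ ℓ _ hℓ inferInstance (addNoise_le V hV N hN s)).trans_eq ?_
        rw [lintegral_addNoise _ _ _ _ (by fun_prop)]
    _ = _ := by
        rw [lintegral_add_left measurable_const, lintegral_const, measure_univ, mul_one]

/-- The moment of the sum of `V s` and of a uniform noise. -/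
theorem lintegral_pw_add_unifNoise_le {η : ℝ} (hη : 0 < η) {C : ℝ≥0}
    (hV : Measurable V) (hC : ∀ a b : ℝ, pw η (a + b) ≤ C * (pw η a + pw η b)) (m : Measure S)
    [IsProbabilityMeasure m] {δ : ℝ} (hδ : 0 < δ) :
    ∫⁻ s, ∫⁻ x, pw η (V s + x) ∂unifNoise δ ∂m ≤ C * (∫⁻ s, pw η (V s) ∂m + pw η δ) := by
  have := isProbabilityMeasure_unifNoise hδ
  calc ∫⁻ s, ∫⁻ x, pw η (V s + x) ∂unifNoise δ ∂m ≤ ∫⁻ s, C * (pw η (V s) + pw η δ) ∂m := by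
        refine lintegral_mono fun s => ?_
        refine (lintegral_mono_ae (g := fun _ => C * (pw η (V s) + pw η δ)) ?_).trans_eq (by simp)
        filter_upwards [ae_unifNoise δ] with x hx
        refine (hC _ _).trans ?_
        gcongr
        exact pw_mono hη hx
    _ = _ := by
        rw [lintegral_const_mul _ (by fun_prop), lintegral_add_left (by fun_prop)]
        simp

end AddNoise

/-! ### Concatenation of backwards blocks -/

section Integrals

variable {n : ℕ} {η : ℝ} {S : Type*} [MeasurableSpace S]

theorem measurable_lintegral_totalDist (κ : Kernel (Fin n → ℝ) (Fin n → ℝ)) [IsMarkovKernel κ] :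
    Measurable fun x => ∫⁻ y, totalDist η x y ∂κ x :=
  Measurable.lintegral_kernel_prod_right' (κ := κ) (f := fun p => totalDist η p.1 p.2)
    (by fun_prop)

theorem lintegral_totalDist_comp (m : Measure S) {f : S → Fin n → ℝ} (hf : Measurable f)
    (κ : Kernel (Fin n → ℝ) (Fin n → ℝ)) [IsMarkovKernel κ] :
    ∫⁻ s, ∫⁻ y, totalDist η (f s) y ∂κ (f s) ∂m =
      ∫⁻ x, ∫⁻ y, totalDist η x y ∂κ x ∂(m.map f) :=
  (lintegral_map (measurable_lintegral_totalDist κ) hf).symm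

theorem lintegral_klDiv_comp (m : Measure S) {f : S → Fin n → ℝ} (hf : Measurable f)
    (κ : Kernel (Fin n → ℝ) (Fin n → ℝ)) [IsMarkovKernel κ] (Q : Measure (Fin n → ℝ))
    [IsProbabilityMeasure Q] :
    ∫⁻ s, klDiv (κ (f s)) Q ∂m = ∫⁻ x, klDiv (κ x) Q ∂(m.map f) :=
  (lintegral_map (measurable_klDiv_left κ Q) hf).symm

theorem lintegral_fst_prod {α β : Type*} [MeasurableSpace α] [MeasurableSpace β] (μ : Measure α)
    (ρ : Measure β) [SFinite μ] [IsProbabilityMeasure ρ] {F : α → ℝ≥0∞} (hF : Measurable F) :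
    ∫⁻ p, F p.1 ∂(μ.prod ρ) = ∫⁻ x, F x ∂μ := by
  rw [lintegral_prod _ (by fun_prop)]
  simp

theorem lintegral_snd_prod {α β : Type*} [MeasurableSpace α] [MeasurableSpace β] (μ : Measure α)
    (ρ : Measure β) [IsProbabilityMeasure μ] [SFinite ρ] {F : β → ℝ≥0∞} (hF : Measurable F) :
    ∫⁻ p, F p.2 ∂(μ.prod ρ) = ∫⁻ x, F x ∂ρ := by
  rw [lintegral_prod _ (by fun_prop)]
  simp

theorem exp_max_log_inv {δ : ℝ} (hδ : 0 < δ) (μ : Measure ℝ)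
    (hμ : μ ≤ ENNReal.ofReal δ⁻¹ • volume) :
    μ ≤ ENNReal.ofReal (Real.exp (max 0 (Real.log δ⁻¹))) • volume := by
  refine hμ.trans fun s => ?_
  simp only [Measure.smul_apply, smul_eq_mul]
  gcongr
  calc δ⁻¹ = Real.exp (Real.log δ⁻¹) := (Real.exp_log (by positivity)).symm
    _ ≤ _ := Real.exp_le_exp.2 (le_max_right _ _)

end Integrals

namespace IsNoise

variable {lam η : ℝ} {K : ℝ≥0} {ν : Measure ℝ} {𝒲 : Measure (ℕ → ℝ)} (h : IsNoise lam η K ν 𝒲)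
include h

/-- Descriptions of two backwards blocks combine to a description of the long block. The later block
is itself a part of the long one, and the earlier times of the long block are those of an
independent short block shifted by a geometrically decaying multiple of the state at the junction,
which is described up to a noise of width `δ`. -/
theorem exists_concat (ε : ℝ≥0) (hε : 0 < ε) : ∃ C : ℝ≥0, ∀ δ : ℝ, 0 < δ → ∃ c : ℝ≥0,
    ∀ (m n : ℕ) (D I D' I' : ℝ≥0∞), Achievable η (𝒲.map (bwdBlock lam m)) D' I' →
      Achievable η (𝒲.map (bwdBlock lam n)) D I →
      Achievable η (𝒲.map (bwdBlock lam (m + n))) ((1 + ε) * D' + D + C * pw η δ)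
        (I' + I + c) := by
  have := h.prob
  obtain ⟨Cε, hCε⟩ := exists_pw_add_le h.eta_pos ε hε
  obtain ⟨C2, hC2⟩ := exists_pw_add_le' h.eta_pos
  obtain ⟨Q, CQ, hQp, hQ⟩ := exists_reference h.eta_pos
  have hG := h.sum_pw_ne_top
  set G := (1 - pw η lam⁻¹)⁻¹ with hGdef
  refine ⟨Cε * G.toNNReal, fun δ hδ => ?_⟩
  have := isProbabilityMeasure_unifNoise hδ
  set ℓ := max 0 (Real.log δ⁻¹) with hℓ
  refine ⟨(ENNReal.ofReal ℓ + CQ + C2 * (K + pw η δ)).toNNReal, fun m n D I D' I' h1 h2 => ?_⟩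
  rw [ENNReal.coe_toNNReal (by finiteness [pw_ne_top (η := η) δ]), ENNReal.coe_mul,
    ENNReal.coe_toNNReal hG]
  obtain ⟨κ1, hκ1, hD1, hI1⟩ := h1
  obtain ⟨κ2, hκ2, hD2, hI2⟩ := h2
  set g : (ℕ → ℝ) → Fin n → ℝ := fun w => bwdBlock lam n (fun t => w (m + t)) with hg
  have hgm : Measurable g := (measurable_bwdBlock n).comp (by fun_prop)
  have hgmap : 𝒲.map g = 𝒲.map (bwdBlock lam n) := by
    conv_rhs => rw [← h.map_shift m]
    rw [Measure.map_map (by fun_prop) (by fun_prop)]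
    rfl
  have hfm := measurable_bwdBlock (lam := lam) m
  have hVm := measurable_bwd (lam := lam) (m + n) m
  have := isProbabilityMeasure_bwdBlock (lam := lam) (𝒲 := 𝒲) m
  have := isProbabilityMeasure_bwdBlock (lam := lam) (𝒲 := 𝒲) n
  refine achievable_of_two_stage 𝒲 (addNoise _ hVm (unifNoise δ))
    (Kernel.prodMkRight ℝ ((κ1.comap _ hfm) ×ₖ (κ2.comap g hgm))) Q
    (Kernel.const ℝ ((κ1 ∘ₘ 𝒲.map (bwdBlock lam m)).prod (κ2 ∘ₘ 𝒲.map (bwdBlock lam n))))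
    (bwdBlock lam (m + n)) (by fun_prop)
    (fun p => Fin.append (fun i => p.2.1 i + lam⁻¹ ^ (m - (i : ℕ)) * p.1) p.2.2) ?_ ?_ ?_
  · refine measurable_pi_iff.2 fun i => ?_
    induction i using Fin.addCases with
    | left i => simp only [Fin.append_left]; fun_prop
    | right i => simp only [Fin.append_right]; fun_prop
  · have hpt : ∀ (w : ℕ → ℝ) (a : ℝ), |a - bwd lam w (m + n) m| ≤ |δ| →
        ∀ t : (Fin m → ℝ) × (Fin n → ℝ), totalDist η (bwdBlock lam (m + n) w)
          (Fin.append (fun i => t.1 i + lam⁻¹ ^ (m - (i : ℕ)) * a) t.2) ≤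
        ((1 + ε) * totalDist η (bwdBlock lam m w) t.1 + totalDist η (g w) t.2) +
          Cε * G * pw η δ := by
      intro w a ha t
      rw [totalDist, Fin.sum_univ_add]
      simp only [Fin.append_left, Fin.append_right]
      have e1 : ∀ i : Fin m, pw η (bwdBlock lam (m + n) w (Fin.castAdd n i) -
          (t.1 i + lam⁻¹ ^ (m - (i : ℕ)) * a)) ≤
          (1 + ε) * pw η (bwdBlock lam m w i - t.1 i) +
            Cε * pw η δ * pw η (lam⁻¹ ^ (m - (i : ℕ))) := by
        intro i
        have e2 : bwdBlock lam (m + n) w (Fin.castAdd n i) -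
            (t.1 i + lam⁻¹ ^ (m - (i : ℕ)) * a) =
            (bwdBlock lam m w i - t.1 i) +
              -(lam⁻¹ ^ (m - (i : ℕ)) * (a - bwd lam w (m + n) m)) := by
          simp only [bwdBlock, Fin.val_castAdd]
          rw [bwd_add_eq w m n i.2.le]
          ring
        rw [e2]
        refine (hCε _ _).trans ?_
        rw [pw_neg, pw_mul, mul_assoc (Cε : ℝ≥0∞), mul_comm (pw η δ)]
        gcongr
        exact pw_mono h.eta_pos ha
      have e3 : ∀ j : Fin n, bwdBlock lam (m + n) w (Fin.natAdd m j) = g w j := fun j => by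
        simp only [hg, bwdBlock, Fin.val_natAdd]
        exact bwd_add_shift w m n j
      simp only [e3]
      calc _ ≤ ∑ i : Fin m, ((1 + ε) * pw η (bwdBlock lam m w i - t.1 i) +
            Cε * pw η δ * pw η (lam⁻¹ ^ (m - (i : ℕ)))) + totalDist η (g w) t.2 := by
            gcongr with i
            · exact e1 i
            · exact le_rfl
        _ = (1 + ε) * totalDist η (bwdBlock lam m w) t.1 + totalDist η (g w) t.2 +
            Cε * pw η δ * ∑ i : Fin m, pw η (lam⁻¹ ^ (m - (i : ℕ))) := by
            rw [Finset.sum_add_distrib, ← Finset.mul_sum, ← Finset.mul_sum]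
            simp only [totalDist]
            ring
        _ ≤ _ := by
            rw [mul_right_comm (Cε : ℝ≥0∞) G]
            gcongr
            exact h.sum_pw_le m
    calc _ ≤ ∫⁻ w, (((1 + ε) * ∫⁻ y, totalDist η (bwdBlock lam m w) y ∂κ1 (bwdBlock lam m w) +
          ∫⁻ y, totalDist η (g w) y ∂κ2 (g w)) + Cε * G * pw η δ) ∂𝒲 := by
          refine lintegral_mono fun w => ?_
          refine (lintegral_mono_ae ((ae_addNoise_unifNoise _ hVm δ w).mono fun a ha =>
            lintegral_mono (hpt w a ha))).trans_eq ?_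
          simp only [Kernel.prodMkRight_apply, Kernel.prod_apply, Kernel.comap_apply]
          rw [lintegral_const, measure_univ, mul_one, lintegral_add_right _ measurable_const,
            lintegral_add_left (by fun_prop), lintegral_const_mul _ (by fun_prop),
            lintegral_const, measure_univ, mul_one,
            lintegral_fst_prod (κ1 (bwdBlock lam m w)) (κ2 (g w))
              (F := fun t => totalDist η (bwdBlock lam m w) t) (by fun_prop),
            lintegral_snd_prod (κ1 (bwdBlock lam m w)) (κ2 (g w))
              (F := fun t => totalDist η (g w) t) (by fun_prop)]
      _ ≤ _ := by
          rw [lintegral_add_right _ measurable_const, lintegral_add_right,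
            lintegral_const_mul, lintegral_totalDist_comp _ hfm, lintegral_totalDist_comp _ hgm,
            hgmap]
          · simp only [lintegral_const, measure_univ, mul_one]
            gcongr
          · exact (measurable_lintegral_totalDist κ1).comp hfm
          · exact (measurable_lintegral_totalDist κ2).comp hgm
  · have e1 : ∀ (w : ℕ → ℝ) (a : ℝ), klDiv ((Kernel.prodMkRight ℝ
        ((κ1.comap _ hfm) ×ₖ (κ2.comap g hgm))) (w, a)) (Kernel.const ℝ
        ((κ1 ∘ₘ 𝒲.map (bwdBlock lam m)).prod (κ2 ∘ₘ 𝒲.map (bwdBlock lam n))) a) =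
        klDiv (κ1 (bwdBlock lam m w)) (κ1 ∘ₘ 𝒲.map (bwdBlock lam m)) +
          klDiv (κ2 (g w)) (κ2 ∘ₘ 𝒲.map (bwdBlock lam n)) := by
      intro w a
      rw [Kernel.prodMkRight_apply, Kernel.prod_apply, Kernel.comap_apply, Kernel.comap_apply,
        Kernel.const_apply, klDiv_prod]
    simp only [e1, lintegral_const, measure_univ, mul_one]
    rw [lintegral_add_left, lintegral_klDiv_comp _ hfm, lintegral_klDiv_comp _ hgm, hgmap,
      add_comm]
    · gcongr
      refine (lintegral_klDiv_addNoise_le _ hVm _ hQ 𝒲 (le_max_left _ _)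
        (exp_max_log_inv hδ _ (unifNoise_le δ))).trans ?_
      gcongr
      refine (lintegral_pw_add_unifNoise_le _ h.eta_pos hVm hC2 𝒲 hδ).trans ?_
      gcongr
      exact h.moment_bwd (by omega)
    · exact (measurable_klDiv_left κ1 _).comp hfm

end IsNoise

/-! ### Comparison of the forward with the backwards process -/

section OutputLaw

variable {Z U Y : Type*} [MeasurableSpace Z] [MeasurableSpace U] [MeasurableSpace Y]
  [StandardBorelSpace U] [Nonempty U] [StandardBorelSpace Y] [Nonempty Y]

theorem lintegral_fst_compProd_outputKernel (ν : Measure (Z × U)) [IsProbabilityMeasure ν]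
    (κ : Kernel (Z × U) Y) [IsMarkovKernel κ] {F : Z × Y → ℝ≥0∞} (hF : Measurable F) :
    ∫⁻ q, F q ∂(ν.fst ⊗ₘ outputKernel ν κ) = ∫⁻ p, ∫⁻ y, F (p.1, y) ∂κ p ∂ν := by
  rw [outputKernel, Kernel.snd_eq, Measure.compProd_map measurable_snd, ← fst_assoc_compProd ν κ,
    Measure.disintegrate, lintegral_map hF (by fun_prop),
    lintegral_map (by fun_prop) (MeasurableEquiv.measurable _),
    Measure.lintegral_compProd (by simp only [MeasurableEquiv.prodAssoc]; fun_prop)]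
  rfl

end OutputLaw

section DensityBound

variable {η : ℝ}

/-- The mean of `exp (-|a * x + y| ^ η)` under a law of density at most `c`. -/
theorem lintegral_exp_neg_affine_le {c : ℝ} (hc : 0 < c) {Z : ℝ} (hZ : 0 < Z)
    (hZeq : ∫⁻ x : ℝ, ENNReal.ofReal (Real.exp (-|x| ^ η)) = ENNReal.ofReal Z)
    (μ : Measure ℝ)
    (hμ : ∀ F : ℝ → ℝ≥0∞, Measurable F → ∫⁻ x, F x ∂μ ≤ ENNReal.ofReal c * ∫⁻ x, F x)
    {a : ℝ} (ha : a ≠ 0) (y : ℝ) :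
    ∫⁻ x, ENNReal.ofReal (Real.exp (-|a * x + y| ^ η)) ∂μ ≤
      ENNReal.ofReal (Real.exp (-(Real.log |a| - Real.log c - Real.log Z))) := by
  refine (hμ _ (by fun_prop)).trans_eq ?_
  rw [lintegral_comp_affine (fun x => ENNReal.ofReal (Real.exp (-|x| ^ η))) (by fun_prop) ha, hZeq,
    ← ENNReal.ofReal_mul (by positivity), ← ENNReal.ofReal_mul hc.le]
  congr 1
  have : -(Real.log |a| - Real.log c - Real.log Z) =
      Real.log c + (-Real.log |a| + Real.log Z) := by ring
  rw [this, Real.exp_add, Real.exp_add, Real.exp_neg, Real.exp_log hc, Real.exp_log hZ,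
    Real.exp_log (abs_pos.2 ha), abs_inv]

/-- A channel whose output `y` predicts a multiple `a * x` of a real input of bounded density with
small error conveys about `log |a|` nats. -/
theorem ofReal_log_le_klDiv_add {Y : Type*} [MeasurableSpace Y] {c : ℝ} (hc : 0 < c) {Z : ℝ}
    (hZ : 0 < Z) (hZeq : ∫⁻ x : ℝ, ENNReal.ofReal (Real.exp (-|x| ^ η)) = ENNReal.ofReal Z)
    (μ : Measure ℝ) [IsProbabilityMeasure μ]
    (hμ : ∀ F : ℝ → ℝ≥0∞, Measurable F → ∫⁻ x, F x ∂μ ≤ ENNReal.ofReal c * ∫⁻ x, F x)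
    {a : ℝ} (ha : a ≠ 0) (π : Kernel ℝ Y) [IsMarkovKernel π] (PY : Measure Y)
    [IsProbabilityMeasure PY] (b : Y → ℝ) (hb : Measurable b) :
    ENNReal.ofReal (Real.log |a| - Real.log c - Real.log Z) ≤
      klDiv (μ ⊗ₘ π) (μ ⊗ₘ Kernel.const ℝ PY) + ∫⁻ q, pw η (a * q.1 + b q.2) ∂(μ ⊗ₘ π) := by
  refine ofReal_le_klDiv_add_lintegral (μ ⊗ₘ π) (μ ⊗ₘ Kernel.const ℝ PY)
    (fun q => |a * q.1 + b q.2| ^ η) ?_ (fun q => by positivity) _ ?_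
  · have : Measurable fun q : ℝ × Y => a * q.1 + b q.2 := by fun_prop
    exact ((measurable_norm (α := ℝ)).comp this).pow_const η
  · have : Measurable fun q : ℝ × Y => a * q.1 + b q.2 := by fun_prop
    have hm : Measurable fun q : ℝ × Y =>
        ENNReal.ofReal (Real.exp (-|a * q.1 + b q.2| ^ η)) := by fun_prop
    rw [Measure.compProd_const, lintegral_prod_symm _ hm.aemeasurable]
    refine (lintegral_mono fun y => lintegral_exp_neg_affine_le hc hZ hZeq μ hμ ha
      (b y)).trans_eq ?_
    simp

end DensityBound

namespace IsNoise

variable {lam η : ℝ} {K : ℝ≥0} {ν : Measure ℝ} {𝒲 : Measure (ℕ → ℝ)} (h : IsNoise lam η K ν 𝒲)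
include h

theorem fwdBlock_eq (n : ℕ) (p : ℝ × (ℕ → ℝ)) (i : Fin n) :
    fwdBlock lam n p i = bwdBlock lam n p.2 i + lam ^ (i : ℕ) * (p.1 - bwd lam p.2 n 0) :=
  fwd_eq h.lam_ne_zero p.1 p.2 i.2.le

/-- The forward block is the backwards block plus the multiples `lam ^ t * V` of one variable `V`,
which has to be described with an accuracy of `|lam| ^ (-n)`. -/
theorem exists_fwd_of_bwd (U : Measure ℝ) [IsProbabilityMeasure U] {M : ℝ≥0}
    (hM : ∫⁻ x, pw η x ∂U ≤ M) (ε : ℝ≥0) (hε : 0 < ε) : ∃ C : ℝ≥0, ∀ (n : ℕ) (D I : ℝ≥0∞),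
      Achievable η (𝒲.map (bwdBlock lam n)) D I →
      Achievable η ((U.prod 𝒲).map (fwdBlock lam n)) ((1 + ε) * D + C)
        (I + ENNReal.ofReal (n * Real.log |lam|) + C) := by
  have := h.prob
  obtain ⟨Cε, hCε⟩ := exists_pw_add_le h.eta_pos ε hε
  obtain ⟨C2, hC2⟩ := exists_pw_add_le' h.eta_pos
  obtain ⟨Q, CQ, hQp, hQ⟩ := exists_reference h.eta_pos
  have hG := h.sum_pw_ne_top
  have hsum := h.sum_pw_le
  set G := (1 - pw η lam⁻¹)⁻¹ with hGdef
  refine ⟨Cε * G.toNNReal + (CQ + C2 * (C2 * (M + K) + 1)), fun n D I h1 => ?_⟩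
  obtain ⟨κ, hκ, hD, hI⟩ := h1
  have hlam0 := h.lam_ne_zero
  have hlam1 := h.one_lt
  set δ : ℝ := |lam⁻¹ ^ n| with hδdef
  have hδ : 0 < δ := abs_pos.2 (pow_ne_zero _ (inv_ne_zero hlam0))
  have hδ1 : δ ≤ 1 := by
    rw [hδdef, abs_pow, abs_inv]
    exact pow_le_one₀ (by positivity) (inv_le_one_of_one_le₀ hlam1.le)
  have := isProbabilityMeasure_unifNoise hδ
  have hVm : Measurable fun p : ℝ × (ℕ → ℝ) => p.1 - bwd lam p.2 n 0 := by fun_prop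
  have hfm : Measurable fun p : ℝ × (ℕ → ℝ) => bwdBlock lam n p.2 :=
    (measurable_bwdBlock n).comp measurable_snd
  have hfmap : (U.prod 𝒲).map (fun p => bwdBlock lam n p.2) = 𝒲.map (bwdBlock lam n) := by
    have : (fun p : ℝ × (ℕ → ℝ) => bwdBlock lam n p.2) = bwdBlock lam n ∘ Prod.snd := rfl
    rw [this, ← Measure.map_map (by fun_prop) measurable_snd, Measure.map_snd_prod]
    simp
  have := isProbabilityMeasure_bwdBlock (lam := lam) (𝒲 := 𝒲) n
  refine achievable_of_two_stage (U.prod 𝒲) (addNoise _ hVm (unifNoise δ))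
    (Kernel.prodMkRight ℝ (κ.comap _ hfm)) Q
    (Kernel.const ℝ (κ ∘ₘ 𝒲.map (bwdBlock lam n))) (fwdBlock lam n) (by fun_prop)
    (fun p i => p.2 i + lam ^ (i : ℕ) * p.1) (by fun_prop) ?_ ?_
  · have hpt : ∀ (p : ℝ × (ℕ → ℝ)) (a : ℝ), |a - (p.1 - bwd lam p.2 n 0)| ≤ |δ| →
        ∀ t : Fin n → ℝ, totalDist η (fwdBlock lam n p) (fun i => t i + lam ^ (i : ℕ) * a) ≤
        (1 + ε) * totalDist η (bwdBlock lam n p.2) t + Cε * G := by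
      intro p a ha t
      have e1 : ∀ i : Fin n, pw η (fwdBlock lam n p i - (t i + lam ^ (i : ℕ) * a)) ≤
          (1 + ε) * pw η (bwdBlock lam n p.2 i - t i) + Cε * pw η (lam⁻¹ ^ (n - (i : ℕ))) := by
        intro i
        have e2 : fwdBlock lam n p i - (t i + lam ^ (i : ℕ) * a) =
            (bwdBlock lam n p.2 i - t i) +
              -(lam ^ (i : ℕ) * (a - (p.1 - bwd lam p.2 n 0))) := by
          rw [h.fwdBlock_eq]
          ring
        rw [e2]
        refine (hCε _ _).trans ?_
        rw [pw_neg]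
        gcongr
        refine pw_mono h.eta_pos ?_
        have e3 : lam⁻¹ ^ (n - (i : ℕ)) = lam ^ (i : ℕ) * lam⁻¹ ^ n := by
          rw [inv_pow_sub₀ hlam0 i.2.le, inv_pow, mul_comm]
        rw [e3, abs_mul, abs_mul]
        rw [hδdef, abs_abs] at ha
        exact mul_le_mul_of_nonneg_left ha (abs_nonneg _)
      calc _ ≤ ∑ i : Fin n, ((1 + ε) * pw η (bwdBlock lam n p.2 i - t i) +
            Cε * pw η (lam⁻¹ ^ (n - (i : ℕ)))) := Finset.sum_le_sum fun i _ => e1 i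
        _ = (1 + ε) * totalDist η (bwdBlock lam n p.2) t +
            Cε * ∑ i : Fin n, pw η (lam⁻¹ ^ (n - (i : ℕ))) := by
            rw [Finset.sum_add_distrib, ← Finset.mul_sum, ← Finset.mul_sum, totalDist]
        _ ≤ _ := by
            gcongr
            exact hsum n
    calc _ ≤ ∫⁻ p, ((1 + ε) * ∫⁻ y, totalDist η (bwdBlock lam n p.2) y ∂κ (bwdBlock lam n p.2) +
          Cε * G) ∂(U.prod 𝒲) := by
          refine lintegral_mono fun p => ?_
          refine (lintegral_mono_ae ((ae_addNoise_unifNoise _ hVm δ p).mono fun a ha =>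
            lintegral_mono (hpt p a ha))).trans_eq ?_
          simp only [Kernel.prodMkRight_apply, Kernel.comap_apply]
          rw [lintegral_const, measure_univ, mul_one, lintegral_add_right _ measurable_const,
            lintegral_const_mul _ (by fun_prop), lintegral_const, measure_univ, mul_one]
      _ ≤ _ := by
          rw [lintegral_add_right _ measurable_const, lintegral_const_mul,
            lintegral_totalDist_comp _ hfm, hfmap, lintegral_const, measure_univ, mul_one]
          · push_cast
            rw [ENNReal.coe_toNNReal hG]
            gcongr
            exact le_self_add
          · exact (measurable_lintegral_totalDist κ).comp hfm
  · simp only [Kernel.prodMkRight_apply, Kernel.comap_apply, Kernel.const_apply, lintegral_const,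
      measure_univ, mul_one]
    rw [lintegral_klDiv_comp _ hfm, hfmap, add_comm, add_assoc I]
    gcongr
    refine (lintegral_klDiv_addNoise_le _ hVm _ hQ (U.prod 𝒲) (le_max_left _ _)
        (exp_max_log_inv hδ _ (unifNoise_le δ))).trans ?_
    have e1 : max 0 (Real.log δ⁻¹) = n * Real.log |lam| := by
      rw [hδdef, abs_pow, abs_inv, inv_pow, inv_inv, Real.log_pow]
      exact max_eq_right (mul_nonneg (by positivity) (Real.log_nonneg hlam1.le))
    rw [e1, add_assoc]
    gcongr
    refine le_trans ?_ (b := ((CQ + C2 * (C2 * (M + K) + 1) : ℝ≥0) : ℝ≥0∞))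
      (by push_cast; exact le_add_self)
    push_cast
    gcongr
    refine (lintegral_pw_add_unifNoise_le _ h.eta_pos hVm hC2 _ hδ).trans ?_
    gcongr
    · calc ∫⁻ p, pw η (p.1 - bwd lam p.2 n 0) ∂(U.prod 𝒲)
          ≤ ∫⁻ p, C2 * (pw η p.1 + pw η (bwd lam p.2 n 0)) ∂(U.prod 𝒲) := by
            refine lintegral_mono fun p => ?_
            rw [sub_eq_add_neg]
            refine (hC2 _ _).trans ?_
            rw [pw_neg]
        _ = C2 * (∫⁻ x, pw η x ∂U + ∫⁻ w, pw η (bwd lam w n 0) ∂𝒲) := by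
            rw [lintegral_const_mul _ (by fun_prop), lintegral_add_left (by fun_prop),
              lintegral_fst_prod U 𝒲 (F := pw η) measurable_pw,
              lintegral_snd_prod U 𝒲 (F := fun w => pw η (bwd lam w n 0)) (by fun_prop)]
        _ ≤ _ := by
            gcongr
            exact h.moment n
    · refine (pw_mono h.eta_pos (y := 1) ?_).trans (by simp [pw])
      rw [abs_of_pos hδ, abs_one]
      exact hδ1

/-- The converse comparison. Knowing `X 0 - A 0`, where `A` is the backwards process, the forward
block is a translate of the backwards block. Conversely the last output of a good description of
the forward block determines `X 0 - A 0` up to an error of order `|lam| ^ (-n)`, so that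
`n * log |lam|` of the information is spent on that variable. -/
theorem exists_bwd_of_fwd (U : Measure ℝ) [IsProbabilityMeasure U] {M : ℝ≥0}
    (hM : ∫⁻ x, pw η x ∂U ≤ M) {ℓU : ℝ} (hℓU : 0 ≤ ℓU)
    (hU : U ≤ ENNReal.ofReal (Real.exp ℓU) • volume) :
    ∃ C : ℝ≥0, ∀ (n : ℕ) (D I : ℝ≥0∞), 0 < n →
      Achievable η ((U.prod 𝒲).map (fwdBlock lam n)) D I →
      ∃ I', Achievable η (𝒲.map (bwdBlock lam n)) D I' ∧
        I' + ENNReal.ofReal (n * Real.log |lam|) ≤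
          I + (C + ENNReal.ofReal (Real.log n / η) + C * (D / n)) := by
  have := h.prob
  obtain ⟨C2, hC2⟩ := exists_pw_add_le' h.eta_pos
  obtain ⟨Q, CQ, hQp, hQ⟩ := exists_reference h.eta_pos
  obtain ⟨hZ0, hZ⟩ := lintegral_exp_pos_lt_top h.eta_pos
  obtain ⟨Z, hZpos, hZeq⟩ : ∃ Z : ℝ, 0 < Z ∧
      ∫⁻ x : ℝ, ENNReal.ofReal (Real.exp (-|x| ^ η)) = ENNReal.ofReal Z :=
    ⟨_, ENNReal.toReal_pos hZ0.ne' hZ.ne, (ENNReal.ofReal_toReal hZ.ne).symm⟩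
  have hlam0 := h.lam_ne_zero
  have hlam1 := h.one_lt
  set C1 : ℝ≥0 := Real.toNNReal (Real.log |lam| + ℓU + |Real.log Z|) with hC1
  set C3 : ℝ≥0 := Real.toNNReal ℓU + CQ + C2 * (K + M) with hC3
  refine ⟨C1 + C2 * K + C3 + C2, fun n D I hn hA => ?_⟩
  obtain ⟨κ, hκ, hD, hI⟩ := hA
  have hn' : (0 : ℝ) < n := by exact_mod_cast hn
  set A0 : (ℕ → ℝ) → ℝ := fun w => bwd lam w n 0 with hA0
  have hA0m : Measurable A0 := measurable_bwd n 0
  have hA0n : Measurable fun w => -A0 w := hA0m.neg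
  set Φ : ℝ × (ℕ → ℝ) → ℝ × (ℕ → ℝ) := fun p => (p.1 - A0 p.2, p.2) with hΦ
  have hΦm : Measurable Φ := by fun_prop
  set ρ := (U.prod 𝒲).map Φ with hρ
  have hρp : IsProbabilityMeasure ρ := Measure.isProbabilityMeasure_map hΦm.aemeasurable
  set g : ℝ × (ℕ → ℝ) → Fin n → ℝ := fun p i => bwdBlock lam n p.2 i + lam ^ (i : ℕ) * p.1 with hg
  have hbm : Measurable fun p : ℝ × (ℕ → ℝ) => bwdBlock lam n p.2 :=
    (measurable_bwdBlock n).comp measurable_snd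
  have hgm : Measurable g := by fun_prop
  have hgΦ : ∀ p, g (Φ p) = fwdBlock lam n p := fun p => by
    ext i
    rw [h.fwdBlock_eq]
  have hgmap : ρ.map g = (U.prod 𝒲).map (fwdBlock lam n) := by
    rw [hρ, Measure.map_map hgm hΦm]
    congr 1
    ext1 p
    exact hgΦ p
  set PY := κ ∘ₘ (U.prod 𝒲).map (fwdBlock lam n) with hPY
  have := isProbabilityMeasure_fwdBlock (lam := lam) (𝒲 := 𝒲) U n
  set κ' := κ.comap g hgm with hκ'
  -- integrals against the joint law of `X 0 - A 0` and the noise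
  have hswap : ∀ F : ℝ × (ℕ → ℝ) → ℝ≥0∞, Measurable F →
      ∫⁻ w, ∫⁻ a, F (a, w) ∂addNoise (fun w => -A0 w) hA0n U w ∂𝒲 = ∫⁻ p, F p ∂ρ := by
    intro F hF
    rw [hρ, lintegral_map hF hΦm, lintegral_prod_symm _ (by fun_prop)]
    refine lintegral_congr fun w => ?_
    rw [lintegral_addNoise _ _ _ _ (by fun_prop)]
    refine lintegral_congr fun x => ?_
    simp only [hΦ]
    congr 2
    ring
  have hfst : ∀ F : ℝ → ℝ≥0∞, Measurable F →
      ∫⁻ x, F x ∂ρ.fst ≤ ENNReal.ofReal (Real.exp ℓU) * ∫⁻ x, F x := by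
    intro F hF
    rw [Measure.fst, lintegral_map hF measurable_fst, ← hswap _ (by fun_prop)]
    refine (lintegral_mono fun w => lintegral_mono' (addNoise_le _ hA0n U hU w) le_rfl).trans_eq ?_
    simp
  -- the information splits into the part about `X 0 - A 0` and the conditional information
  have hsplit := lintegral_klDiv_eq_add ρ κ' (Kernel.const ℝ PY)
  have hI1 : ∫⁻ p, klDiv (κ' p) (Kernel.const ℝ PY p.1) ∂ρ ≤ I := by
    simp only [Kernel.const_apply, hκ', Kernel.comap_apply]
    rw [lintegral_klDiv_comp _ hgm, hgmap]
    exact hI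
  rw [hsplit] at hI1
  have hD1 : ∫⁻ p, ∫⁻ y, totalDist η (g p) y ∂κ' p ∂ρ ≤ D := by
    simp only [hκ', Kernel.comap_apply]
    rw [lintegral_totalDist_comp _ hgm, hgmap]
    exact hD
  set I0 := ∫⁻ p, klDiv (κ' p) (outputKernel ρ κ' p.1) ∂ρ with hI0
  set N := n - 1 with hN
  set last : Fin n := ⟨n - 1, by omega⟩ with hlast
  -- with this scale, the `η`-th power of a scaled distance is the distance power divided by `n`
  set s : ℝ := (n : ℝ) ^ (-η⁻¹) with hs
  have hspos : 0 < s := Real.rpow_pos_of_pos hn' _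
  have hpws : pw η s = (n : ℝ≥0∞)⁻¹ := by
    rw [pw, abs_of_pos hspos, hs, ← Real.rpow_mul hn'.le, neg_mul, inv_mul_cancel₀ h.eta_pos.ne',
      Real.rpow_neg_one, ENNReal.ofReal_inv_of_pos hn', ENNReal.ofReal_natCast]
  have ha : s * lam ^ N ≠ 0 := mul_ne_zero hspos.ne' (pow_ne_zero _ hlam0)
  have hDV := ofReal_log_le_klDiv_add (Real.exp_pos ℓU) hZpos hZeq ρ.fst hfst ha
    (outputKernel ρ κ') PY (fun y => -(s * y last)) (by fun_prop)
  have hψint : ∫⁻ q, pw η ((s * lam ^ N) * q.1 + -(s * q.2 last)) ∂(ρ.fst ⊗ₘ outputKernel ρ κ') ≤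
      C2 * (D / n + K) := by
    rw [lintegral_fst_compProd_outputKernel ρ κ' (by fun_prop)]
    have hpt : ∀ (p : ℝ × (ℕ → ℝ)) (y : Fin n → ℝ), pw η ((s * lam ^ N) * p.1 + -(s * y last)) ≤
        (n : ℝ≥0∞)⁻¹ * C2 * totalDist η (g p) y + (n : ℝ≥0∞)⁻¹ * C2 * pw η (bwd lam p.2 n N) := by
      intro p y
      have e1 : (s * lam ^ N) * p.1 + -(s * y last) =
          s * ((g p last - y last) + -bwd lam p.2 n N) := by
        simp only [hg, bwdBlock, hlast]
        ring
      rw [e1, pw_mul, hpws, ← mul_add, mul_assoc]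
      gcongr
      refine (hC2 _ _).trans ?_
      rw [pw_neg]
      gcongr
      exact Finset.single_le_sum (f := fun i => pw η (g p i - y i)) (fun i _ => zero_le)
        (Finset.mem_univ last)
    have hmom : ∫⁻ p, pw η (bwd lam p.2 n N) ∂ρ ≤ K := by
      rw [← hswap _ (by fun_prop)]
      simp only [lintegral_const, measure_univ, mul_one]
      exact h.moment_bwd (by omega)
    calc _ ≤ ∫⁻ p, ((n : ℝ≥0∞)⁻¹ * C2 * ∫⁻ y, totalDist η (g p) y ∂κ' p +
          (n : ℝ≥0∞)⁻¹ * C2 * pw η (bwd lam p.2 n N)) ∂ρ := by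
          refine lintegral_mono fun p => (lintegral_mono (hpt p)).trans_eq ?_
          rw [lintegral_add_right _ measurable_const, lintegral_const_mul _ (by fun_prop),
            lintegral_const, measure_univ, mul_one]
      _ = (n : ℝ≥0∞)⁻¹ * C2 * ∫⁻ p, ∫⁻ y, totalDist η (g p) y ∂κ' p ∂ρ +
          (n : ℝ≥0∞)⁻¹ * C2 * ∫⁻ p, pw η (bwd lam p.2 n N) ∂ρ := by
          rw [lintegral_add_right _ (by fun_prop), lintegral_const_mul,
            lintegral_const_mul _ (by fun_prop)]
          exact (measurable_lintegral_totalDist κ).comp hgm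
      _ ≤ (n : ℝ≥0∞)⁻¹ * C2 * D + 1 * C2 * K := by
          gcongr
          rw [ENNReal.inv_le_one]
          exact_mod_cast hn
      _ = _ := by
          rw [one_mul, mul_add, ENNReal.div_eq_inv_mul]
          ring
  refine ⟨I0 + C3, ?_, ?_⟩
  · refine achievable_of_two_stage 𝒲 (addNoise (fun w => -A0 w) hA0n U)
      (κ'.comap Prod.swap measurable_swap) Q (outputKernel ρ κ') (bwdBlock lam n)
      (by fun_prop) (fun q i => q.2 i - lam ^ (i : ℕ) * q.1) (by fun_prop) ?_ ?_
    · have e1 : ∀ (w : ℕ → ℝ) (a : ℝ) (t : Fin n → ℝ), totalDist η (bwdBlock lam n w)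
          (fun i => t i - lam ^ (i : ℕ) * a) = totalDist η (g (a, w)) t := by
        intro w a t
        simp only [totalDist, hg]
        refine Finset.sum_congr rfl fun i _ => ?_
        congr 1
        ring
      simp only [e1, Kernel.comap_apply, Prod.swap_prod_mk]
      exact (hswap (fun p => ∫⁻ t, totalDist η (g p) t ∂κ' p)
        ((measurable_lintegral_totalDist κ).comp hgm)).trans_le hD1
    · simp only [Kernel.comap_apply, Prod.swap_prod_mk]
      rw [hswap (fun p => klDiv (κ' p) (outputKernel ρ κ' p.1))
        (measurable_klDiv_kernel κ' ((outputKernel ρ κ').comap Prod.fst measurable_fst)), add_comm]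
      refine add_le_add_right ?_ _
      refine (lintegral_klDiv_addNoise_le _ hA0n U hQ 𝒲 hℓU hU).trans ?_
      rw [hC3]
      push_cast
      gcongr
      · exact le_rfl
      · calc ∫⁻ w, ∫⁻ x, pw η (-A0 w + x) ∂U ∂𝒲
            ≤ ∫⁻ w, ∫⁻ x, C2 * (pw η (A0 w) + pw η x) ∂U ∂𝒲 := by
              refine lintegral_mono fun w => lintegral_mono fun x => ?_
              refine (hC2 _ _).trans_eq ?_
              rw [pw_neg]
          _ = C2 * (∫⁻ w, pw η (A0 w) ∂𝒲 + ∫⁻ x, pw η x ∂U) := by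
              have : ∀ w, ∫⁻ x, C2 * (pw η (A0 w) + pw η x) ∂U =
                  C2 * (pw η (A0 w) + ∫⁻ x, pw η x ∂U) := fun w => by
                rw [lintegral_const_mul _ (by fun_prop), lintegral_add_left measurable_const]
                simp
              simp_rw [this]
              rw [lintegral_const_mul _ (by fun_prop), lintegral_add_right _ measurable_const]
              simp
          _ ≤ _ := by
              gcongr
              exact h.moment n
  · have e1 : ENNReal.ofReal (n * Real.log |lam|) ≤
        ENNReal.ofReal (Real.log |s * lam ^ N| - Real.log (Real.exp ℓU) - Real.log Z) +
          (C1 + ENNReal.ofReal (Real.log n / η)) := by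
      have e2 : Real.log |s * lam ^ N| = -(Real.log n / η) + (n - 1) * Real.log |lam| := by
        rw [abs_mul, Real.log_mul (abs_pos.2 hspos.ne').ne' (abs_pos.2 (pow_ne_zero _ hlam0)).ne',
          abs_of_pos hspos, hs, Real.log_rpow hn', abs_pow, Real.log_pow, hN,
          Nat.cast_sub (by omega), div_eq_mul_inv]
        push_cast
        ring
      have h0 : 0 ≤ Real.log |lam| := Real.log_nonneg hlam1.le
      have h1 : 0 ≤ Real.log n / η :=
        div_nonneg (Real.log_nonneg (by exact_mod_cast hn)) h.eta_pos.le
      have h3 : (C1 : ℝ≥0∞) = ENNReal.ofReal (Real.log |lam| + ℓU + |Real.log Z|) := rfl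
      rw [h3, ← ENNReal.ofReal_add (by positivity) h1]
      refine le_trans (ENNReal.ofReal_le_ofReal ?_) ENNReal.ofReal_add_le
      rw [e2, Real.log_exp]
      have := le_abs_self (Real.log Z)
      linarith
    set kl := klDiv (ρ.fst ⊗ₘ outputKernel ρ κ') (ρ.fst ⊗ₘ Kernel.const ℝ PY) with hkl
    calc I0 + C3 + ENNReal.ofReal (n * Real.log |lam|)
        ≤ I0 + C3 + ((kl + C2 * (D / n + K)) + (C1 + ENNReal.ofReal (Real.log n / η))) := by
          gcongr
          exact e1.trans (by gcongr; exact hDV.trans (by gcongr))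
      _ = (kl + I0) + ((C1 + C2 * K + C3) + ENNReal.ofReal (Real.log n / η) + C2 * (D / n)) := by
          ring
      _ ≤ _ := by
          have e3 : (C2 : ℝ≥0∞) ≤ ((C1 + C2 * K + C3 + C2 : ℝ≥0) : ℝ≥0∞) := by
            exact_mod_cast le_add_self
          have e4 : (C1 + C2 * K + C3 : ℝ≥0∞) ≤ ((C1 + C2 * K + C3 + C2 : ℝ≥0) : ℝ≥0∞) := by
            exact_mod_cast le_self_add
          gcongr

end IsNoise

/-! ### Side information about the initial value -/

/-- Some channel which sees a real variable `z` besides a block `x` maps `(z, x)`, of law `ρ`, to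
an output with expected total distortion at most `D` while conveying at most `I` nats on average
given `z`. The conditional information is bounded through an arbitrary kernel `π`, the infimum over
which is attained at the conditional law of the output. -/
def AchievableGiven {n : ℕ} (η : ℝ) (ρ : Measure (ℝ × (Fin n → ℝ))) (D I : ℝ≥0∞) : Prop :=
  ∃ (κ : Kernel (ℝ × (Fin n → ℝ)) (Fin n → ℝ)) (π : Kernel ℝ (Fin n → ℝ)), IsMarkovKernel κ ∧
    IsMarkovKernel π ∧ ∫⁻ p, ∫⁻ y, totalDist η p.2 y ∂κ p ∂ρ ≤ D ∧
    ∫⁻ p, klDiv (κ p) (π p.1) ∂ρ ≤ I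

/-- The initial value of the backwards process together with the block of its values. -/
def bwdPair (lam : ℝ) (n : ℕ) (w : ℕ → ℝ) : ℝ × (Fin n → ℝ) := (bwd lam w n 0, bwdBlock lam n w)

@[fun_prop]
theorem measurable_bwdPair {lam : ℝ} (n : ℕ) : Measurable (bwdPair lam n) := by
  unfold bwdPair; fun_prop

theorem bwd_succ_zero (lam : ℝ) (w : ℕ → ℝ) (k : ℕ) :
    bwd lam w (k + 1) 0 = lam⁻¹ * bwd lam (fun t => w (t + 1)) k 0 + -(lam⁻¹ * w 0) := by
  rw [bwd_of_lt lam w (Nat.succ_pos k), ← sub_eq_add_neg]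
  have := bwd_add_shift (lam := lam) w 1 k 0
  rw [add_comm 1 k, add_zero] at this
  rw [zero_add, this]
  simp only [add_comm 1]

theorem bwdPair_succ (lam : ℝ) (w : ℕ → ℝ) (k : ℕ) :
    bwdPair lam (k + 1) w = (bwd lam w (k + 1) 0,
      Fin.cons (bwd lam w (k + 1) 0) (bwdBlock lam k fun t => w (t + 1))) := by
  refine Prod.ext rfl (funext fun i => ?_)
  refine Fin.cases rfl (fun i => ?_) i
  simp only [bwdPair, bwdBlock, Fin.cons_succ, Fin.val_succ]
  have := bwd_add_shift (lam := lam) w 1 k i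
  rw [add_comm 1 k, add_comm 1 (i : ℕ)] at this
  rw [this]
  simp only [add_comm 1]

@[fun_prop]
theorem Measurable.finCons {α : Type*} [MeasurableSpace α] {k : ℕ} {f : α → ℝ} {g : α → Fin k → ℝ}
    (hf : Measurable f) (hg : Measurable g) :
    Measurable fun a => (Fin.cons (f a) (g a) : Fin (k + 1) → ℝ) := by
  refine measurable_pi_iff.2 fun i => ?_
  refine Fin.cases ?_ (fun i => ?_) i
  · simpa using hf
  · simp only [Fin.cons_succ]; fun_prop

namespace IsNoise

variable {lam η : ℝ} {K : ℝ≥0} {ν : Measure ℝ} {𝒲 : Measure (ℕ → ℝ)} (h : IsNoise lam η K ν 𝒲)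
include h

/-- Replacing the first noise variable by an independent one, whose law is at most `a` times the
original law, multiplies integrals by at most `a`. -/
theorem lintegral_resample_le {β : Measure ℝ} [IsProbabilityMeasure β] {a : ℝ≥0}
    (hβ : β ≤ (a : ℝ≥0∞) • ν) (k : ℕ) {F : ℝ × (Fin (k + 1) → ℝ) → ℝ≥0∞} (hF : Measurable F) :
    ∫⁻ w, ∫⁻ x, F (x, Fin.cons x (bwdBlock lam k fun t => w (t + 1)))
      ∂addNoise (fun w => lam⁻¹ * bwd lam (fun t => w (t + 1)) k 0) (by fun_prop)
        (β.map fun x => -(lam⁻¹ * x)) w ∂𝒲 ≤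
      a * ∫⁻ p, F p ∂(𝒲.map (bwdPair lam (k + 1))) := by
  have := h.prob
  have := h.prob_marginal
  have : IsProbabilityMeasure (β.map fun x => -(lam⁻¹ * x)) :=
    Measure.isProbabilityMeasure_map (by fun_prop)
  set H : ℝ × (ℕ → ℝ) → ℝ≥0∞ := fun q => F (lam⁻¹ * bwd lam q.2 k 0 + -(lam⁻¹ * q.1),
    Fin.cons (lam⁻¹ * bwd lam q.2 k 0 + -(lam⁻¹ * q.1)) (bwdBlock lam k q.2)) with hH
  have hbm : Measurable fun p : ℝ × (ℕ → ℝ) => bwdBlock lam k p.2 :=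
    (measurable_bwdBlock k).comp measurable_snd
  have hHm : Measurable H := by fun_prop
  have hbm' : Measurable fun w : ℕ → ℝ => bwdBlock lam k fun t => w (t + 1) :=
    (measurable_bwdBlock k).comp (by fun_prop)
  have hshift : 𝒲.map (fun w t => w (t + 1)) = 𝒲 := by
    simpa only [add_comm 1] using h.map_shift 1
  calc _ = ∫⁻ w, ∫⁻ x, H (x, fun t => w (t + 1)) ∂β ∂𝒲 := by
        refine lintegral_congr fun w => ?_
        rw [lintegral_addNoise _ _ _ _ (by fun_prop), lintegral_map (by fun_prop) (by fun_prop)]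
    _ = ∫⁻ v, ∫⁻ x, H (x, v) ∂β ∂𝒲 := by
        conv_rhs => rw [← hshift]
        rw [lintegral_map (f := fun v => ∫⁻ x, H (x, v) ∂β) (by fun_prop) (by fun_prop)]
    _ ≤ ∫⁻ v, a * ∫⁻ x, H (x, v) ∂ν ∂𝒲 := by
        refine lintegral_mono fun v => (lintegral_mono' hβ le_rfl).trans_eq ?_
        rw [lintegral_smul_measure]
        rfl
    _ = a * ∫⁻ w, H (w 0, fun t => w (t + 1)) ∂𝒲 := by
        rw [lintegral_const_mul _ (by fun_prop), ← lintegral_prod_symm _ hHm.aemeasurable,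
          ← h.map_split, lintegral_map hHm (by fun_prop)]
    _ = _ := by
        rw [lintegral_map hF (by fun_prop)]
        congr 1
        refine lintegral_congr fun w => ?_
        rw [bwdPair_succ, bwd_succ_zero]

/-- Knowledge of the initial value hardly helps. The first noise variable is replaced by an
independent one of bounded density; the new initial value then has bounded density given the later
times, so that it can be conveyed at a bounded cost, and the description that assumes it to be
known can be used. -/
theorem exists_of_achievableGiven {β : Measure ℝ} [IsProbabilityMeasure β] {a : ℝ≥0}
    (hβ : β ≤ (a : ℝ≥0∞) • ν) {ℓ : ℝ} (hℓ : 0 ≤ ℓ)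
    (hβℓ : β ≤ ENNReal.ofReal (Real.exp ℓ) • volume) :
    ∃ C : ℝ≥0, ∀ (k : ℕ) (D I : ℝ≥0∞),
      AchievableGiven η (𝒲.map (bwdPair lam (k + 1))) D I →
      Achievable η (𝒲.map (bwdBlock lam (k + 1))) (a * D + C) (a * I + C) := by
  have := h.prob
  obtain ⟨C2, hC2⟩ := exists_pw_add_le' h.eta_pos
  obtain ⟨Q, CQ, hQp, hQ⟩ := exists_reference h.eta_pos
  have hlam0 := h.lam_ne_zero
  have hlam1 := h.one_lt
  set N : Measure ℝ := β.map fun x => -(lam⁻¹ * x) with hN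
  have hNp : IsProbabilityMeasure N := Measure.isProbabilityMeasure_map (by fun_prop)
  set ℓ' := ℓ + Real.log |lam| with hℓ'
  have hlog : 0 ≤ Real.log |lam| := Real.log_nonneg hlam1.le
  have hNle : N ≤ ENNReal.ofReal (Real.exp ℓ') • volume := by
    have e1 : (fun x => -(lam⁻¹ * x)) = fun x => (-lam⁻¹) * x := by ext x; ring
    rw [hN, e1]
    refine (Measure.map_mono hβℓ (by fun_prop)).trans_eq ?_
    rw [Measure.map_smul, Real.map_volume_mul_left (neg_ne_zero.2 (inv_ne_zero hlam0)), smul_smul,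
      ← ENNReal.ofReal_mul (by positivity), hℓ', Real.exp_add,
      Real.exp_log (by positivity), inv_neg, inv_inv, abs_neg]
  set CI : ℝ≥0 := Real.toNNReal ℓ' + CQ + a * K with hCI
  set CD : ℝ≥0 := C2 * (K + a * K) with hCD
  refine ⟨CI + CD, fun k D I hA => ?_⟩
  obtain ⟨κ, π, hκ, hπ, hD, hI⟩ := hA
  have hVm : Measurable fun w : ℕ → ℝ => lam⁻¹ * bwd lam (fun t => w (t + 1)) k 0 := by
    fun_prop
  have hres := fun (F : ℝ × (Fin (k + 1) → ℝ) → ℝ≥0∞) (hF : Measurable F) =>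
    h.lintegral_resample_le hβ k hF
  have hbm' : Measurable fun p : (ℕ → ℝ) × ℝ => bwdBlock lam k fun t => p.1 (t + 1) :=
    (measurable_bwdBlock k).comp (by fun_prop)
  have hcm : Measurable fun p : (ℕ → ℝ) × ℝ =>
      ((p.2, Fin.cons p.2 (bwdBlock lam k fun t => p.1 (t + 1))) : ℝ × (Fin (k + 1) → ℝ)) := by
    fun_prop
  have hmom : ∫⁻ p, pw η p.1 ∂(𝒲.map (bwdPair lam (k + 1))) ≤ K := by
    rw [lintegral_map (by fun_prop) (by fun_prop)]
    exact h.moment (k + 1)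
  have hmom' : ∫⁻ w, ∫⁻ x, pw η x ∂addNoise _ hVm N w ∂𝒲 ≤ a * K :=
    (hres (fun p => pw η p.1) (by fun_prop)).trans (by gcongr)
  refine achievable_of_two_stage 𝒲 (addNoise _ hVm N) (κ.comap _ hcm) Q π (bwdBlock lam (k + 1))
    (by fun_prop) (fun q => Fin.cons q.1 (Fin.tail q.2)) ?_ ?_ ?_
  · have : Measurable fun q : ℝ × (Fin (k + 1) → ℝ) => Fin.tail q.2 := by
      unfold Fin.tail; fun_prop
    fun_prop
  · have hGm : Measurable fun p : ℝ × (Fin (k + 1) → ℝ) => ∫⁻ y, totalDist η p.2 y ∂κ p :=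
      Measurable.lintegral_kernel_prod_right' (κ := κ) (f := fun q => totalDist η q.1.2 q.2)
        (by fun_prop)
    have hpt : ∀ (w : ℕ → ℝ) (x : ℝ) (t : Fin (k + 1) → ℝ),
        totalDist η (bwdBlock lam (k + 1) w) (Fin.cons x (Fin.tail t)) ≤
        totalDist η (Fin.cons x (bwdBlock lam k fun t => w (t + 1)) : Fin (k + 1) → ℝ) t +
          C2 * (pw η (bwd lam w (k + 1) 0) + pw η x) := by
      intro w x t
      have e0 : bwdBlock lam (k + 1) w = Fin.cons (bwd lam w (k + 1) 0)
        (bwdBlock lam k fun t => w (t + 1)) := congrArg Prod.snd (bwdPair_succ lam w k)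
      rw [e0, totalDist, totalDist, Fin.sum_univ_succ, Fin.sum_univ_succ]
      simp only [Fin.cons_zero, Fin.cons_succ, Fin.tail]
      rw [add_comm, add_assoc]
      refine le_trans ?_ le_add_self
      gcongr
      rw [sub_eq_add_neg]
      refine (hC2 _ _).trans_eq ?_
      rw [pw_neg]
    calc _ ≤ ∫⁻ w, ∫⁻ x, (∫⁻ t, totalDist η
            (Fin.cons x (bwdBlock lam k fun t => w (t + 1)) : Fin (k + 1) → ℝ) t
            ∂κ (x, Fin.cons x (bwdBlock lam k fun t => w (t + 1))) +
          C2 * (pw η (bwd lam w (k + 1) 0) + pw η x)) ∂addNoise _ hVm N w ∂𝒲 := by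
          refine lintegral_mono fun w => lintegral_mono fun x =>
            (lintegral_mono (hpt w x)).trans_eq ?_
          rw [lintegral_add_right _ measurable_const, lintegral_const, measure_univ, mul_one]
          rfl
      _ = ∫⁻ w, ∫⁻ x, ∫⁻ t, totalDist η
            (Fin.cons x (bwdBlock lam k fun t => w (t + 1)) : Fin (k + 1) → ℝ) t
            ∂κ (x, Fin.cons x (bwdBlock lam k fun t => w (t + 1))) ∂addNoise _ hVm N w ∂𝒲 +
          C2 * (∫⁻ w, pw η (bwd lam w (k + 1) 0) ∂𝒲 +
            ∫⁻ w, ∫⁻ x, pw η x ∂addNoise _ hVm N w ∂𝒲) := by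
          rw [← lintegral_add_left (by fun_prop), ← lintegral_const_mul,
            ← lintegral_add_right]
          · refine lintegral_congr fun w => ?_
            rw [lintegral_add_right _ (by fun_prop), lintegral_const_mul _ (by fun_prop),
              lintegral_add_left measurable_const, lintegral_const, measure_univ, mul_one]
          · exact ((by fun_prop : Measurable fun w : ℕ → ℝ => pw η (bwd lam w (k + 1) 0)).add
              (measurable_pw.lintegral_kernel)).const_mul _
          · exact (by fun_prop : Measurable fun w : ℕ → ℝ => pw η (bwd lam w (k + 1) 0)).add
              (measurable_pw.lintegral_kernel)
      _ ≤ a * D + C2 * (K + a * K) := by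
          gcongr
          · exact (hres _ hGm).trans (by gcongr)
          · exact h.moment (k + 1)
      _ ≤ _ := by
          have e3 : (C2 * (K + a * K) : ℝ≥0∞) ≤ ((CI + CD : ℝ≥0) : ℝ≥0∞) := by
            exact_mod_cast le_add_self
          gcongr
  · have e3 : (CI : ℝ≥0∞) ≤ ((CI + CD : ℝ≥0) : ℝ≥0∞) := by
      exact_mod_cast le_self_add
    rw [add_comm]
    gcongr
    · exact (hres (fun p => klDiv (κ p) (π p.1))
        (measurable_klDiv_kernel κ (π.comap Prod.fst measurable_fst))).trans (by gcongr)
    · refine le_trans ?_ e3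
      refine (lintegral_klDiv_addNoise_le _ hVm N hQ 𝒲 (by positivity) hNle).trans ?_
      rw [hCI]
      push_cast
      gcongr
      · exact le_rfl
      · refine le_of_eq_of_le (lintegral_congr fun w => ?_) hmom'
        rw [lintegral_addNoise _ _ _ _ (by fun_prop)]

end IsNoise

section ConditionalRate

variable {n : ℕ} {η : ℝ}

theorem lintegral_blockDist_compProd (ρ : Measure (ℝ × (Fin n → ℝ))) [IsProbabilityMeasure ρ]
    (κ : Kernel (ℝ × (Fin n → ℝ)) (Fin n → ℝ)) [IsMarkovKernel κ] :
    ∫⁻ p, blockDist η p.1.2 p.2 ∂(ρ ⊗ₘ κ) = (∫⁻ p, ∫⁻ y, totalDist η p.2 y ∂κ p ∂ρ) / n := by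
  rw [lintegral_blockDist _ (by fun_prop) measurable_snd, Measure.lintegral_compProd (by fun_prop)]

theorem condRateDistortion_le (ρ : Measure (ℝ × (Fin n → ℝ))) [IsProbabilityMeasure ρ] {d : ℝ}
    {I : ℝ≥0∞} (h : AchievableGiven η ρ (n * ENNReal.ofReal d) I) :
    condRateDistortion η ρ d ≤ I / ENNReal.ofReal (Real.log 2) / n := by
  obtain ⟨κ, π, hκ, hπ, hD, hI⟩ := h
  refine (iInf_le_of_le κ (iInf_le_of_le hκ (iInf_le _ ?_))).trans ?_
  · rw [lintegral_blockDist_compProd]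
    exact ENNReal.div_le_of_le_mul' hD
  · gcongr
    exact (condMutualInfo_le ρ κ π).trans (by gcongr)

theorem achievableGiven_of_condRateDistortion_lt (ρ : Measure (ℝ × (Fin n → ℝ)))
    [IsProbabilityMeasure ρ] (hn : n ≠ 0) {d : ℝ} {x : ℝ≥0∞}
    (h : condRateDistortion η ρ d < x) :
    AchievableGiven η ρ (n * ENNReal.ofReal d) (n * (x * ENNReal.ofReal (Real.log 2))) := by
  have hn' : (n : ℝ≥0∞) ≠ 0 := by exact_mod_cast hn
  simp only [condRateDistortion, iInf_lt_iff] at h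
  obtain ⟨κ, hκ, hD, hI⟩ := h
  refine ⟨κ, outputKernel ρ κ, hκ, inferInstance, ?_, ?_⟩
  · rwa [lintegral_blockDist_compProd, ENNReal.div_le_iff hn' (by simp), mul_comm] at hD
  · have := hI.le
    rwa [condMutualInfo_eq, ENNReal.div_le_iff hn' (by simp),
      ENNReal.div_le_iff ofReal_log_two_pos ENNReal.ofReal_ne_top, mul_comm x, mul_assoc] at this

/-- Finer side information decreases the rate. -/
theorem AchievableGiven.of_map {ρ : Measure (ℝ × (Fin n → ℝ))} {g : ℝ → ℝ} (hg : Measurable g)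
    {D I : ℝ≥0∞} (h : AchievableGiven η (ρ.map fun p => (g p.1, p.2)) D I) :
    AchievableGiven η ρ D I := by
  obtain ⟨κ, π, hκ, hπ, hD, hI⟩ := h
  have hgm : Measurable fun p : ℝ × (Fin n → ℝ) => (g p.1, p.2) := by fun_prop
  refine ⟨κ.comap _ hgm, π.comap g hg, inferInstance, inferInstance, ?_, ?_⟩
  · rwa [lintegral_map (Measurable.lintegral_kernel_prod_right' (κ := κ)
      (f := fun q => totalDist η q.1.2 q.2) (by fun_prop)) hgm] at hD
  · rwa [lintegral_map (f := fun p => klDiv (κ p) (π p.1))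
      (measurable_klDiv_kernel κ (π.comap Prod.fst measurable_fst)) hgm] at hI

/-- Side information does not increase the rate. -/
theorem Achievable.given {ρ : Measure (ℝ × (Fin n → ℝ))} [IsProbabilityMeasure ρ]
    {D I : ℝ≥0∞} (h : Achievable η ρ.snd D I) : AchievableGiven η ρ D I := by
  obtain ⟨κ, hκ, hD, hI⟩ := h
  refine ⟨κ.comap _ measurable_snd, Kernel.const ℝ (κ ∘ₘ ρ.snd), inferInstance, inferInstance,
    ?_, ?_⟩
  · simp only [Kernel.comap_apply]
    rwa [lintegral_totalDist_comp _ measurable_snd]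
  · simp only [Kernel.comap_apply, Kernel.const_apply]
    rwa [lintegral_klDiv_comp _ measurable_snd]

/-- A description without distortion that conveys a finite amount of information requires the
block to be, given the side information, an atom of the reference law. -/
theorem AchievableGiven.ae_ne_zero {ρ : Measure (ℝ × (Fin n → ℝ))} {I : ℝ≥0∞}
    (hI : I ≠ ∞) (h : AchievableGiven η ρ 0 I) :
    ∃ π : Kernel ℝ (Fin n → ℝ), IsMarkovKernel π ∧ ∀ᵐ p ∂ρ, π p.1 {p.2} ≠ 0 := by
  obtain ⟨κ, π, hκ, hπ, hD, hI'⟩ := h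
  refine ⟨π, hπ, ?_⟩
  have h1 : ∀ᵐ p ∂ρ, ∫⁻ y, totalDist η p.2 y ∂κ p = 0 := by
    rw [nonpos_iff_eq_zero, lintegral_eq_zero_iff (Measurable.lintegral_kernel_prod_right' (κ := κ)
      (f := fun q => totalDist η q.1.2 q.2) (by fun_prop))] at hD
    exact hD
  have h2 : ∀ᵐ p ∂ρ, klDiv (κ p) (π p.1) < ∞ :=
    ae_lt_top (measurable_klDiv_kernel κ (π.comap Prod.fst measurable_fst))
      (ne_top_of_le_ne_top hI hI')
  filter_upwards [h1, h2] with p hp1 hp2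
  have hac : κ p ≪ π p.1 := by
    by_contra hac
    rw [klDiv_of_not_ac hac] at hp2
    exact lt_irrefl _ hp2
  rw [lintegral_eq_zero_iff (by fun_prop)] at hp1
  have h3 : ∀ᵐ y ∂κ p, y ∈ ({p.2} : Set (Fin n → ℝ)) := by
    filter_upwards [hp1] with y hy
    have h4 : ∑ i, pw η (p.2 i - y i) = 0 := hy
    ext i
    have h5 := pw_eq_zero (Finset.sum_eq_zero_iff.1 h4 i (Finset.mem_univ i))
    linarith
  intro h0
  have h6 : κ p {p.2}ᶜ = 0 := h3
  have h7 := measure_univ (μ := κ p)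
  rw [← Set.union_compl_self {p.2}] at h7
  have h8 := measure_union_le (μ := κ p) {p.2} {p.2}ᶜ
  rw [h7, hac h0, h6] at h8
  simp at h8

end ConditionalRate

namespace IsNoise

variable {lam η : ℝ} {K : ℝ≥0} {ν : Measure ℝ} {𝒲 : Measure (ℕ → ℝ)} (h : IsNoise lam η K ν 𝒲)
include h

/-- The initial value has a density given the noise at later times. -/
theorem ae_notMem_of_volume_section (hν : ν ≪ volume) (k : ℕ) {E : Set (ℝ × (ℕ → ℝ))}
    (hE : MeasurableSet E) (hE0 : ∀ᵐ v ∂𝒲, volume {z | (z, v) ∈ E} = 0) :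
    ∀ᵐ w ∂𝒲, (bwd lam w (k + 1) 0, fun t => w (t + 1)) ∉ E := by
  have := h.prob
  have := h.prob_marginal
  have hlam0 := h.lam_ne_zero
  set Ψ : ℝ × (ℕ → ℝ) → ℝ × (ℕ → ℝ) :=
    fun q => (lam⁻¹ * bwd lam q.2 k 0 + -(lam⁻¹ * q.1), q.2) with hΨ
  have hΨm : Measurable Ψ := by fun_prop
  have key : ∀ᵐ q ∂(ν.prod 𝒲), Ψ q ∉ E := by
    have h1 : MeasurableSet {q | Ψ q ∉ E} := (hΨm hE).compl
    have h2 : ∀ᵐ q ∂(𝒲.prod ν), Ψ q.swap ∉ E := by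
      rw [Measure.ae_prod_iff_ae_ae (p := fun q => Ψ q.swap ∉ E) (measurable_swap h1)]
      filter_upwards [hE0] with v hv
      refine hν ?_
      have h3 : Measurable fun z : ℝ => -lam⁻¹ * z + lam⁻¹ * bwd lam v k 0 := by fun_prop
      have h4 : MeasurableSet {z | (z, v) ∈ E} := measurable_prodMk_right hE
      have h5 := lintegral_comp_affine (Set.indicator {z | (z, v) ∈ E} 1)
        (measurable_one.indicator h4) (neg_ne_zero.2 (inv_ne_zero hlam0)) (lam⁻¹ * bwd lam v k 0)
      rw [lintegral_indicator_one h4, hv, mul_zero] at h5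
      have h7 := (lintegral_eq_zero_iff ((measurable_one.indicator h4).comp h3)).1 h5
      change ∀ᵐ x, Ψ (x, v) ∉ E
      filter_upwards [h7] with x hx hxE
      have h6 : -lam⁻¹ * x + lam⁻¹ * bwd lam v k 0 ∈ {z | (z, v) ∈ E} := by
        simp only [hΨ] at hxE
        have : -lam⁻¹ * x + lam⁻¹ * bwd lam v k 0 = lam⁻¹ * bwd lam v k 0 + -(lam⁻¹ * x) := by ring
        rwa [Set.mem_ofPred_eq, this]
      exact one_ne_zero ((Set.indicator_of_mem h6 (1 : ℝ → ℝ≥0∞)).symm.trans hx)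
    rw [← Measure.prod_swap]
    exact (ae_map_iff (by fun_prop) h1).2 h2
  rw [← h.map_split] at key
  filter_upwards [(ae_map_iff (p := fun q => Ψ q ∉ E) (by fun_prop) (hΨm hE).compl).1 key]
    with w hw
  rwa [bwd_succ_zero]

/-- A block of at least two times cannot be described without distortion, even knowing the initial
value. -/
theorem not_achievableGiven_zero (hν : ν ≪ volume) (k : ℕ) {I : ℝ≥0∞} (hI : I ≠ ∞) :
    ¬ AchievableGiven η (𝒲.map (bwdPair lam (k + 2))) 0 I := by
  intro hA
  have := h.prob
  obtain ⟨π, hπ, hae⟩ := hA.ae_ne_zero hI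
  -- the law of the second coordinate
  set π1 : Kernel ℝ ℝ := π.map fun y => y 1 with hπ1
  have hm1 : Measurable fun y : Fin (k + 2) → ℝ => y 1 := measurable_pi_apply 1
  have : IsMarkovKernel π1 := Kernel.IsMarkovKernel.map _ hm1
  set T : Set (ℝ × ℝ) := {q | π1 q.1 {q.2} ≠ 0} with hT
  have hTm : MeasurableSet T := by
    have h1 : Measurable fun q : ℝ × ℝ => (π1.comap Prod.fst measurable_fst) q
        (Prod.mk q ⁻¹' {r : (ℝ × ℝ) × ℝ | r.2 = r.1.2}) :=
      Kernel.measurable_kernel_prodMk_left (measurableSet_eq_fun (by fun_prop) (by fun_prop))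
    exact (h1 (measurableSet_singleton 0)).compl
  have hcount : ∀ z : ℝ, volume (Prod.mk z ⁻¹' T) = 0 := fun z =>
    (Measure.countable_meas_pos_of_disjoint_iUnion (μ := π1 z) (As := fun a : ℝ => {a})
      (fun a => measurableSet_singleton a)
      (fun a b hab => by simpa using hab)).mono (fun a ha => pos_iff_ne_zero.2 ha)
      |>.measure_zero volume
  have hT0 : ∀ᵐ a : ℝ, volume {z | (z, a) ∈ T} = 0 := by
    have h2 : (volume.prod volume : Measure (ℝ × ℝ)) T = 0 := by
      rw [Measure.measure_prod_null hTm]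
      exact ae_of_all _ hcount
    rw [← Measure.prod_swap, Measure.map_apply measurable_swap hTm,
      Measure.measure_prod_null (measurable_swap hTm)] at h2
    exact h2
  have hA1 : ∀ᵐ v ∂𝒲, volume {z | (z, bwd lam v (k + 1) 0) ∈ T} = 0 := by
    set N : Set ℝ := toMeasurable volume {a | ¬ volume {z | (z, a) ∈ T} = 0} with hN
    have hN0 : volume N = 0 := by rw [hN, measure_toMeasurable]; exact hT0
    have := h.ae_notMem_of_volume_section hν k (E := Prod.fst ⁻¹' N)
      (measurable_fst (measurableSet_toMeasurable _ _))
      (ae_of_all _ fun v => by simpa using hN0)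
    filter_upwards [this] with v hv
    by_contra hcon
    exact hv (subset_toMeasurable volume _ hcon)
  have hfin := h.ae_notMem_of_volume_section hν (k + 1)
    (E := (fun q : ℝ × (ℕ → ℝ) => (q.1, bwd lam q.2 (k + 1) 0)) ⁻¹' T)
    ((by fun_prop : Measurable fun q : ℝ × (ℕ → ℝ) => (q.1, bwd lam q.2 (k + 1) 0)) hTm)
    (by simpa using hA1)
  have hae' := ae_of_ae_map (by fun_prop : AEMeasurable (bwdPair lam (k + 2)) 𝒲) hae
  obtain ⟨w, hw1, hw2⟩ := (hfin.and hae').exists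
  apply hw1
  intro h0
  apply hw2
  rw [hπ1, Kernel.map_apply' _ hm1 _ (measurableSet_singleton _)] at h0
  refine measure_mono_null ?_ h0
  rintro y rfl
  rw [bwdPair_succ]
  simp only [Set.mem_preimage, Set.mem_singleton_iff]
  rfl

end IsNoise

/-! ### Time sharing and long blocks -/

section TimeSharing

variable {n : ℕ} {η : ℝ}

/-- Time sharing: two channels can be mixed at random. -/
theorem Achievable.mix {μ : Measure (Fin n → ℝ)} [IsProbabilityMeasure μ] {D₁ I₁ D₂ I₂ : ℝ≥0∞}
    (h₁ : Achievable η μ D₁ I₁) (h₂ : Achievable η μ D₂ I₂) {p q : ℝ≥0∞} (hpq : p + q = 1) :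
    Achievable η μ (p * D₁ + q * D₂) (p * I₁ + q * I₂) := by
  obtain ⟨κ₁, hκ₁, hD₁, hI₁⟩ := h₁
  obtain ⟨κ₂, hκ₂, hD₂, hI₂⟩ := h₂
  set β : Measure Bool := p • Measure.dirac true + q • Measure.dirac false with hβ
  have hβp : IsProbabilityMeasure β := ⟨by simp [hβ, hpq]⟩
  have hint : ∀ F : Bool → ℝ≥0∞, ∫⁻ b, F b ∂β = p * F true + q * F false := fun F => by
    rw [hβ, lintegral_add_measure, lintegral_smul_measure, lintegral_smul_measure, lintegral_dirac,
      lintegral_dirac]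
    rfl
  have hs : MeasurableSet {b : Bool | b = true} := MeasurableSet.of_discrete
  have hs' : MeasurableSet {x : (Fin n → ℝ) × Bool | x.2 = true} := measurable_snd hs
  classical
  set κ : Kernel ((Fin n → ℝ) × Bool) (Fin n → ℝ) :=
    Kernel.piecewise hs' (Kernel.prodMkRight Bool κ₁) (Kernel.prodMkRight Bool κ₂) with hκ
  set π : Kernel Bool (Fin n → ℝ) :=
    Kernel.piecewise hs (Kernel.const Bool (κ₁ ∘ₘ μ)) (Kernel.const Bool (κ₂ ∘ₘ μ)) with hπ
  have e1 : ∀ s, κ (s, true) = κ₁ s := fun s => by simp [hκ, Kernel.piecewise_apply]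
  have e2 : ∀ s, κ (s, false) = κ₂ s := fun s => by simp [hκ, Kernel.piecewise_apply]
  have e3 : π true = κ₁ ∘ₘ μ := by simp [hπ, Kernel.piecewise_apply]
  have e4 : π false = κ₂ ∘ₘ μ := by simp [hπ, Kernel.piecewise_apply]
  rw [← Measure.map_id (μ := μ)]
  refine achievable_of_two_stage μ (Kernel.const _ β) κ β π id measurable_id Prod.snd
    measurable_snd ?_ ?_
  · simp only [Kernel.const_apply, hint, e1, e2, id]
    rw [lintegral_add_left ((measurable_lintegral_totalDist κ₁).const_mul p),
      lintegral_const_mul _ (measurable_lintegral_totalDist κ₁),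
      lintegral_const_mul _ (measurable_lintegral_totalDist κ₂)]
    gcongr
  · simp only [Kernel.const_apply, hint, e1, e2, e3, e4, klDiv_self, lintegral_zero, zero_add]
    rw [lintegral_add_left ((measurable_klDiv_left κ₁ _).const_mul p),
      lintegral_const_mul _ (measurable_klDiv_left κ₁ _),
      lintegral_const_mul _ (measurable_klDiv_left κ₂ _)]
    gcongr

theorem exists_pos_pw_le (hη : 0 < η) {δ : ℝ≥0} (hδ : 0 < δ) : ∃ x : ℝ, 0 < x ∧ pw η x ≤ δ := by
  have hδ' : (0 : ℝ) < δ := hδ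
  refine ⟨(δ : ℝ) ^ η⁻¹, Real.rpow_pos_of_pos hδ' _, ?_⟩
  rw [pw, abs_of_pos (Real.rpow_pos_of_pos hδ' _), Real.rpow_inv_rpow hδ'.le hη.ne',
    ENNReal.ofReal_coe_nnreal]

/-- A number in `(0, 1]` that makes given products small. -/
theorem exists_pos_mul_le (A B x y : ℝ≥0) (hx : 0 < x) (hy : 0 < y) :
    ∃ t : ℝ≥0, 0 < t ∧ t ≤ 1 ∧ t * A ≤ x ∧ t * B ≤ y := by
  have key : ∀ C z : ℝ≥0, z / (C + 1) * C ≤ z := fun C z => by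
    rw [div_mul_eq_mul_div, div_le_iff₀ (by positivity)]
    exact mul_le_mul_of_nonneg_left le_self_add zero_le
  refine ⟨min 1 (min (x / (A + 1)) (y / (B + 1))), by positivity, min_le_left _ _, ?_, ?_⟩
  · exact le_trans (by gcongr; exact (min_le_right _ _).trans (min_le_left _ _)) (key A x)
  · exact le_trans (by gcongr; exact (min_le_right _ _).trans (min_le_right _ _)) (key B y)

theorem eventually_const_le_mul (C : ℝ≥0) {e : ℝ≥0} (he : 0 < e) :
    ∀ᶠ n : ℕ in atTop, C ≤ n * e := by
  obtain ⟨N, hN⟩ := exists_nat_ge (C / e)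
  filter_upwards [eventually_ge_atTop N] with n hn
  rw [← div_le_iff₀ he]
  exact hN.trans (by exact_mod_cast hn)

theorem eventually_add_log_le_mul (C : ℝ≥0) (η : ℝ) {e : ℝ≥0} (he : 0 < e) :
    ∀ᶠ n : ℕ in atTop, C + ENNReal.ofReal (Real.log n / η) ≤ (n * e : ℝ≥0∞) := by
  have h2 : (0 : ℝ) < e / 2 := by positivity
  have h1 : ∀ᶠ n : ℕ in atTop, Real.log n / η ≤ (e / 2) * n := by
    have hlog : Tendsto (fun n : ℕ => Real.log n / n * η⁻¹) atTop (𝓝 (0 * η⁻¹)) :=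
      ((Real.isLittleO_log_id_atTop.tendsto_div_nhds_zero).comp
        tendsto_natCast_atTop_atTop).mul_const _
    rw [zero_mul] at hlog
    filter_upwards [hlog.eventually_lt_const h2, eventually_gt_atTop 0] with n hn hn0
    have hn0' : (0 : ℝ) < n := by exact_mod_cast hn0
    rw [div_mul_eq_mul_div, div_lt_iff₀ hn0', ← div_eq_mul_inv] at hn
    exact hn.le
  filter_upwards [h1, eventually_const_le_mul C (half_pos he)] with n hn1 hn2
  calc C + ENNReal.ofReal (Real.log n / η)
      ≤ ((n * (e / 2) : ℝ≥0) : ℝ≥0∞) + ENNReal.ofReal ((e / 2) * n) := by gcongr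
    _ = ((n * (e / 2) : ℝ≥0) : ℝ≥0∞) + ((n * (e / 2) : ℝ≥0) : ℝ≥0∞) := by
        congr 1
        rw [← ENNReal.ofReal_coe_nnreal]
        congr 1
        push_cast
        ring
    _ = n * e := by
        rw [← ENNReal.coe_add, ← mul_add, add_halves]
        push_cast
        rfl

end TimeSharing

namespace IsNoise

variable {lam η : ℝ} {K : ℝ≥0} {ν : Measure ℝ} {𝒲 : Measure (ℕ → ℝ)} (h : IsNoise lam η K ν 𝒲)
include h

/-- The output `0` conveys nothing and has total distortion at most `n * K`. -/
theorem achievable_zero (n : ℕ) : Achievable η (𝒲.map (bwdBlock lam n)) (n * K) 0 := by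
  have := h.prob
  have := isProbabilityMeasure_bwdBlock (lam := lam) (𝒲 := 𝒲) n
  refine ⟨Kernel.const _ (Measure.dirac 0), inferInstance, ?_, ?_⟩
  · simp only [Kernel.const_apply, lintegral_dirac]
    rw [lintegral_map (by fun_prop) (by fun_prop)]
    unfold totalDist
    rw [lintegral_finsetSum _ (fun i _ => by unfold bwdBlock; fun_prop)]
    calc _ ≤ ∑ i : Fin n, (K : ℝ≥0∞) := by
          refine Finset.sum_le_sum fun i _ => ?_
          simp only [Pi.zero_apply, sub_zero]
          exact h.moment_bwd i.2.le
      _ = n * K := by simp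
  · simp [Measure.const_comp]

/-- Repeated concatenation of copies of one description; the remaining `r` times are not described
at all. -/
theorem exists_chain (ε : ℝ≥0) (hε : 0 < ε) : ∃ C : ℝ≥0, ∀ δ : ℝ, 0 < δ → ∃ c : ℝ≥0,
    ∀ (m : ℕ) (D I : ℝ≥0∞), Achievable η (𝒲.map (bwdBlock lam m)) D I → ∀ q r : ℕ,
      Achievable η (𝒲.map (bwdBlock lam (q * m + r)))
        (q * ((1 + ε) * D + C * pw η δ) + r * K) (q * (I + c)) := by
  obtain ⟨C, hC⟩ := h.exists_concat ε hε
  refine ⟨C, fun δ hδ => ?_⟩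
  obtain ⟨c, hc⟩ := hC δ hδ
  refine ⟨c, fun m D I hA q r => ?_⟩
  induction q with
  | zero =>
    rw [zero_mul, zero_add]
    exact (h.achievable_zero r).mono (by simp) (by simp)
  | succ q ih =>
    have e1 : (q + 1) * m + r = m + (q * m + r) := by ring
    rw [e1]
    refine (hc m (q * m + r) _ _ D I hA ih).mono (le_of_eq ?_) (le_of_eq ?_)
    · push_cast
      ring
    · push_cast
      ring

/-- Every positive distortion is achieved at a finite rate. -/
theorem exists_achievable {δ : ℝ≥0} (hδ : 0 < δ) : ∃ C : ℝ≥0, ∀ n : ℕ,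
    Achievable η (𝒲.map (bwdBlock lam n)) (n * δ) (n * C) := by
  have := h.prob
  obtain ⟨C2, hC2⟩ := exists_pw_add_le' h.eta_pos
  obtain ⟨Q, CQ, hQp, hQ⟩ := exists_reference h.eta_pos
  obtain ⟨C, hC⟩ := h.exists_chain 1 one_pos
  obtain ⟨t, ht0, ht1, htC, htA⟩ := exists_pos_mul_le C 1 (δ / 2) (δ / 4) (by positivity)
    (by positivity)
  rw [mul_one] at htA
  obtain ⟨x, hx, hxt⟩ := exists_pos_pw_le h.eta_pos ht0
  obtain ⟨c, hc⟩ := hC x hx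
  have := isProbabilityMeasure_unifNoise hx
  have hVm := measurable_bwd (lam := lam) 1 0
  have hbase : ∃ C1 : ℝ≥0, Achievable η (𝒲.map (bwdBlock lam 1)) t C1 := by
    set ℓ := max 0 (Real.log x⁻¹) with hℓ
    refine ⟨(ENNReal.ofReal ℓ + CQ + C2 * (K + pw η x)).toNNReal, ?_⟩
    rw [ENNReal.coe_toNNReal (by finiteness [pw_ne_top (η := η) x])]
    refine achievable_of_kernel 𝒲 (addNoise _ hVm (unifNoise x)) Q (bwdBlock lam 1) (by fun_prop)
      (fun a _ => a) (by fun_prop) ?_ ?_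
    · calc _ ≤ ∫⁻ w, ∫⁻ _a, (t : ℝ≥0∞) ∂addNoise _ hVm (unifNoise x) w ∂𝒲 := by
            refine lintegral_mono fun w => lintegral_mono_ae
              ((ae_addNoise_unifNoise _ hVm x w).mono fun a ha => ?_)
            simp only [totalDist, Finset.univ_unique, Finset.sum_singleton]
            refine le_trans (pw_mono h.eta_pos ?_) hxt
            rw [abs_sub_comm]
            exact ha
        _ = t := by simp
    · refine (lintegral_klDiv_addNoise_le _ hVm _ hQ 𝒲 (le_max_left _ _)
        (exp_max_log_inv hx _ (unifNoise_le x))).trans ?_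
      gcongr
      refine (lintegral_pw_add_unifNoise_le _ h.eta_pos hVm hC2 𝒲 hx).trans ?_
      gcongr
      exact h.moment_bwd (by omega)
  obtain ⟨C1, hC1⟩ := hbase
  refine ⟨C1 + c, fun n => ?_⟩
  have := hc 1 _ _ hC1 n 0
  rw [mul_one, add_zero] at this
  refine this.mono ?_ (by push_cast; rfl)
  have e1 : (1 + 1) * t + C * t ≤ δ := by
    rw [← NNReal.coe_le_coe] at *
    push_cast at *
    linarith
  calc (n : ℝ≥0∞) * ((1 + (1 : ℝ≥0)) * t + C * pw η x) + ((0 : ℕ) : ℝ≥0∞) * K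
      ≤ n * ((1 + (1 : ℝ≥0)) * t + C * t) + 0 := by
        gcongr
        simp
    _ ≤ n * δ := by
        rw [add_zero]
        gcongr
        exact_mod_cast e1

/-- The rates are continuous in the distortion, uniformly in the length of the block. -/
theorem exists_lower_distortion {d₀ e : ℝ≥0} (hd₀ : 0 < d₀) (he : 0 < e) : ∃ δ : ℝ≥0, 0 < δ ∧
    ∀ (n : ℕ) (d : ℝ≥0) (I : ℝ≥0∞), d₀ ≤ d →
      Achievable η (𝒲.map (bwdBlock lam n)) (n * (d + δ)) I →
      Achievable η (𝒲.map (bwdBlock lam n)) (n * d) (I + n * e) := by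
  have := h.prob
  obtain ⟨C, hC⟩ := h.exists_achievable (half_pos hd₀)
  obtain ⟨t, ht0, ht1, htC, -⟩ := exists_pos_mul_le C 0 e 1 he one_pos
  refine ⟨t * (d₀ / 2), by positivity, fun n d I hd hA => ?_⟩
  have := isProbabilityMeasure_bwdBlock (lam := lam) (𝒲 := 𝒲) n
  have hpq : ((1 - t : ℝ≥0) : ℝ≥0∞) + (t : ℝ≥0∞) = 1 := by
    rw [← ENNReal.coe_add, tsub_add_cancel_of_le ht1, ENNReal.coe_one]
  refine (hA.mix (hC n) hpq).mono ?_ ?_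
  · have e1 : (1 - t) * (n * (d + t * (d₀ / 2))) + t * (n * (d₀ / 2)) ≤ n * d := by
      rw [← NNReal.coe_le_coe] at *
      push_cast [NNReal.coe_sub ht1]
      have : (0 : ℝ) ≤ n * t * (d - d₀ + t * (d₀ / 2)) := by
        have : (0 : ℝ) ≤ d - d₀ := by linarith
        positivity
      nlinarith
    exact_mod_cast e1
  · have e2 : (1 - t : ℝ≥0) ≤ 1 := tsub_le_self
    calc ((1 - t : ℝ≥0) : ℝ≥0∞) * I + t * (n * C) = (1 - t : ℝ≥0) * I + n * (t * C) := by ring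
      _ ≤ 1 * I + n * e := by
          gcongr
          · exact_mod_cast e2
          · exact_mod_cast htC
      _ = _ := by rw [one_mul]

/-- A description of a sufficiently long block gives descriptions of all longer blocks of
essentially the same distortion and rate. -/
theorem exists_eventually_of_block (d : ℝ≥0) {δ e : ℝ≥0} (hδ : 0 < δ) (he : 0 < e) :
    ∃ m₀ : ℕ, ∀ m ≥ m₀, ∀ I : ℝ≥0∞,
      Achievable η (𝒲.map (bwdBlock lam m)) (m * d) (m * I) →
      ∀ᶠ n : ℕ in atTop, Achievable η (𝒲.map (bwdBlock lam n)) (n * (d + δ)) (n * (I + e)) := by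
  have hδ3 : 0 < δ / 3 := by positivity
  obtain ⟨ε, hε0, -, hε, -⟩ := exists_pos_mul_le d 0 (δ / 3) 1 hδ3 one_pos
  obtain ⟨C, hC⟩ := h.exists_chain ε hε0
  obtain ⟨c, hc⟩ := hC 1 one_pos
  obtain ⟨m₀, hm₀⟩ := eventually_atTop.1 ((eventually_const_le_mul C hδ3).and
    ((eventually_const_le_mul c he).and (eventually_gt_atTop 0)))
  refine ⟨m₀, fun m hm I hA => ?_⟩
  obtain ⟨hm1, hm2, hm3⟩ := hm₀ m hm
  -- `n / m` copies of the block, and fewer than `m` times that are not described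
  filter_upwards [eventually_const_le_mul (m * K) hδ3] with n hn
  have e1 : n / m * m + n % m = n := Nat.div_add_mod' n m
  have hpw : pw η 1 = 1 := by simp [pw]
  have h1 := hc m _ _ hA (n / m) (n % m)
  rw [e1, hpw, mul_one] at h1
  have e2 : ((n / m : ℕ) : ℝ≥0) * m ≤ n := by exact_mod_cast Nat.div_mul_le_self n m
  have e3 : ((n % m : ℕ) : ℝ≥0) ≤ m := by exact_mod_cast (Nat.mod_lt n hm3).le
  generalize n / m = q at *
  generalize n % m = r at *
  refine h1.mono ?_ ?_
  · have e4 : (q : ℝ≥0) * ((1 + ε) * (m * d) + C) + r * K ≤ n * (d + δ) := by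
      calc (q : ℝ≥0) * ((1 + ε) * (m * d) + C) + r * K
          ≤ q * (m * d + m * (ε * d) + C) + m * K := by
            gcongr
            apply le_of_eq
            ring
        _ ≤ q * (m * d + m * (δ / 3) + m * (δ / 3)) + n * (δ / 3) := by gcongr
        _ = (q * m) * (d + δ / 3 + δ / 3) + n * (δ / 3) := by ring
        _ ≤ n * (d + δ / 3 + δ / 3) + n * (δ / 3) := by gcongr
        _ = n * (d + (δ / 3 + δ / 3 + δ / 3)) := by ring
        _ = n * (d + δ) := by rw [add_thirds]
    exact_mod_cast e4
  · have e5 : (c : ℝ≥0∞) ≤ m * e := by exact_mod_cast hm2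
    have e6 : (q : ℝ≥0∞) * m ≤ n := by exact_mod_cast e2
    calc (q : ℝ≥0∞) * (m * I + c) ≤ q * (m * I + m * e) := by gcongr
      _ = (q * m) * (I + e) := by ring
      _ ≤ _ := by gcongr

/-- The distortion lost in `exists_eventually_of_block` is regained at the expense of the rate. -/
theorem exists_eventually_achievable {d e : ℝ≥0} (hd : 0 < d) (he : 0 < e) :
    ∃ m₀ : ℕ, ∀ m ≥ m₀, ∀ I : ℝ≥0∞,
      Achievable η (𝒲.map (bwdBlock lam m)) (m * d) (m * I) →
      ∀ᶠ n : ℕ in atTop, Achievable η (𝒲.map (bwdBlock lam n)) (n * d) (n * (I + e)) := by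
  obtain ⟨δ, hδ, hlow⟩ := h.exists_lower_distortion hd (half_pos he)
  obtain ⟨m₀, hm₀⟩ := h.exists_eventually_of_block d hδ (half_pos he)
  refine ⟨m₀, fun m hm I hA => ?_⟩
  filter_upwards [hm₀ m hm I hA] with n hn
  refine (hlow n d _ le_rfl hn).mono le_rfl (le_of_eq ?_)
  rw [← mul_add, add_assoc, ← ENNReal.coe_add, add_halves]

end IsNoise

/-! ### Comparisons up to terms of lower order in the length of the block -/

/-- Up to a factor close to `1`, a law with a density is bounded from below by a law of bounded
density. -/
theorem exists_truncation (ν : Measure ℝ) [IsProbabilityMeasure ν] (hν : ν ≪ volume) {t : ℝ≥0}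
    (ht : 0 < t) : ∃ β : Measure ℝ, IsProbabilityMeasure β ∧ β ≤ ((1 + t : ℝ≥0) : ℝ≥0∞) • ν ∧
      ∃ ℓ : ℝ, 0 ≤ ℓ ∧ β ≤ ENNReal.ofReal (Real.exp ℓ) • volume := by
  set f := ν.rnDeriv volume with hf
  have hfm : Measurable f := Measure.measurable_rnDeriv _ _
  have hfν : volume.withDensity f = ν := Measure.withDensity_rnDeriv_eq _ _ hν
  set B : ℕ → Set ℝ := fun M => {x | f x ≤ M} with hB
  have hBm : ∀ M, MeasurableSet (B M) := fun M => measurableSet_le hfm measurable_const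
  have hlim : Tendsto (fun M => ν (B M)) atTop (𝓝 1) := by
    have hmono : Monotone B := fun M N hMN x (hx : f x ≤ M) =>
      hx.trans (by exact_mod_cast hMN : (M : ℝ≥0∞) ≤ N)
    have h1 := tendsto_measure_iUnion_atTop (μ := ν) hmono
    have h2 : ν (⋃ M, B M) = 1 := by
      rw [prob_compl_eq_zero_iff (MeasurableSet.iUnion hBm) |>.symm]
      have h3 : ∀ᵐ x ∂ν, f x < ∞ := hν.ae_le (Measure.rnDeriv_lt_top ν volume)
      refine measure_mono_null (fun x hx => ?_) h3
      intro hx'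
      obtain ⟨M, hM⟩ := ENNReal.exists_nat_gt (ne_of_lt hx')
      exact hx (Set.mem_iUnion.2 ⟨M, hM.le⟩)
    rwa [h2] at h1
  have hlt : (((1 + t : ℝ≥0) : ℝ≥0∞))⁻¹ < 1 := by
    rw [ENNReal.inv_lt_one]
    exact_mod_cast lt_add_of_pos_right 1 ht
  obtain ⟨M, hM⟩ := (hlim.eventually_const_lt hlt).exists
  set p := ν (B M) with hp
  have hp0 : p ≠ 0 := (zero_le.trans_lt hM).ne'
  have hpt : p ≠ ∞ := measure_ne_top _ _
  have hpinv : p⁻¹ ≤ ((1 + t : ℝ≥0) : ℝ≥0∞) := by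
    rw [ENNReal.inv_le_iff_inv_le]
    exact hM.le
  refine ⟨p⁻¹ • ν.restrict (B M), ⟨?_⟩, ?_, Real.log (max 1 (p⁻¹ * M).toReal), ?_, ?_⟩
  · rw [Measure.smul_apply, Measure.restrict_apply_univ, smul_eq_mul,
      ENNReal.inv_mul_cancel hp0 hpt]
  · intro s
    simp only [Measure.smul_apply, smul_eq_mul]
    exact mul_le_mul' hpinv (Measure.restrict_apply_le _ _)
  · exact Real.log_nonneg (le_max_left _ _)
  · rw [Real.exp_log (by positivity)]
    have h5 : p⁻¹ * M ≠ ∞ := ENNReal.mul_ne_top (ENNReal.inv_ne_top.2 hp0) (by simp)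
    have h4 : p⁻¹ * M ≤ ENNReal.ofReal (max 1 (p⁻¹ * M).toReal) := by
      rw [← ENNReal.ofReal_toReal h5]
      exact ENNReal.ofReal_le_ofReal (by
        rw [ENNReal.toReal_ofReal ENNReal.toReal_nonneg]; exact le_max_right _ _)
    refine le_trans ?_ (b := (p⁻¹ * M) • (volume : Measure ℝ)) ?_
    · rw [mul_smul]
      refine fun s => ?_
      simp only [Measure.smul_apply, smul_eq_mul]
      gcongr
      conv_lhs => rw [← hfν, restrict_withDensity (hBm M)]
      calc (volume.restrict (B M)).withDensity f s
          ≤ (volume.restrict (B M)).withDensity (fun _ => (M : ℝ≥0∞)) s := by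
            refine withDensity_mono ?_ s
            filter_upwards [ae_restrict_mem (hBm M)] with x hx
            exact hx
        _ = M * volume.restrict (B M) s := by
            rw [withDensity_const, Measure.smul_apply, smul_eq_mul]
        _ ≤ _ := by
            gcongr
            exact Measure.restrict_le_self
    · intro s
      simp only [Measure.smul_apply, smul_eq_mul]
      gcongr

namespace IsNoise

variable {lam η : ℝ} {K : ℝ≥0} {ν : Measure ℝ} {𝒲 : Measure (ℕ → ℝ)} (h : IsNoise lam η K ν 𝒲)
include h

/-- For long blocks the side information saves at most a small rate. -/
theorem eventually_of_achievableGiven (hν : ν ≪ volume) {d e : ℝ≥0} (hd : 0 < d) (he : 0 < e) :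
    ∀ᶠ n : ℕ in atTop, ∀ I : ℝ≥0∞,
      AchievableGiven η (𝒲.map (bwdPair lam n)) (n * d) (n * I) →
      Achievable η (𝒲.map (bwdBlock lam n)) (n * d) (n * (I + e)) := by
  have := h.prob_marginal
  obtain ⟨δ, hδ, hlow⟩ := h.exists_lower_distortion hd (half_pos he)
  obtain ⟨Cd, hCd⟩ := h.exists_achievable hd
  obtain ⟨t, ht, -, htd, htC⟩ := exists_pos_mul_le d Cd (δ / 2) (e / 4) (by positivity)
    (by positivity)
  obtain ⟨β, hβp, hβ, ℓ, hℓ, hβℓ⟩ := exists_truncation ν hν ht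
  obtain ⟨C, hC⟩ := h.exists_of_achievableGiven hβ hℓ hβℓ
  filter_upwards [eventually_const_le_mul C (half_pos hδ),
    eventually_const_le_mul C (by positivity : 0 < e / 4), eventually_gt_atTop 0]
    with n hn1 hn2 hn3 I hA
  rcases le_total (Cd : ℝ≥0∞) I with hI | hI
  · exact (hCd n).mono le_rfl (by gcongr; exact hI.trans le_self_add)
  lift I to ℝ≥0 using ne_top_of_le_ne_top ENNReal.coe_ne_top hI
  obtain ⟨k, rfl⟩ : ∃ k, n = k + 1 := ⟨n - 1, by omega⟩
  have hI' : I ≤ Cd := by exact_mod_cast hI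
  generalize hN : ((k + 1 : ℕ) : ℝ≥0∞) = N at *
  have e0 : N = (((k + 1 : ℕ) : ℝ≥0) : ℝ≥0∞) := by rw [← hN]; rfl
  generalize ((k + 1 : ℕ) : ℝ≥0) = m at *
  subst e0
  have h1 := hC k _ _ hA
  have h2 : Achievable η (𝒲.map (bwdBlock lam (k + 1))) (m * (d + δ)) (m * (I + e / 2 : ℝ≥0)) := by
    refine h1.mono ?_ ?_
    · have : (1 + t) * (m * d) + C ≤ m * (d + δ) := by
        calc (1 + t) * (m * d) + C = m * d + m * (t * d) + C := by ring
          _ ≤ m * d + m * (δ / 2) + m * (δ / 2) := by gcongr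
          _ = m * (d + (δ / 2 + δ / 2)) := by ring
          _ = _ := by rw [add_halves]
      exact_mod_cast this
    · have : (1 + t) * (m * I) + C ≤ m * (I + e / 2) := by
        calc (1 + t) * (m * I) + C = m * I + m * (t * I) + C := by ring
          _ ≤ m * I + m * (e / 4) + m * (e / 4) := by
            gcongr
            exact le_trans (by gcongr) htC
          _ = m * (I + e / 2) := by ring
      exact_mod_cast this
  have h3 := hlow (k + 1) d _ le_rfl (hN ▸ h2)
  rw [hN] at h3
  refine h3.mono le_rfl (le_of_eq ?_)
  rw [← ENNReal.coe_add, ← ENNReal.coe_mul, ← ENNReal.coe_mul, ← ENNReal.coe_mul,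
    ← ENNReal.coe_add, ← mul_add, add_assoc, add_halves]

/-- At a fixed distortion, a rate for long backwards blocks, increased by a little more than
`log |lam|`, suffices for the forward blocks. -/
theorem eventually_fwd_of_bwd (U : Measure ℝ) [IsProbabilityMeasure U] {M : ℝ≥0}
    (hM : ∫⁻ x, pw η x ∂U ≤ M) {d e : ℝ≥0} (hd : 0 < d) (he : 0 < e) :
    ∀ᶠ n : ℕ in atTop, ∀ I : ℝ≥0∞,
      Achievable η (𝒲.map (bwdBlock lam n)) (n * d) (n * I) →
      Achievable η ((U.prod 𝒲).map (fwdBlock lam n)) (n * d)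
        (n * (I + e) + ENNReal.ofReal (n * Real.log |lam|)) := by
  obtain ⟨δ₀, hδ₀, hlow⟩ := h.exists_lower_distortion (half_pos hd) (half_pos he)
  set δ := min δ₀ (d / 2) with hδ
  have hδ0 : 0 < δ := lt_min hδ₀ (half_pos hd)
  have hδd : δ ≤ d / 2 := min_le_right _ _
  obtain ⟨d', hd'⟩ : ∃ d', d = d' + δ := ⟨d - δ,
    (tsub_add_cancel_of_le (hδd.trans (half_le_self zero_le))).symm⟩
  have hdd' : d / 2 ≤ d' := by
    rw [← NNReal.coe_le_coe] at *
    have := congrArg NNReal.toReal hd'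
    push_cast at *
    linarith
  obtain ⟨ε, hε, -, hεd, -⟩ := exists_pos_mul_le d' 0 (δ / 2) 1 (by positivity) one_pos
  obtain ⟨C, hC⟩ := h.exists_fwd_of_bwd U hM ε hε
  filter_upwards [eventually_const_le_mul C (half_pos hδ0), eventually_const_le_mul C (half_pos he)]
    with n hn1 hn2 I hA
  have h1 := hlow n d' (n * I) hdd' (hA.mono (by
    rw [hd']
    push_cast
    gcongr
    exact min_le_left _ _) le_rfl)
  refine (hC n _ _ h1).mono ?_ ?_
  · have : (1 + ε) * (n * d') + C ≤ n * d := by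
      calc (1 + ε) * (n * d') + C = n * d' + n * (ε * d') + C := by ring
        _ ≤ n * d' + n * (δ / 2) + n * (δ / 2) := by gcongr
        _ = n * (d' + (δ / 2 + δ / 2)) := by ring
        _ = _ := by rw [add_halves, hd']
    exact_mod_cast this
  · have h2 : (C : ℝ≥0∞) ≤ n * (e / 2 : ℝ≥0) := by exact_mod_cast hn2
    have h3 : (e : ℝ≥0∞) = (e / 2 : ℝ≥0) + (e / 2 : ℝ≥0) := by
      rw [← ENNReal.coe_add, add_halves]
    calc _ ≤ n * I + n * (e / 2 : ℝ≥0) + ENNReal.ofReal (n * Real.log |lam|) +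
          n * (e / 2 : ℝ≥0) := by gcongr
      _ = _ := by
        rw [h3]
        ring

/-- A description of a long forward block yields one of the backwards block, whose information is
smaller by `n * log |lam|` up to lower order, as long as the distortion is bounded. -/
theorem eventually_bwd_of_fwd (U : Measure ℝ) [IsProbabilityMeasure U] {M : ℝ≥0}
    (hM : ∫⁻ x, pw η x ∂U ≤ M) {ℓU : ℝ} (hℓU : 0 ≤ ℓU)
    (hU : U ≤ ENNReal.ofReal (Real.exp ℓU) • volume) (d : ℝ≥0) {e : ℝ≥0} (he : 0 < e) :
    ∀ᶠ n : ℕ in atTop, ∀ (x I : ℝ≥0∞), x ≤ d →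
      Achievable η ((U.prod 𝒲).map (fwdBlock lam n)) (n * x) I →
      ∃ I', Achievable η (𝒲.map (bwdBlock lam n)) (n * x) I' ∧
        I' + ENNReal.ofReal (n * Real.log |lam|) ≤ I + n * e := by
  obtain ⟨C, hC⟩ := h.exists_bwd_of_fwd U hM hℓU hU
  filter_upwards [eventually_add_log_le_mul (C + C * d) η he, eventually_gt_atTop 0]
    with n hn1 hn2 x I hx hA
  obtain ⟨I', h1, h2⟩ := hC n _ _ hn2 hA
  refine ⟨I', h1, h2.trans ?_⟩
  gcongr
  refine le_trans ?_ hn1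
  have hn' : (n : ℝ≥0∞) ≠ 0 := by exact_mod_cast hn2.ne'
  have h5 : (n : ℝ≥0∞) * x / n = x := by
    rw [mul_comm, ENNReal.mul_div_cancel_right hn' (by simp)]
  rw [h5, add_right_comm]
  push_cast
  gcongr

/-- The counterpart of `eventually_fwd_of_bwd` at a fixed rate: the excess is put on the distortion,
by time sharing with the output `0`. -/
theorem eventually_fwd_of_bwd_of_rate (U : Measure ℝ) [IsProbabilityMeasure U] {M : ℝ≥0}
    (hM : ∫⁻ x, pw η x ∂U ≤ M) {r e : ℝ≥0} (hr : 0 < r) (he : 0 < e) :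
    ∀ᶠ n : ℕ in atTop, ∀ x : ℝ≥0∞,
      Achievable η (𝒲.map (bwdBlock lam n)) (n * x) (n * r) →
      Achievable η ((U.prod 𝒲).map (fwdBlock lam n)) (n * (x + e))
        (n * r + ENNReal.ofReal (n * Real.log |lam|)) := by
  have := h.prob
  have he4 : 0 < e / 4 := by positivity
  obtain ⟨t, ht, ht1, htK, -⟩ := exists_pos_mul_le K 0 (e / 4) 1 he4 one_pos
  obtain ⟨ε, hε, -, hεK, -⟩ := exists_pos_mul_le (K + e / 4) 0 (e / 4) 1 he4 one_pos
  obtain ⟨C, hC⟩ := h.exists_fwd_of_bwd U hM ε hε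
  filter_upwards [eventually_const_le_mul C (half_pos he),
    eventually_const_le_mul C (mul_pos ht hr)] with n hn1 hn2 x hA
  have := isProbabilityMeasure_bwdBlock (lam := lam) (𝒲 := 𝒲) n
  -- a distortion above `K` is achieved without any information
  obtain ⟨z, hzK, hzx, hz⟩ : ∃ z : ℝ≥0, z ≤ K ∧ (z : ℝ≥0∞) ≤ x ∧
      Achievable η (𝒲.map (bwdBlock lam n)) (n * z) (n * r) := by
    rcases le_total (K : ℝ≥0∞) x with hK | hK
    · exact ⟨K, le_rfl, hK, (h.achievable_zero n).mono le_rfl zero_le⟩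
    · lift x to ℝ≥0 using ne_top_of_le_ne_top ENNReal.coe_ne_top hK
      exact ⟨x, by exact_mod_cast hK, le_rfl, hA⟩
  have hpq : ((1 - t : ℝ≥0) : ℝ≥0∞) + (t : ℝ≥0∞) = 1 := by
    rw [← ENNReal.coe_add, tsub_add_cancel_of_le ht1, ENNReal.coe_one]
  have h1 := hC n _ _ (hz.mix (h.achievable_zero n) hpq)
  refine h1.mono ?_ ?_
  · have e1 : (1 + ε) * ((1 - t) * (n * z) + t * (n * K)) + C ≤ n * (z + e) := by
      have e2 : (1 - t) ≤ 1 := tsub_le_self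
      calc (1 + ε) * ((1 - t) * (n * z) + t * (n * K)) + C
          ≤ (1 + ε) * (1 * (n * z) + t * (n * K)) + C := by gcongr
        _ = n * ((z + t * K) + ε * (z + t * K)) + C := by ring
        _ ≤ n * ((z + e / 4) + ε * (K + e / 4)) + n * (e / 2) := by gcongr
        _ ≤ n * ((z + e / 4) + e / 4) + n * (e / 2) := by gcongr
        _ = n * (z + e) := by ring
    calc _ ≤ (n : ℝ≥0∞) * (z + e) := by exact_mod_cast e1
      _ ≤ _ := by gcongr
  · rw [mul_zero, add_zero, add_right_comm]
    gcongr
    have e3 : (1 - t) * (n * r) + C ≤ n * r := by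
      calc (1 - t) * (n * r) + C ≤ (1 - t) * (n * r) + n * (t * r) := by gcongr
        _ = ((1 - t) + t) * (n * r) := by ring
        _ = n * r := by rw [tsub_add_cancel_of_le ht1, one_mul]
    exact_mod_cast e3

/-- The counterpart of `eventually_bwd_of_fwd` at a fixed rate. -/
theorem eventually_bwd_of_fwd_of_rate (U : Measure ℝ) [IsProbabilityMeasure U] {M : ℝ≥0}
    (hM : ∫⁻ x, pw η x ∂U ≤ M) {ℓU : ℝ} (hℓU : 0 ≤ ℓU)
    (hU : U ≤ ENNReal.ofReal (Real.exp ℓU) • volume) {r e : ℝ≥0} (hr : 0 < r) (he : 0 < e) :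
    ∀ᶠ n : ℕ in atTop, ∀ x : ℝ≥0∞,
      Achievable η ((U.prod 𝒲).map (fwdBlock lam n)) (n * x)
        (n * r + ENNReal.ofReal (n * Real.log |lam|)) →
      Achievable η (𝒲.map (bwdBlock lam n)) (n * (x + e)) (n * r) := by
  have := h.prob
  obtain ⟨t, ht, ht1, htK, -⟩ := exists_pos_mul_le K 0 e 1 he one_pos
  filter_upwards [h.eventually_bwd_of_fwd U hM hℓU hU K (mul_pos ht hr)] with n hn x hA
  have := isProbabilityMeasure_bwdBlock (lam := lam) (𝒲 := 𝒲) n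
  rcases le_total (K : ℝ≥0∞) x with hK | hK
  · exact (h.achievable_zero n).mono (by gcongr; exact hK.trans le_self_add) zero_le
  obtain ⟨I', h1, h2⟩ := hn x _ hK hA
  rw [add_right_comm, ENNReal.add_le_add_iff_right ENNReal.ofReal_ne_top] at h2
  have hpq : ((1 - t : ℝ≥0) : ℝ≥0∞) + (t : ℝ≥0∞) = 1 := by
    rw [← ENNReal.coe_add, tsub_add_cancel_of_le ht1, ENNReal.coe_one]
  refine (h1.mix (h.achievable_zero n) hpq).mono ?_ ?_
  · have e2 : ((1 - t : ℝ≥0) : ℝ≥0∞) ≤ 1 := by exact_mod_cast tsub_le_self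
    have e3 : (t * K : ℝ≥0∞) ≤ e := by exact_mod_cast htK
    calc _ ≤ 1 * (n * x) + n * (t * K) := by
          rw [mul_left_comm (t : ℝ≥0∞)]
          gcongr
      _ ≤ 1 * (n * x) + n * e := by gcongr
      _ = _ := by rw [one_mul, mul_add]
  · rw [mul_zero, add_zero]
    have e4 : (1 - t) * (n * r + n * (t * r)) ≤ n * r := by
      rw [← NNReal.coe_le_coe]
      push_cast [NNReal.coe_sub ht1]
      have : (0 : ℝ) ≤ n * r * (t * t) := by positivity
      nlinarith
    calc _ ≤ ((1 - t : ℝ≥0) : ℝ≥0∞) * (n * r + n * (t * r)) := by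
          gcongr
          exact_mod_cast h2
      _ ≤ _ := by exact_mod_cast e4

/-- At a rate below `log |lam|` no finite distortion is achieved for long blocks. -/
theorem eventually_not_achievable_fwd (U : Measure ℝ) [IsProbabilityMeasure U] {M : ℝ≥0}
    (hM : ∫⁻ x, pw η x ∂U ≤ M) {ℓU : ℝ} (hℓU : 0 ≤ ℓU)
    (hU : U ≤ ENNReal.ofReal (Real.exp ℓU) • volume) {r : ℝ≥0} (hr : (r : ℝ) < Real.log |lam|)
    (d : ℝ≥0) : ∀ᶠ n : ℕ in atTop,
      ¬ Achievable η ((U.prod 𝒲).map (fwdBlock lam n)) (n * d) (n * r) := by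
  obtain ⟨e, he, hre⟩ : ∃ e : ℝ≥0, 0 < e ∧ (r : ℝ) + e < Real.log |lam| := by
    refine ⟨Real.toNNReal ((Real.log |lam| - r) / 2), Real.toNNReal_pos.2 (by linarith), ?_⟩
    rw [Real.coe_toNNReal _ (by linarith)]
    linarith
  filter_upwards [h.eventually_bwd_of_fwd U hM hℓU hU d he, eventually_gt_atTop 0]
    with n hn hn0 hA
  obtain ⟨I', -, h2⟩ := hn d _ le_rfl hA
  have h3 := le_add_self.trans h2
  have h4 : (n * r + n * e : ℝ≥0∞) = ENNReal.ofReal (n * (r + e)) := by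
    have : (n * (r + e) : ℝ) = ((n * r + n * e : ℝ≥0) : ℝ) := by push_cast; ring
    rw [this, ENNReal.ofReal_coe_nnreal]
    push_cast
    rfl
  have hn0' : (0 : ℝ) < n := by exact_mod_cast hn0
  rw [h4, ENNReal.ofReal_le_ofReal_iff (by positivity)] at h3
  exact absurd (le_of_mul_le_mul_left h3 hn0') (not_le.2 hre)

end IsNoise

/-! ### Passage to infinite blocks -/

section Squeeze

variable {u v : ℕ → ℝ≥0∞} {a : ℝ≥0∞}

theorem tendsto_of_le_add (hu : Tendsto u atTop (𝓝 a))
    (huv : ∀ e : ℝ≥0, 0 < e → ∀ᶠ n in atTop, u n ≤ v n + e)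
    (hvu : ∀ e : ℝ≥0, 0 < e → ∀ᶠ n in atTop, v n ≤ u n + e) : Tendsto v atTop (𝓝 a) := by
  refine tendsto_order.2 ⟨fun y hy => ?_, fun y hy => ?_⟩
  · obtain ⟨r, hr, hyr⟩ := ENNReal.lt_iff_exists_add_pos_lt.1 hy
    filter_upwards [huv r hr, hu.eventually_const_lt hyr] with n h1 h2
    exact lt_of_add_lt_add_right (h2.trans_le h1)
  · obtain ⟨r, hr, hyr⟩ := ENNReal.lt_iff_exists_add_pos_lt.1 hy
    filter_upwards [hvu r hr, (hu.add_const (r : ℝ≥0∞)).eventually_lt_const hyr] with n h1 h2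
    exact h1.trans_lt h2

theorem liminf_le_liminf_of_le_add
    (huv : ∀ e : ℝ≥0, 0 < e → ∀ᶠ n in atTop, u n ≤ v n + e) :
    liminf u atTop ≤ liminf v atTop := by
  refine le_of_forall_lt fun y hy => ?_
  obtain ⟨z, hyz, hz⟩ := exists_between hy
  obtain ⟨r, hr, hyr⟩ := ENNReal.lt_iff_exists_add_pos_lt.1 hz
  refine hyz.trans_le (le_liminf_of_le (by isBoundedDefault) ?_)
  filter_upwards [huv r hr, eventually_lt_of_lt_liminf hyr] with n h1 h2
  exact (lt_of_add_lt_add_right (h2.trans_le h1)).le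

theorem le_add_of_forall_lt {x y e : ℝ≥0∞} (h : ∀ z, y < z → x ≤ z + e) : x ≤ y + e := by
  rw [← tsub_le_iff_right]
  exact le_of_forall_gt_imp_ge_of_dense fun z hz => tsub_le_iff_right.2 (h z hz)

theorem mul_log_two_div {n : ℕ} (hn : n ≠ 0) (z : ℝ≥0∞) :
    n * (z * ENNReal.ofReal (Real.log 2)) / ENNReal.ofReal (Real.log 2) / n = z := by
  have hn' : (n : ℝ≥0∞) ≠ 0 := by exact_mod_cast hn
  rw [← mul_assoc, ENNReal.mul_div_cancel_right ofReal_log_two_pos ENNReal.ofReal_ne_top, mul_comm,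
    ENNReal.mul_div_cancel_right hn' (by simp)]

/-- A rate of `e` bits, in nats. -/
theorem exists_bits {e : ℝ≥0} (he : 0 < e) :
    ∃ e' : ℝ≥0, 0 < e' ∧ (e' : ℝ≥0∞) = e * ENNReal.ofReal (Real.log 2) :=
  ⟨e * Real.toNNReal (Real.log 2), mul_pos he (Real.toNNReal_pos.2 (Real.log_pos one_lt_two)),
    by push_cast; rfl⟩

theorem condRateDistortion_congr {n : ℕ} {η : ℝ} {ρ ρ' : Measure (ℝ × (Fin n → ℝ))}
    [IsFiniteMeasure ρ] [IsFiniteMeasure ρ'] (h : ρ = ρ') (d : ℝ) :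
    condRateDistortion η ρ d = condRateDistortion η ρ' d := by
  subst h
  rfl

end Squeeze

namespace IsNoise

variable {lam η : ℝ} {K : ℝ≥0} {ν : Measure ℝ} {𝒲 : Measure (ℕ → ℝ)} (h : IsNoise lam η K ν 𝒲)
include h

theorem isProbabilityMeasure_bwdPair (n : ℕ) :
    IsProbabilityMeasure (𝒲.map (bwdPair lam n)) := by
  have := h.prob
  exact Measure.isProbabilityMeasure_map (by fun_prop)

theorem ofReal_mul_log (n : ℕ) : ENNReal.ofReal (n * Real.log |lam|) =
    n * (ENNReal.ofReal (Real.logb 2 |lam|) * ENNReal.ofReal (Real.log 2)) := by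
  have h1 := Real.log_pos one_lt_two
  have h2 : 0 ≤ Real.logb 2 |lam| := Real.logb_nonneg one_lt_two h.one_lt.le
  rw [← ENNReal.ofReal_mul h2, Real.logb, div_mul_cancel₀ _ h1.ne',
    ENNReal.ofReal_mul (by positivity), ENNReal.ofReal_natCast]

/-- The limit of the rates of the backwards blocks exists. -/
theorem tendsto_rateDistortion {d : ℝ} (hd : 0 < d) :
    Tendsto (fun n => rateDistortion η (𝒲.map (bwdBlock lam n)) d) atTop
      (𝓝 (liminf (fun n => rateDistortion η (𝒲.map (bwdBlock lam n)) d) atTop)) := by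
  have := h.prob
  have hp := fun n => isProbabilityMeasure_bwdBlock (lam := lam) (𝒲 := 𝒲) n
  lift d to ℝ≥0 using hd.le
  refine tendsto_order.2 ⟨fun y hy => eventually_lt_of_lt_liminf hy, fun y hy => ?_⟩
  obtain ⟨r, hr, hyr⟩ := ENNReal.lt_iff_exists_add_pos_lt.1 hy
  obtain ⟨e, he, hee⟩ := exists_bits (half_pos hr)
  obtain ⟨m₀, hm₀⟩ := h.exists_eventually_achievable (by exact_mod_cast hd : 0 < d) he
  set l := liminf (fun n => rateDistortion η (𝒲.map (bwdBlock lam n)) d) atTop with hl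
  have hlt : l < l + (r / 2 : ℝ≥0) :=
    ENNReal.lt_add_right hy.ne_top (by exact_mod_cast (half_pos hr).ne')
  obtain ⟨m, hm, hm1⟩ := ((frequently_lt_of_liminf_lt (by isBoundedDefault) hlt).and_eventually
    (eventually_ge_atTop (max m₀ 1))).exists
  have hA := achievable_of_rateDistortion_lt (by have := le_max_right m₀ 1; omega) hm
  rw [ENNReal.ofReal_coe_nnreal] at hA
  filter_upwards [hm₀ m ((le_max_left _ _).trans hm1) _ hA, eventually_gt_atTop 0] with n hn hn0
  rw [hee, ← add_mul, add_assoc, ← ENNReal.coe_add, add_halves] at hn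
  refine lt_of_le_of_lt (rateDistortion_le (by rwa [ENNReal.ofReal_coe_nnreal])) ?_
  rwa [mul_log_two_div hn0.ne']

theorem eventually_rateDistortion_le [IsProbabilityMeasure 𝒲] (hν : ν ≪ volume) {d : ℝ}
    (hd : 0 < d) (e : ℝ≥0) (he : 0 < e) : ∀ᶠ n : ℕ in atTop,
    rateDistortion η (𝒲.map (bwdBlock lam n)) d ≤
      condRateDistortion η (𝒲.map (bwdPair lam n)) d + e := by
  have := h.prob
  have hp := fun n => isProbabilityMeasure_bwdBlock (lam := lam) (𝒲 := 𝒲) n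
  have hp' := h.isProbabilityMeasure_bwdPair
  lift d to ℝ≥0 using hd.le
  obtain ⟨e', he', hee⟩ := exists_bits he
  filter_upwards [h.eventually_of_achievableGiven hν (by exact_mod_cast hd : 0 < d) he',
    eventually_gt_atTop 0] with n hn hn0
  refine le_add_of_forall_lt fun z hz => ?_
  have hA := achievableGiven_of_condRateDistortion_lt _ hn0.ne' hz
  rw [ENNReal.ofReal_coe_nnreal] at hA
  have h1 := hn _ hA
  rw [hee, ← add_mul] at h1
  refine (rateDistortion_le (by rwa [ENNReal.ofReal_coe_nnreal])).trans_eq ?_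
  rw [mul_log_two_div hn0.ne']

/-- The initial value itself is the finest of the side information derived from it. -/
theorem condRateDistortion_bwdPair_le [IsProbabilityMeasure 𝒲] {g : ℝ → ℝ}
    (hg : Measurable g) {n : ℕ} (hn : n ≠ 0) (d : ℝ) :
    condRateDistortion η (𝒲.map (bwdPair lam n)) d ≤
      condRateDistortion η (𝒲.map fun w => (g (bwd lam w n 0), bwdBlock lam n w)) d := by
  have := h.prob
  have hp' := h.isProbabilityMeasure_bwdPair n
  have hm : Measurable fun w => (g (bwd lam w n 0), bwdBlock lam n w) := by fun_prop
  have hp : IsProbabilityMeasure (𝒲.map fun w => (g (bwd lam w n 0), bwdBlock lam n w)) :=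
    Measure.isProbabilityMeasure_map hm.aemeasurable
  refine le_of_forall_gt_imp_ge_of_dense fun z hz => ?_
  have hA := achievableGiven_of_condRateDistortion_lt _ hn hz
  have e1 : (𝒲.map fun w => (g (bwd lam w n 0), bwdBlock lam n w)) =
      (𝒲.map (bwdPair lam n)).map fun p => (g p.1, p.2) := by
    rw [Measure.map_map (by fun_prop) (by fun_prop)]
    rfl
  rw [e1] at hA
  refine (condRateDistortion_le _ (hA.of_map hg)).trans_eq ?_
  rw [mul_log_two_div hn]

theorem condRateDistortion_le_rateDistortion [IsProbabilityMeasure 𝒲] {g : ℝ → ℝ}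
    (hg : Measurable g) {n : ℕ} (hn : n ≠ 0) (d : ℝ) :
    condRateDistortion η (𝒲.map fun w => (g (bwd lam w n 0), bwdBlock lam n w)) d ≤
      rateDistortion η (𝒲.map (bwdBlock lam n)) d := by
  have := h.prob
  have hm : Measurable fun w => (g (bwd lam w n 0), bwdBlock lam n w) := by fun_prop
  have hp : IsProbabilityMeasure (𝒲.map fun w => (g (bwd lam w n 0), bwdBlock lam n w)) :=
    Measure.isProbabilityMeasure_map hm.aemeasurable
  have hp' := isProbabilityMeasure_bwdBlock (lam := lam) (𝒲 := 𝒲) n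
  have e1 : 𝒲.map (bwdBlock lam n) =
      (𝒲.map fun w => (g (bwd lam w n 0), bwdBlock lam n w)).snd := by
    rw [Measure.snd, Measure.map_map measurable_snd hm]
    rfl
  refine le_of_forall_gt_imp_ge_of_dense fun z hz => ?_
  have hA := achievable_of_rateDistortion_lt hn hz
  rw [e1] at hA
  refine (condRateDistortion_le _ hA.given).trans_eq ?_
  rw [mul_log_two_div hn]

theorem eventually_rateDistortion_fwd_le (U : Measure ℝ) [IsProbabilityMeasure U] {M : ℝ≥0}
    (hM : ∫⁻ x, pw η x ∂U ≤ M) {d : ℝ} (hd : 0 < d) (e : ℝ≥0) (he : 0 < e) :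
    ∀ᶠ n : ℕ in atTop, rateDistortion η ((U.prod 𝒲).map (fwdBlock lam n)) d ≤
      (rateDistortion η (𝒲.map (bwdBlock lam n)) d + ENNReal.ofReal (Real.logb 2 |lam|)) + e := by
  have := h.prob
  have hp := fun n => isProbabilityMeasure_bwdBlock (lam := lam) (𝒲 := 𝒲) n
  have hp' := fun n => isProbabilityMeasure_fwdBlock (lam := lam) (𝒲 := 𝒲) U n
  lift d to ℝ≥0 using hd.le
  obtain ⟨e', he', hee⟩ := exists_bits he
  filter_upwards [h.eventually_fwd_of_bwd U hM (by exact_mod_cast hd : 0 < d) he',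
    eventually_gt_atTop 0] with n hn hn0
  rw [add_assoc]
  refine le_add_of_forall_lt fun z hz => ?_
  have hA := achievable_of_rateDistortion_lt hn0.ne' hz
  rw [ENNReal.ofReal_coe_nnreal] at hA
  have h1 := hn _ hA
  rw [hee, h.ofReal_mul_log, ← mul_add, ← add_mul, ← add_mul] at h1
  refine (rateDistortion_le (by rwa [ENNReal.ofReal_coe_nnreal])).trans_eq ?_
  rw [mul_log_two_div hn0.ne']
  ring

theorem eventually_le_rateDistortion_fwd (U : Measure ℝ) [IsProbabilityMeasure U] {M : ℝ≥0}
    (hM : ∫⁻ x, pw η x ∂U ≤ M) {ℓU : ℝ} (hℓU : 0 ≤ ℓU)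
    (hU : U ≤ ENNReal.ofReal (Real.exp ℓU) • volume) {d : ℝ} (hd : 0 < d) (e : ℝ≥0) (he : 0 < e) :
    ∀ᶠ n : ℕ in atTop,
      rateDistortion η (𝒲.map (bwdBlock lam n)) d + ENNReal.ofReal (Real.logb 2 |lam|) ≤
        rateDistortion η ((U.prod 𝒲).map (fwdBlock lam n)) d + e := by
  have := h.prob
  have hp := fun n => isProbabilityMeasure_bwdBlock (lam := lam) (𝒲 := 𝒲) n
  have hp' := fun n => isProbabilityMeasure_fwdBlock (lam := lam) (𝒲 := 𝒲) U n
  lift d to ℝ≥0 using hd.le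
  obtain ⟨e', he', hee⟩ := exists_bits he
  filter_upwards [h.eventually_bwd_of_fwd U hM hℓU hU d he', eventually_gt_atTop 0] with n hn hn0
  refine le_add_of_forall_lt fun z hz => ?_
  have hA := achievable_of_rateDistortion_lt hn0.ne' hz
  rw [ENNReal.ofReal_coe_nnreal] at hA
  obtain ⟨I', h1, h2⟩ := hn _ _ le_rfl hA
  have h3 := rateDistortion_le (d := d) (by rwa [ENNReal.ofReal_coe_nnreal])
  rw [hee, h.ofReal_mul_log, ← mul_add, ← add_mul] at h2
  calc _ ≤ I' / ENNReal.ofReal (Real.log 2) / n + ENNReal.ofReal (Real.logb 2 |lam|) := by gcongr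
    _ = (I' + n * (ENNReal.ofReal (Real.logb 2 |lam|) * ENNReal.ofReal (Real.log 2))) /
          ENNReal.ofReal (Real.log 2) / n := by
        rw [ENNReal.add_div, ENNReal.add_div, mul_log_two_div hn0.ne']
    _ ≤ n * ((z + e) * ENNReal.ofReal (Real.log 2)) / ENNReal.ofReal (Real.log 2) / n := by gcongr
    _ = z + e := mul_log_two_div hn0.ne' _

/-- Without distortion the conditional rates are infinite. -/
theorem condRateDistortion_zero [IsProbabilityMeasure 𝒲] (hν : ν ≪ volume) (k : ℕ) :
    condRateDistortion η (𝒲.map (bwdPair lam (k + 2))) 0 = ∞ := by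
  have hp' := h.isProbabilityMeasure_bwdPair (k + 2)
  by_contra hcon
  obtain ⟨z, hz1, hz2⟩ := exists_between (lt_top_iff_ne_top.2 hcon)
  have hA := achievableGiven_of_condRateDistortion_lt _ (by omega) hz1
  rw [ENNReal.ofReal_zero, mul_zero] at hA
  exact h.not_achievableGiven_zero hν k (by finiteness) hA

theorem rateDistortion_fwd_zero (hν : ν ≪ volume) (U : Measure ℝ) [IsProbabilityMeasure U]
    {M : ℝ≥0} (hM : ∫⁻ x, pw η x ∂U ≤ M) {ℓU : ℝ} (hℓU : 0 ≤ ℓU)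
    (hU : U ≤ ENNReal.ofReal (Real.exp ℓU) • volume) (k : ℕ) :
    rateDistortion η ((U.prod 𝒲).map (fwdBlock lam (k + 2))) 0 = ∞ := by
  have := h.prob
  have hp := isProbabilityMeasure_bwdBlock (lam := lam) (𝒲 := 𝒲) (k + 2)
  have hp' := isProbabilityMeasure_fwdBlock (lam := lam) (𝒲 := 𝒲) U (k + 2)
  have hp'' := h.isProbabilityMeasure_bwdPair (k + 2)
  by_contra hcon
  obtain ⟨z, hz1, hz2⟩ := exists_between (lt_top_iff_ne_top.2 hcon)
  have hA := achievable_of_rateDistortion_lt (by omega) hz1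
  rw [ENNReal.ofReal_zero, mul_zero] at hA
  obtain ⟨C, hC⟩ := h.exists_bwd_of_fwd U hM hℓU hU
  obtain ⟨I', h1, h2⟩ := hC (k + 2) _ _ (by omega) hA
  have e1 : 𝒲.map (bwdBlock lam (k + 2)) = (𝒲.map (bwdPair lam (k + 2))).snd := by
    rw [Measure.snd, Measure.map_map measurable_snd (by fun_prop)]
    rfl
  rw [e1] at h1
  refine h.not_achievableGiven_zero hν k (ne_top_of_le_ne_top ?_ (le_self_add.trans h2)) h1.given
  rw [ENNReal.zero_div, mul_zero]
  finiteness

/-- The limits of all rates of the backwards process agree. -/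
theorem tendsto_rates [IsProbabilityMeasure 𝒲] (hν : ν ≪ volume) {d : ℝ} (hd : 0 ≤ d) :
    Tendsto (fun n => rateDistortion η (𝒲.map (bwdBlock lam n)) d) atTop
      (𝓝 (liminf (fun n => rateDistortion η (𝒲.map (bwdBlock lam n)) d) atTop)) ∧
    ∀ g : ℝ → ℝ, Measurable g → Tendsto (fun n => condRateDistortion η
      (𝒲.map fun w => (g (bwd lam w n 0), bwdBlock lam n w)) d) atTop
      (𝓝 (liminf (fun n => rateDistortion η (𝒲.map (bwdBlock lam n)) d) atTop)) := by
  rcases hd.eq_or_lt with rfl | hd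
  · have h1 : ∀ᶠ n in atTop, condRateDistortion η (𝒲.map (bwdPair lam n)) 0 = ∞ := by
      filter_upwards [eventually_ge_atTop 2] with n hn
      obtain ⟨k, rfl⟩ : ∃ k, n = k + 2 := ⟨n - 2, by omega⟩
      exact h.condRateDistortion_zero hν k
    have h2 : ∀ g : ℝ → ℝ, Measurable g → ∀ᶠ n in atTop, condRateDistortion η
        (𝒲.map fun w => (g (bwd lam w n 0), bwdBlock lam n w)) 0 = ∞ := by
      intro g hg
      filter_upwards [h1, eventually_gt_atTop 0] with n hn hn0
      exact top_le_iff.1 (hn ▸ h.condRateDistortion_bwdPair_le hg hn0.ne' 0)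
    have h3 : ∀ᶠ n in atTop, rateDistortion η (𝒲.map (bwdBlock lam n)) 0 = ∞ := by
      filter_upwards [h2 id measurable_id, eventually_gt_atTop 0] with n hn hn0
      exact top_le_iff.1 (hn ▸ h.condRateDistortion_le_rateDistortion measurable_id hn0.ne' 0)
    have h4 : Tendsto (fun n => rateDistortion η (𝒲.map (bwdBlock lam n)) 0) atTop (𝓝 ∞) :=
      tendsto_const_nhds.congr' (h3.mono fun n hn => hn.symm)
    rw [h4.liminf_eq]
    exact ⟨h4, fun g hg => tendsto_const_nhds.congr' ((h2 g hg).mono fun n hn => hn.symm)⟩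
  · have h1 := h.tendsto_rateDistortion hd
    refine ⟨h1, fun g hg => tendsto_of_le_add h1 (fun e he => ?_) fun e he => ?_⟩
    · filter_upwards [h.eventually_rateDistortion_le hν hd e he, eventually_gt_atTop 0]
        with n hn hn0
      refine hn.trans ?_
      gcongr
      exact h.condRateDistortion_bwdPair_le hg hn0.ne' d
    · filter_upwards [eventually_gt_atTop 0] with n hn0
      exact (h.condRateDistortion_le_rateDistortion hg hn0.ne' d).trans le_self_add

/-- The rates of the forward and of the backwards process differ by `log₂ |lam|` in the limit. -/
theorem liminf_rateDistortion_fwd (hν : ν ≪ volume) (U : Measure ℝ) [IsProbabilityMeasure U]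
    {M : ℝ≥0} (hM : ∫⁻ x, pw η x ∂U ≤ M) {ℓU : ℝ} (hℓU : 0 ≤ ℓU)
    (hU : U ≤ ENNReal.ofReal (Real.exp ℓU) • volume) {d : ℝ} (hd : 0 ≤ d) :
    liminf (fun n => rateDistortion η ((U.prod 𝒲).map (fwdBlock lam n)) d) atTop =
      liminf (fun n => rateDistortion η (𝒲.map (bwdBlock lam n)) d) atTop +
        ENNReal.ofReal (Real.logb 2 |lam|) := by
  have := h.prob
  rcases hd.eq_or_lt with rfl | hd
  · have h1 : Tendsto (fun n => rateDistortion η ((U.prod 𝒲).map (fwdBlock lam n)) 0) atTop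
        (𝓝 ∞) := by
      refine tendsto_const_nhds.congr' ?_
      filter_upwards [eventually_ge_atTop 2] with n hn
      obtain ⟨k, rfl⟩ : ∃ k, n = k + 2 := ⟨n - 2, by omega⟩
      exact (h.rateDistortion_fwd_zero hν U hM hℓU hU k).symm
    have h2 : Tendsto (fun n => rateDistortion η (𝒲.map (bwdBlock lam n)) 0) atTop (𝓝 ∞) := by
      refine tendsto_const_nhds.congr' ?_
      filter_upwards [eventually_ge_atTop 2] with n hn
      obtain ⟨k, rfl⟩ : ∃ k, n = k + 2 := ⟨n - 2, by omega⟩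
      refine (top_le_iff.1 ?_).symm
      rw [← h.condRateDistortion_zero hν k]
      exact h.condRateDistortion_le_rateDistortion measurable_id (by omega) 0
    rw [h1.liminf_eq, h2.liminf_eq, top_add]
  · exact (tendsto_of_le_add ((h.tendsto_rateDistortion hd).add_const _)
      (h.eventually_le_rateDistortion_fwd U hM hℓU hU hd)
      (h.eventually_rateDistortion_fwd_le U hM hd)).liminf_eq

/-- A rate of `R` bits above `log₂ |lam|`, for `n` times and in nats, is the sum of `n * log |lam|`
and of a positive rate for the backwards process. -/
theorem exists_nats {R : ℝ} (hR : Real.logb 2 |lam| < R) :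
    ∃ r : ℝ≥0, 0 < r ∧ ∀ n : ℕ,
      (n : ℝ≥0∞) * (ENNReal.ofReal (R - Real.logb 2 |lam|) * ENNReal.ofReal (Real.log 2)) =
        n * r ∧
      (n : ℝ≥0∞) * (ENNReal.ofReal R * ENNReal.ofReal (Real.log 2)) =
        n * r + ENNReal.ofReal (n * Real.log |lam|) := by
  have h0 : 0 < R - Real.logb 2 |lam| := by linarith
  have h2 : 0 ≤ Real.logb 2 |lam| := Real.logb_nonneg one_lt_two h.one_lt.le
  obtain ⟨r, hr, hre⟩ := exists_bits (Real.toNNReal_pos.2 h0)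
  refine ⟨r, hr, fun n => ⟨by rw [hre]; rfl, ?_⟩⟩
  rw [hre, h.ofReal_mul_log, ← mul_add, ← add_mul]
  congr 2
  change _ = ENNReal.ofReal _ + _
  rw [← ENNReal.ofReal_add h0.le h2, sub_add_cancel]

theorem liminf_distortionRate_fwd (U : Measure ℝ) [IsProbabilityMeasure U]
    {M : ℝ≥0} (hM : ∫⁻ x, pw η x ∂U ≤ M) {ℓU : ℝ} (hℓU : 0 ≤ ℓU)
    (hU : U ≤ ENNReal.ofReal (Real.exp ℓU) • volume) {R : ℝ} (hR : Real.logb 2 |lam| < R) :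
    liminf (fun n => distortionRate η ((U.prod 𝒲).map (fwdBlock lam n)) R) atTop =
      liminf (fun n => distortionRate η (𝒲.map (bwdBlock lam n)) (R - Real.logb 2 |lam|))
        atTop := by
  have := h.prob
  have hp := fun n => isProbabilityMeasure_bwdBlock (lam := lam) (𝒲 := 𝒲) n
  have hp' := fun n => isProbabilityMeasure_fwdBlock (lam := lam) (𝒲 := 𝒲) U n
  have hdiv : ∀ {n : ℕ}, 0 < n → ∀ z : ℝ≥0∞, n * z / n = z := fun {n} hn z => by
    rw [mul_comm, ENNReal.mul_div_cancel_right (by exact_mod_cast hn.ne') (by simp)]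
  obtain ⟨r, hr, hrn⟩ := h.exists_nats hR
  refine le_antisymm (liminf_le_liminf_of_le_add fun e he => ?_)
    (liminf_le_liminf_of_le_add fun e he => ?_)
  · filter_upwards [h.eventually_fwd_of_bwd_of_rate U hM hr he, eventually_gt_atTop 0]
      with n hn hn0
    refine le_add_of_forall_lt fun z hz => ?_
    have hA := achievable_of_distortionRate_lt hn0.ne' hz
    rw [(hrn n).1] at hA
    refine (distortionRate_le hn0.ne' ((hrn n).2 ▸ hn z hA)).trans_eq (hdiv hn0 _)
  · filter_upwards [h.eventually_bwd_of_fwd_of_rate U hM hℓU hU hr he, eventually_gt_atTop 0]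
      with n hn hn0
    refine le_add_of_forall_lt fun z hz => ?_
    have hA := achievable_of_distortionRate_lt hn0.ne' hz
    rw [(hrn n).2] at hA
    refine (distortionRate_le hn0.ne' ((hrn n).1 ▸ hn z hA)).trans_eq (hdiv hn0 _)

theorem distortionRate_bwd_le {n : ℕ} (hn : n ≠ 0) (R : ℝ) :
    distortionRate η (𝒲.map (bwdBlock lam n)) R ≤ K := by
  have := h.prob
  have hp := isProbabilityMeasure_bwdBlock (lam := lam) (𝒲 := 𝒲) n
  refine (distortionRate_le hn ((h.achievable_zero n).mono le_rfl zero_le)).trans_eq ?_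
  rw [mul_comm, ENNReal.mul_div_cancel_right (by exact_mod_cast hn) (by simp)]

theorem liminf_distortionRate_fwd_eq_top (U : Measure ℝ) [IsProbabilityMeasure U]
    {M : ℝ≥0} (hM : ∫⁻ x, pw η x ∂U ≤ M) {ℓU : ℝ} (hℓU : 0 ≤ ℓU)
    (hU : U ≤ ENNReal.ofReal (Real.exp ℓU) • volume) {R : ℝ} (hR0 : 0 ≤ R)
    (hR : R < Real.logb 2 |lam|) :
    liminf (fun n => distortionRate η ((U.prod 𝒲).map (fwdBlock lam n)) R) atTop = ∞ := by
  have := h.prob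
  have hp' := fun n => isProbabilityMeasure_fwdBlock (lam := lam) (𝒲 := 𝒲) U n
  have h1 := Real.log_pos one_lt_two
  refine ENNReal.eq_top_of_forall_nnreal_le fun d => le_liminf_of_le (by isBoundedDefault) ?_
  have hr : ((Real.toNNReal (R * Real.log 2) : ℝ≥0) : ℝ) < Real.log |lam| := by
    rw [Real.coe_toNNReal _ (by positivity)]
    rwa [Real.logb, lt_div_iff₀ h1] at hR
  filter_upwards [h.eventually_not_achievable_fwd U hM hℓU hU hr d, eventually_gt_atTop 0]
    with n hn hn0
  by_contra hcon
  refine hn ((achievable_of_distortionRate_lt hn0.ne' (not_le.1 hcon)).mono le_rfl ?_)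
  rw [← ENNReal.ofReal_mul hR0]
  rfl

end IsNoise

/-! ### The law of the noise and of the initial value -/

section Model

theorem bwd_shift_zero (lam : ℝ) (w : ℕ → ℝ) (n : ℕ) :
    bwd lam (fun t => w (t + 1)) n 0 = -∑ i ∈ Finset.Icc 1 n, (lam ^ i)⁻¹ * w i := by
  induction n with
  | zero => simp [bwd_self]
  | succ n ih =>
    rw [bwd_add_eq _ n 1 (Nat.zero_le n), ih, bwd_of_lt _ _ (Nat.lt_succ_self n), bwd_self,
      Finset.sum_Icc_succ_top (by omega), Nat.sub_zero, pow_succ, inv_pow, mul_inv]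
    ring

theorem measurable_natCases : Measurable fun p : ℝ × (ℕ → ℝ) =>
    (fun t => Nat.casesOn t p.1 p.2 : ℕ → ℝ) := by
  refine measurable_pi_iff.2 fun t => ?_
  cases t with
  | zero => exact measurable_fst
  | succ t => exact (measurable_pi_apply t).comp measurable_snd

/-- The first term of an i.i.d. sequence is independent of the rest, which is again i.i.d. -/
theorem infinitePi_map_split (ν : Measure ℝ) [IsProbabilityMeasure ν] :
    (Measure.infinitePi fun _ : ℕ => ν).map (fun w => (w 0, fun t => w (t + 1))) =
      ν.prod (Measure.infinitePi fun _ : ℕ => ν) := by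
  set 𝒲 := Measure.infinitePi fun _ : ℕ => ν with h𝒲
  have key : (ν.prod 𝒲).map (fun p => (fun t => Nat.casesOn t p.1 p.2 : ℕ → ℝ)) = 𝒲 := by
    refine Measure.eq_infinitePi _ fun s t ht => ?_
    classical
    rw [Measure.map_apply measurable_natCases (MeasurableSet.pi s.countable_toSet fun i _ => ht i)]
    set s' : Finset ℕ := s.preimage Nat.succ Nat.succ_injective.injOn with hs'
    set t₀ : Set ℝ := if 0 ∈ s then t 0 else Set.univ with ht₀
    have e1 : (fun p : ℝ × (ℕ → ℝ) => (fun t => Nat.casesOn t p.1 p.2 : ℕ → ℝ)) ⁻¹'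
        (Set.pi s t) = t₀ ×ˢ Set.pi s' fun i => t (i + 1) := by
      ext p
      simp only [Set.mem_preimage, Set.mem_pi, Set.mem_prod, Finset.mem_coe]
      constructor
      · intro hp
        refine ⟨?_, fun i hi => hp (Nat.succ i) (Finset.mem_preimage.1 hi)⟩
        rw [ht₀]
        split_ifs with h0
        · exact hp 0 h0
        · trivial
      · rintro ⟨h0, h1⟩ i hi
        cases i with
        | zero =>
          rw [ht₀, if_pos hi] at h0
          exact h0
        | succ i => exact h1 i (Finset.mem_preimage.2 hi)
    have e2 : s.erase 0 = s'.image Nat.succ := by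
      ext i
      cases i with
      | zero => simp
      | succ i => simp [hs']
    rw [e1, Measure.prod_prod, h𝒲, Measure.infinitePi_pi _ fun i _ => ht (i + 1)]
    have e3 : ∏ i ∈ s', ν (t (i + 1)) = ∏ i ∈ s.erase 0, ν (t i) := by
      rw [e2, Finset.prod_image Nat.succ_injective.injOn]
    rw [e3]
    by_cases h0 : 0 ∈ s
    · rw [ht₀, if_pos h0]
      exact Finset.mul_prod_erase s (fun i => ν (t i)) h0
    · rw [ht₀, if_neg h0, measure_univ, one_mul, Finset.erase_eq_of_notMem h0]
  conv_lhs => rw [← key]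
  rw [Measure.map_map (by fun_prop) measurable_natCases]
  exact Measure.map_id

variable {Ω : Type*} [MeasurableSpace Ω] {P : Measure Ω} [IsProbabilityMeasure P]

theorem isNoise_of_iIndepFun {lam η K : ℝ} (hlam : 1 < |lam|) (hη : 0 < η) {W : ℕ → Ω → ℝ}
    (hW : ∀ t, Measurable (W t)) (hW_indep : iIndepFun W P) {ν : Measure ℝ}
    (hW_law : ∀ t, P.map (W t) = ν)
    (hmoment : ∀ t : ℕ, 1 ≤ t →
      ∫⁻ ω, ENNReal.ofReal (|∑ i ∈ Finset.Icc 1 t, (lam ^ i)⁻¹ * W i ω| ^ η) ∂P ≤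
        ENNReal.ofReal K) :
    IsNoise lam η (Real.toNNReal K) ν (P.map fun ω t => W t ω) := by
  have hν : IsProbabilityMeasure ν := by
    rw [← hW_law 0]
    exact Measure.isProbabilityMeasure_map (hW 0).aemeasurable
  have hWm : Measurable fun ω t => W t ω := measurable_pi_iff.2 hW
  have hpi : (P.map fun ω t => W t ω) = Measure.infinitePi fun _ : ℕ => ν := by
    rw [hW_indep.map_fun_eq_infinitePi_map hW]
    simp only [hW_law]
  have hsplit : (P.map fun ω t => W t ω).map (fun w => (w 0, fun t => w (t + 1))) =
      ν.prod (P.map fun ω t => W t ω) := by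
    rw [hpi]
    exact infinitePi_map_split ν
  refine ⟨hlam, hη, hν, Measure.isProbabilityMeasure_map hWm.aemeasurable, hsplit, fun n => ?_⟩
  rcases Nat.eq_zero_or_pos n with rfl | hn
  · simp [bwd_self, pw_zero hη]
  -- the moment assumption concerns the noise from time `1` on
  have hshift : (P.map fun ω t => W t ω) =
      (P.map fun ω t => W t ω).map fun w t => w (t + 1) := by
    have h2 := congrArg (Measure.map Prod.snd) hsplit
    have : IsProbabilityMeasure (P.map fun ω t => W t ω) :=
      Measure.isProbabilityMeasure_map hWm.aemeasurable
    rw [Measure.map_map measurable_snd (by fun_prop), Measure.map_snd_prod, measure_univ,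
      one_smul] at h2
    exact h2.symm
  rw [hshift, lintegral_map (by fun_prop) (by fun_prop)]
  simp only [bwd_shift_zero, pw_neg]
  rw [lintegral_map (by fun_prop) hWm]
  exact hmoment n hn

theorem map_prodMk_eq {X₀ : Ω → ℝ} {W : ℕ → Ω → ℝ} (hX₀ : Measurable X₀)
    (hW : ∀ t, Measurable (W t)) (hX₀_indep : IndepFun X₀ (fun ω t => W t ω) P) :
    P.map (fun ω => (X₀ ω, fun t => W t ω)) = (P.map X₀).prod (P.map fun ω t => W t ω) :=
  (indepFun_iff_map_prod_eq_prod_map_map hX₀.aemeasurable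
    (measurable_pi_iff.2 hW).aemeasurable).1 hX₀_indep

omit [IsProbabilityMeasure P] in
theorem isUniform_le {Ω₀ : ℝ} (hΩ₀ : 0 < Ω₀) {X₀ : Ω → ℝ}
    (hX₀_unif : pdf.IsUniform X₀ (Set.Icc (-Ω₀ / 2) (Ω₀ / 2)) P volume) :
    P.map X₀ ≤ ENNReal.ofReal Ω₀⁻¹ • volume := by
  have e1 : Ω₀ / 2 - -Ω₀ / 2 = Ω₀ := by ring
  rw [pdf.IsUniform] at hX₀_unif
  rw [hX₀_unif, ProbabilityTheory.cond, Real.volume_Icc, e1, ENNReal.ofReal_inv_of_pos hΩ₀]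
  intro s
  simp only [Measure.smul_apply, smul_eq_mul]
  gcongr
  exact Measure.restrict_le_self

theorem lintegral_pw_isUniform_le {η Ω₀ : ℝ} (hη : 0 < η) (hΩ₀ : 0 < Ω₀) {X₀ : Ω → ℝ}
    (hX₀ : Measurable X₀)
    (hX₀_unif : pdf.IsUniform X₀ (Set.Icc (-Ω₀ / 2) (Ω₀ / 2)) P volume) :
    ∫⁻ x, pw η x ∂(P.map X₀) ≤ (pw η Ω₀).toNNReal := by
  have : IsProbabilityMeasure (P.map X₀) := Measure.isProbabilityMeasure_map hX₀.aemeasurable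
  rw [ENNReal.coe_toNNReal (pw_ne_top _)]
  have h1 : ∀ᵐ x ∂(P.map X₀), pw η x ≤ pw η Ω₀ := by
    rw [pdf.IsUniform] at hX₀_unif
    rw [hX₀_unif, ProbabilityTheory.cond]
    refine Measure.ae_smul_measure ?_ _
    filter_upwards [ae_restrict_mem measurableSet_Icc] with x hx
    refine pw_mono hη ?_
    rw [abs_of_pos hΩ₀, abs_le]
    constructor <;> linarith [hx.1, hx.2]
  refine (lintegral_mono_ae h1).trans_eq ?_
  simp

theorem measurable_quantize (Δ : ℝ) : Measurable (quantize Δ) := by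
  unfold quantize
  simp only [round_eq]
  have : Measurable fun x : ℝ => ((⌊x / Δ + 1 / 2⌋ : ℤ) : ℝ) :=
    (measurable_from_top (f := fun k : ℤ => (k : ℝ))).comp
      (Int.measurable_floor.comp (by fun_prop))
  exact this.mul_const _

end Model

end RateDist

end

theorem theorem4 {Ω : Type*} [MeasurableSpace Ω] (P : Measure Ω) [IsProbabilityMeasure P]
    (lam η Ω₀ K : ℝ) (hlam : 1 < |lam|) (hη : 0 < η) (hΩ₀ : 0 < Ω₀)
    (X₀ : Ω → ℝ) (W : ℕ → Ω → ℝ) (hX₀ : Measurable X₀) (hW : ∀ t, Measurable (W t))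
    (hX₀_unif : pdf.IsUniform X₀ (Set.Icc (-Ω₀ / 2) (Ω₀ / 2)) P volume)
    (hW_indep : iIndepFun W P)
    (hX₀_indep : IndepFun X₀ (fun ω t => W t ω) P)
    (f : ℝ → ℝ) (hf_nonneg : ∀ x, 0 ≤ f x) (hf_meas : Measurable f)
    (hf_riemann : RateDist.LocallyRiemannIntegrable f)
    (hW_law : ∀ t, P.map (W t) = volume.withDensity fun x => ENNReal.ofReal (f x))
    (hmoment : ∀ t : ℕ, 1 ≤ t →
      ∫⁻ ω, ENNReal.ofReal (|∑ i ∈ Finset.Icc 1 t, (lam ^ i)⁻¹ * W i ω| ^ η) ∂P ≤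
        ENNReal.ofReal K) :
    -- the rate-distortion identities, for every distortion level
    (∀ d : ℝ, 0 ≤ d →
      (∃ L : ℝ → ℝ≥0∞,
        (∀ Δ : ℝ, 0 < Δ →
          Tendsto (fun n => RateDist.condRateDistortion η
            (RateDist.bwdJointLaw P lam W (RateDist.quantize Δ) n) d) atTop (𝓝 (L Δ))) ∧
        Tendsto L (𝓝[>] 0)
          (𝓝 (RateDist.rateDistortionInf η (RateDist.bwdLaw P lam W) d))) ∧
      Tendsto (fun n => RateDist.condRateDistortion η
          (RateDist.bwdJointLaw P lam W id n) d) atTop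
        (𝓝 (RateDist.rateDistortionInf η (RateDist.bwdLaw P lam W) d)) ∧
      (RateDist.rateDistortionInf η (RateDist.bwdLaw P lam W) d : EReal) =
        (RateDist.rateDistortionInf η (RateDist.fwdLaw P lam X₀ W) d : EReal) -
          ((Real.logb 2 |lam| : ℝ) : EReal)) ∧
    -- the identity of the distortion-rate functions
    (∀ R : ℝ, Real.logb 2 |lam| < R →
      RateDist.distortionRateInf η (RateDist.fwdLaw P lam X₀ W) R =
        RateDist.distortionRateInf η (RateDist.bwdLaw P lam W) (R - Real.logb 2 |lam|)) ∧
    -- the phase transition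
    (∀ R : ℝ, 0 ≤ R → R < Real.logb 2 |lam| →
      RateDist.distortionRateInf η (RateDist.fwdLaw P lam X₀ W) R = ∞) ∧
    (∃ C : ℝ≥0, ∀ R : ℝ, Real.logb 2 |lam| < R →
      RateDist.distortionRateInf η (RateDist.fwdLaw P lam X₀ W) R ≤ C) := by
  have h := RateDist.isNoise_of_iIndepFun hlam hη hW hW_indep hW_law hmoment
  have hν : (volume.withDensity fun x => ENNReal.ofReal (f x)) ≪ (volume : Measure ℝ) :=
    withDensity_absolutelyContinuous _ _
  have hWm : Measurable fun ω t => W t ω := measurable_pi_iff.2 hW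
  have hlog0 : 0 ≤ Real.logb 2 |lam| := Real.logb_nonneg one_lt_two hlam.le
  have hUp : IsProbabilityMeasure (P.map X₀) := Measure.isProbabilityMeasure_map hX₀.aemeasurable
  have hU := RateDist.exp_max_log_inv hΩ₀ _ (RateDist.isUniform_le hΩ₀ hX₀_unif)
  have hM := RateDist.lintegral_pw_isUniform_le hη hΩ₀ hX₀ hX₀_unif
  have hℓU := le_max_left 0 (Real.log Ω₀⁻¹)
  have hbwd : RateDist.bwdLaw P lam W =
      fun n => (P.map fun ω t => W t ω).map (RateDist.bwdBlock lam n) := by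
    ext1 n
    rw [Measure.map_map (by fun_prop) hWm]
    rfl
  have hfwd : RateDist.fwdLaw P lam X₀ W = fun n =>
      ((P.map X₀).prod (P.map fun ω t => W t ω)).map (RateDist.fwdBlock lam n) := by
    ext1 n
    rw [← RateDist.map_prodMk_eq hX₀ hW hX₀_indep,
      Measure.map_map (by fun_prop) (hX₀.prodMk hWm)]
    rfl
  have hprob := h.prob
  have hjoint : ∀ (g : ℝ → ℝ), Measurable g → ∀ n d,
      RateDist.condRateDistortion η (RateDist.bwdJointLaw P lam W g n) d =
        RateDist.condRateDistortion η ((P.map fun ω t => W t ω).map fun w =>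
          (g (RateDist.bwd lam w n 0), RateDist.bwdBlock lam n w)) d := by
    intro g hg n d
    refine RateDist.condRateDistortion_congr ?_ d
    rw [Measure.map_map (by fun_prop) hWm]
    rfl
  rw [hbwd, hfwd]
  simp only [RateDist.rateDistortionInf, RateDist.distortionRateInf]
  -- the limit over `n` does not depend on the step of the quantizer
  refine ⟨fun d hd => ⟨⟨fun _ => _, fun Δ hΔ => ?_, tendsto_const_nhds⟩, ?_, ?_⟩, fun R hR => ?_,
    fun R hR0 hR => ?_, Real.toNNReal K, fun R hR => ?_⟩
  · simp only [hjoint _ (RateDist.measurable_quantize Δ)]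
    exact (h.tendsto_rates hν hd).2 _ (RateDist.measurable_quantize Δ)
  · simp only [hjoint _ measurable_id]
    exact (h.tendsto_rates hν hd).2 _ measurable_id
  · rw [h.liminf_rateDistortion_fwd hν _ hM hℓU hU hd, EReal.coe_ennreal_add,
      EReal.coe_ennreal_ofReal, max_eq_left hlog0]
    exact (EReal.add_sub_cancel_right).symm
  · exact h.liminf_distortionRate_fwd _ hM hℓU hU hR
  · exact h.liminf_distortionRate_fwd_eq_top _ hM hℓU hU hR0 hR
  · rw [h.liminf_distortionRate_fwd _ hM hℓU hU hR]
    refine (liminf_le_liminf ((eventually_gt_atTop 0).mono fun n hn =>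
      h.distortionRate_bwd_le hn.ne' _)).trans_eq (liminf_const _)
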